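/- There are absolute constants $\alpha > 0$ and $p > 0$ such that for all integers $k$ and $\ell$ with $2 \le \ell \le k^{0.1}$ there exist $d \in \mathbb{N}$ and a finite nonempty (unweighted) point set $X \subseteq \mathbb{R}^d$ for which the following holds. For $x\in\mathbb{R}^d$ and a finite nonempty $C \subseteq \mathbb{R}^d$ write $\phi(x, C) = \min_{c \in C} \|x - c\|_2^2$ and $\phi(X, C) = \sum_{x \in X} \phi(x, C)$, and let $\mathrm{OPT}_k(X) = \inf\{\phi(X, C) : C \subseteq \mathbb{R}^d,\ |C| = k\}$ be the optimal $k$-means cost. Greedy $k$-means++ starts with $C_0 = \emptyset$ and for $i = 0, \dots, k-1$ independently samples $\ell$ candidate centers $c_{i+1}^1, \dots, c_{i+1}^\ell \in X$, uniformly from $X$ if $i = 0$ and taking $x\in X$ with probability $\phi(x, C_i)/\phi(X, C_i)$ if $i \ge 1$; it then sets $C_{i+1} = C_i \cup \{c_{i+1}\}$, where $c_{i+1}$ is a candidate $c$ minimizing $\phi(X, C_i \cup \{c\})$ (ties broken by an arbitrary fixed rule depending on $C_i$ and the candidates). It returns $C_k$. Then $\mathrm{OPT}_k(X) > 0$, and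 for every tie-breaking rule, with probability at least $p$ the set $C_k$ returned by greedy $k$-means++ satisfies $$\phi(X, C_k) \;\ge\; \alpha \cdot \frac{\ell^3 \log^3 k}{\log^2(\ell \log k)} \cdot \mathrm{OPT}_k(X).$$ -/

import Mathlib

noncomputable section

namespace KMeans

open scoped ENNReal

/-- The ambient Euclidean space `ℝ^d`. -/
abbrev Pt (d : ℕ) : Type := EuclideanSpace ℝ (Fin d)

/-- `φ(x, C) = min_{c ∈ C} ‖x - c‖²`, the cost of the point `x` with respect to a nonempty finite
set of centers `C` (the value for `C = ∅` is `0` and is not used). -/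
def pointCost {d : ℕ} (x : Pt d) (C : Finset (Pt d)) : ℝ :=
  ⨅ c : C, ‖x - (c : Pt d)‖ ^ 2

/-- `φ(X, C) = ∑_{x ∈ X} φ(x, C)`. -/
def cost {d : ℕ} (X C : Finset (Pt d)) : ℝ :=
  ∑ x ∈ X, pointCost x C

/-- The optimal `k`-means cost of `X`: the infimum of `φ(X, C)` over all sets `C` of `k` centers
in `ℝ^d` (not necessarily points of `X`). -/
def opt {d : ℕ} (X : Finset (Pt d)) (k : ℕ) : ℝ :=
  ⨅ C : {C : Finset (Pt d) // C.card = k}, cost X C.1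

theorem pointCost_nonneg {d : ℕ} (x : Pt d) (C : Finset (Pt d)) : 0 ≤ pointCost x C :=
  Real.iInf_nonneg fun _ => sq_nonneg _

open Classical in
/-- The distribution on `X` that gives `x ∈ X` the probability `φ(x, C) / φ(X, C)`. -/
def costPMF {d : ℕ} (X C : Finset (Pt d)) (h : 0 < cost X C) : PMF (Pt d) :=
  PMF.ofFinset (fun x => if x ∈ X then ENNReal.ofReal (pointCost x C / cost X C) else 0) X
    (by
      rw [Finset.sum_congr rfl fun x hx => if_pos hx,
        ← ENNReal.ofReal_sum_of_nonneg fun x _ => div_nonneg (pointCost_nonneg x C) h.le,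
        ← Finset.sum_div]
      change ENNReal.ofReal (cost X C / cost X C) = 1
      rw [div_self h.ne', ENNReal.ofReal_one])
    (fun _ hx => if_neg hx)

open Classical in
/-- The distribution of one candidate center when `C` is the current set of centers: uniform on `X`
in the first step (`C = ∅`), and proportional to the current cost afterwards. (If all points of `X`
already have cost `0`, the candidates are drawn uniformly by convention.) -/
def candidatePMF {d : ℕ} (X : Finset (Pt d)) (hX : X.Nonempty) (C : Finset (Pt d)) :
    PMF (Pt d) :=
  if h : C.Nonempty ∧ 0 < cost X C then costPMF X C h.2 else PMF.uniformOfFinset X hX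

/-- `l` independent samples from `μ`. -/
def iidPMF {α : Type*} (μ : PMF α) : (l : ℕ) → PMF (Fin l → α)
  | 0 => PMF.pure Fin.elim0
  | l + 1 => μ.bind fun a => (iidPMF μ l).map fun c => (Fin.cons a c : Fin (l + 1) → α)

/-- A rule that, given the current centers and `l` candidates, names one of the candidates. -/
abbrev Rule (d l : ℕ) : Type := Finset (Pt d) → (Fin l → Pt d) → Fin l

open Classical in
/-- The rule always names a candidate `c` that minimizes `φ(X, C ∪ {c})`; ties may be broken in
any way. -/
def IsGreedyRule {d l : ℕ} (X : Finset (Pt d)) (r : Rule d l) : Prop :=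
  ∀ (C : Finset (Pt d)) (c : Fin l → Pt d) (j : Fin l),
    cost X (insert (c (r C c)) C) ≤ cost X (insert (c j) C)

open Classical in
/-- The law of the set `C_i` of centers after `i` steps of the seeding procedure on `X` with `l`
candidates per step, the new center being chosen among the candidates by the rule `r`. For a greedy
rule `r` this is greedy `k`-means++, whose output on input `(X, k, l)` is `C_k`. -/
def seedingPMF {d l : ℕ} (X : Finset (Pt d)) (hX : X.Nonempty) (r : Rule d l) :
    ℕ → PMF (Finset (Pt d))
  | 0 => PMF.pure ∅
  | i + 1 => (seedingPMF X hX r i).bind fun C =>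
      (iidPMF (candidatePMF X hX C) l).map fun c => insert (c (r C c)) C

end KMeans

end

/-! ### Laws of independent samples and of the seeding process -/

noncomputable section

namespace KMeans

open scoped ENNReal

/-! Put T = ℓ log k. The instance has k + 1 locations. The locations `core` and `decoy` are at
squared distance at most 2, while every other pair is at squared distance at least a². Omitting only
`decoy` shows that OPT is at most 3 (`opt_le_three`). If a run covers both `core` and `decoy`, then
some other location stays uncovered and costs at least a² (`isSuccess`). It remains to make greedy
cover first `decoy` and later `core` with constant probability, for a² of order T³ / log² T.

Towards the decoy. At the start of phase j the center nearest to the core is at distance ρ j (the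
base, or shell j - 1), where ρ j = ρ (j + 1) ^ 4 is huge. A new center close to the core gains about
W ρ j ^ 2, with W the weight of the ball, and the greedy order is decided by lower order terms.
Shell j and the decoy have positive inner product with lure j, worth 2 ρ j ρ (j + 1) and 2 ρ j / P,
whereas the core gets no such bonus. The s fillers of the phase hang off the base in private
orthogonal directions and cost W ρ j ^ 2 + ρ (j + 1) ^ 3, which lies strictly in between. Hence
greedy takes the shell or the decoy if one of them is sampled, otherwise a filler if one is sampled,
and only otherwise anything else, such as the core. With u fillers left the last event has
probability O(1 / u²), because ℓ ≥ 2, and this is summable. The shell is sampled at rate about ℓ P /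
(n u) with n = 12 P². Summed over u this is of order T / P, so P of order T / log T makes a phase
end as planned up to an error O(1 / P). The shell has weight P and the decoy weight 1, so the decoy
ends the phase with probability of order 1 / P. If the shell ends it, the next phase is a fresh
attempt, and P phases give a constant probability.

From the decoy to the core. The satellites lean away from the decoy, so covering the core saves 2a
on each of the 8a satellites. That is 16 a² in total, more than the cost 15 a² of a light filler,
which in turn exceeds the gain 14 a² that bounds a satellite. The core has weight n and is sampled
at rate about ℓ n / (a² v) when v light fillers are left. Summed over v this is of order T P² / a²,
a constant for a² of order P² T, which is T³ / log² T.

Between these runs the scales separate the process: uncovered locations of the largest remaining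
scale carry almost all the cost and have the largest gains, so they are covered first up to an error
τ per step (`Trans.gain_lt`, `Taken.le_stepProb`).

Multiplicities are realized by genuinely distinct points at a tiny mutual distance
(`IsRealization`). The one-step estimate is `IsRealization.stepProb_succ_ge`, `runErr` accounts for
a whole run, and `Loc.le_stepProb` combines everything by induction on the number of remaining
steps. Small k is absorbed by the constant α. -/

theorem iidPMF_apply {α : Type*} (μ : PMF α) :
    ∀ (l : ℕ) (c : Fin l → α), iidPMF μ l c = ∏ i, μ (c i)
  | 0, c => by
    have : c = Fin.elim0 := funext fun i => i.elim0
    simp [iidPMF, this]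
  | l + 1, c => by
    classical
    rw [iidPMF, PMF.bind_apply, tsum_eq_single (c 0), Fin.prod_univ_succ, PMF.map_apply,
      tsum_eq_single (fun i => c i.succ)]
    · rw [if_pos, iidPMF_apply μ l]
      exact (Fin.cons_self_tail c).symm
    · intro t ht
      rw [if_neg]
      intro h
      apply ht
      funext i
      rw [h, Fin.cons_succ]
    · intro a ha
      rw [PMF.map_apply]
      convert mul_zero _
      rw [ENNReal.tsum_eq_zero]
      intro t
      rw [if_neg]
      intro h
      apply ha
      rw [h, Fin.cons_zero]

/-- The expectation of `g` under `l` independent samples from a law carried by the range of `p`. -/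
theorem tsum_iidPMF {α S : Type*} [Fintype S] (μ : PMF α) (p : S → α)
    (hp : Function.Injective p) (hμ : ∀ a, a ∉ Set.range p → μ a = 0) (l : ℕ)
    (g : (Fin l → α) → ℝ≥0∞) :
    ∑' c, iidPMF μ l c * g c = ∑ σ : Fin l → S, (∏ i, μ (p (σ i))) * g (p ∘ σ) := by
  have hinj : Function.Injective fun σ : Fin l → S => p ∘ σ := hp.comp_left
  rw [← hinj.tsum_eq, tsum_fintype]
  · simp [iidPMF_apply]
  · intro c hc
    rw [Function.mem_support] at hc
    have h : ∀ i, c i ∈ Set.range p := by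
      intro i
      by_contra hi
      apply hc
      rw [iidPMF_apply, Finset.prod_eq_zero (Finset.mem_univ i) (hμ _ hi), zero_mul]
    choose σ hσ using h
    exact ⟨σ, funext hσ⟩

open Classical in
/-- The law of the set of centers after one more step. -/
def stepPMF {d l : ℕ} (X : Finset (Pt d)) (hX : X.Nonempty) (r : Rule d l)
    (C : Finset (Pt d)) : PMF (Finset (Pt d)) :=
  (iidPMF (candidatePMF X hX C) l).map fun c => insert (c (r C c)) C

/-- The law of the set of centers after `m` more steps, starting from `C`. -/
def iterPMF {d l : ℕ} (X : Finset (Pt d)) (hX : X.Nonempty) (r : Rule d l) :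
    ℕ → Finset (Pt d) → PMF (Finset (Pt d))
  | 0, C => PMF.pure C
  | m + 1, C => (stepPMF X hX r C).bind (iterPMF X hX r m)

theorem seedingPMF_succ {d l : ℕ} (X : Finset (Pt d)) (hX : X.Nonempty) (r : Rule d l) (i : ℕ) :
    seedingPMF X hX r (i + 1) = (seedingPMF X hX r i).bind (stepPMF X hX r) := rfl

theorem seedingPMF_add {d l : ℕ} (X : Finset (Pt d)) (hX : X.Nonempty) (r : Rule d l) :
    ∀ m i : ℕ, seedingPMF X hX r (i + m) = (seedingPMF X hX r i).bind (iterPMF X hX r m)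
  | 0, i => by
    change _ = (seedingPMF X hX r i).bind PMF.pure
    rw [PMF.bind_pure, add_zero]
  | m + 1, i => by
    rw [show i + (m + 1) = (i + 1) + m by ring, seedingPMF_add X hX r m (i + 1), seedingPMF_succ,
      PMF.bind_bind]
    rfl

theorem seedingPMF_eq_iterPMF {d l : ℕ} (X : Finset (Pt d)) (hX : X.Nonempty) (r : Rule d l)
    (m : ℕ) : seedingPMF X hX r m = iterPMF X hX r m ∅ := by
  have := seedingPMF_add X hX r m 0
  rw [zero_add] at this
  rw [this, seedingPMF, PMF.pure_bind]

/-- The probability of the event `Ev` after `m` more steps, starting from `C`. -/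
def stepProb {d l : ℕ} (X : Finset (Pt d)) (hX : X.Nonempty) (r : Rule d l)
    (Ev : Set (Finset (Pt d))) (m : ℕ) (C : Finset (Pt d)) : ℝ :=
  ((iterPMF X hX r m C).toOuterMeasure Ev).toReal

section
variable {d l : ℕ} (X : Finset (Pt d)) (hX : X.Nonempty) (r : Rule d l)
  (Ev : Set (Finset (Pt d)))

theorem iterPMF_toOuterMeasure_le_one (m : ℕ) (C : Finset (Pt d)) :
    (iterPMF X hX r m C).toOuterMeasure Ev ≤ 1 := by
  refine (MeasureTheory.OuterMeasure.mono _ (Set.subset_univ Ev)).trans ?_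
  exact ((PMF.toOuterMeasure_apply_eq_one_iff _ _).2 (Set.subset_univ _)).le

theorem iterPMF_toOuterMeasure_ne_top (m : ℕ) (C : Finset (Pt d)) :
    (iterPMF X hX r m C).toOuterMeasure Ev ≠ ∞ :=
  ((iterPMF_toOuterMeasure_le_one X hX r Ev m C).trans_lt ENNReal.one_lt_top).ne

theorem stepProb_nonneg (m : ℕ) (C : Finset (Pt d)) : 0 ≤ stepProb X hX r Ev m C :=
  ENNReal.toReal_nonneg

theorem ofReal_stepProb (m : ℕ) (C : Finset (Pt d)) :
    ENNReal.ofReal (stepProb X hX r Ev m C) = (iterPMF X hX r m C).toOuterMeasure Ev :=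
  ENNReal.ofReal_toReal (iterPMF_toOuterMeasure_ne_top X hX r Ev m C)

-- Candidates come from finitely many points, so conditioning on the next step is a finite sum of
-- real numbers; all later estimates start from this recursion.
open Classical in
theorem stepProb_succ {S : Type*} [Fintype S] (p : S → Pt d) (hp : Function.Injective p)
    (m : ℕ) (C : Finset (Pt d)) (hμ : ∀ a, a ∉ Set.range p → candidatePMF X hX C a = 0) :
    stepProb X hX r Ev (m + 1) C =
      ∑ σ : Fin l → S, (∏ i, (candidatePMF X hX C (p (σ i))).toReal) *
        stepProb X hX r Ev m (insert (p (σ (r C (p ∘ σ)))) C) := by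
  have h : (iterPMF X hX r (m + 1) C).toOuterMeasure Ev =
      ∑ σ : Fin l → S, (∏ i, candidatePMF X hX C (p (σ i))) *
        (iterPMF X hX r m (insert (p (σ (r C (p ∘ σ)))) C)).toOuterMeasure Ev := by
    have := tsum_iidPMF (candidatePMF X hX C) p hp hμ l
      (fun c => (iterPMF X hX r m (insert (c (r C c)) C)).toOuterMeasure Ev)
    rw [iterPMF, stepPMF, PMF.bind_map, PMF.toOuterMeasure_bind_apply]
    exact this
  rw [stepProb, h, ENNReal.toReal_sum]
  · refine Finset.sum_congr rfl fun σ _ => ?_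
    rw [ENNReal.toReal_mul, ENNReal.toReal_prod]
    rfl
  · intro σ _
    refine ENNReal.mul_ne_top ?_ (iterPMF_toOuterMeasure_ne_top X hX r Ev _ _)
    exact ENNReal.prod_ne_top fun i _ => PMF.apply_ne_top _ _

theorem subset_of_mem_support_iterPMF :
    ∀ (m : ℕ) (C C' : Finset (Pt d)), C' ∈ (iterPMF X hX r m C).support → C ⊆ C'
  | 0, C, C', h => by
    rw [iterPMF, PMF.support_pure, Set.mem_singleton_iff] at h
    rw [h]
  | m + 1, C, C', h => by
    classical
    rw [iterPMF, PMF.mem_support_bind_iff] at h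
    obtain ⟨C₁, h₁, h₂⟩ := h
    rw [stepPMF, PMF.mem_support_map_iff] at h₁
    obtain ⟨c, -, rfl⟩ := h₁
    exact (Finset.subset_insert _ _).trans (subset_of_mem_support_iterPMF m _ _ h₂)

theorem stepProb_eq_one (m : ℕ) (C : Finset (Pt d)) (h : ∀ C', C ⊆ C' → C' ∈ Ev) :
    stepProb X hX r Ev m C = 1 := by
  rw [stepProb, (PMF.toOuterMeasure_apply_eq_one_iff _ _).2, ENNReal.toReal_one]
  intro C' hC'
  exact h C' (subset_of_mem_support_iterPMF X hX r m C C' hC')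

theorem card_of_mem_support_iterPMF :
    ∀ (m : ℕ) (C C' : Finset (Pt d)), C' ∈ (iterPMF X hX r m C).support →
      C'.card ≤ C.card + m ∧ (0 < m → C'.Nonempty)
  | 0, C, C', h => by
    rw [iterPMF, PMF.support_pure, Set.mem_singleton_iff] at h
    rw [h]
    exact ⟨le_rfl, fun h => absurd h (lt_irrefl _)⟩
  | m + 1, C, C', h => by
    classical
    have h' := h
    rw [iterPMF, PMF.mem_support_bind_iff] at h
    obtain ⟨C₁, h₁, h₂⟩ := h
    rw [stepPMF, PMF.mem_support_map_iff] at h₁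
    obtain ⟨c, -, rfl⟩ := h₁
    have h₃ := card_of_mem_support_iterPMF m _ _ h₂
    have h₄ := Finset.card_insert_le (c (r C c)) C
    refine ⟨by omega, fun _ => ?_⟩
    exact ⟨_, subset_of_mem_support_iterPMF X hX r m _ _ h₂ (Finset.mem_insert_self _ _)⟩

end

/-! ### Weighted locations, their realization by points, and one greedy step -/

open scoped ENNReal

open Classical in
/-- A lower bound for the expectation of `g` over independent samples from `μ`, when the value of
`g` is controlled by the smallest of three nested sets that contains all samples. -/
theorem sum_prod_mul_ge {S : Type*} [Fintype S] {l : ℕ} (μ : S → ℝ) (hμ : ∀ s, 0 ≤ μ s)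
    (hsum : ∑ s, μ s = 1) (B₁ B₂ B₃ : Finset S) (h₂₁ : B₂ ⊆ B₁) (h₃₂ : B₃ ⊆ B₂)
    (g : (Fin l → S) → ℝ) (hg : ∀ σ, 0 ≤ g σ) (x₀ x₁ x₂ : ℝ)
    (h₀ : ∀ σ, (∃ i, σ i ∉ B₁) → x₀ ≤ g σ)
    (h₁ : ∀ σ, (∀ i, σ i ∈ B₁) → (∃ i, σ i ∉ B₂) → x₁ ≤ g σ)
    (h₂ : ∀ σ, (∀ i, σ i ∈ B₂) → (∃ i, σ i ∉ B₃) → x₂ ≤ g σ) :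
    x₀ * (1 - (∑ s ∈ B₁, μ s) ^ l) + x₁ * ((∑ s ∈ B₁, μ s) ^ l - (∑ s ∈ B₂, μ s) ^ l) +
      x₂ * ((∑ s ∈ B₂, μ s) ^ l - (∑ s ∈ B₃, μ s) ^ l) ≤
      ∑ σ : Fin l → S, (∏ i, μ (σ i)) * g σ := by
  -- The power is the probability that all samples lie in `B`; expanding it turns the claim into a
  -- pointwise inequality for each tuple of samples.
  have key : ∀ B : Finset S, (∑ s ∈ B, μ s) ^ l =
      ∑ σ : Fin l → S, (∏ i, μ (σ i)) * if ∀ i, σ i ∈ B then 1 else 0 := by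
    intro B
    have h := Finset.prod_univ_sum (fun _ : Fin l => B) (fun _ s => μ s)
    rw [Finset.prod_const, Finset.card_univ, Fintype.card_fin] at h
    rw [h]
    simp_rw [mul_ite, mul_one, mul_zero]
    rw [← Finset.sum_filter]
    refine Finset.sum_congr ?_ fun _ _ => rfl
    ext σ
    simp [Fintype.mem_piFinset]
  have hone : (1 : ℝ) = ∑ σ : Fin l → S, ∏ i, μ (σ i) := by
    have h := key Finset.univ
    simpa [hsum] using h
  have hrw : x₀ * (1 - (∑ s ∈ B₁, μ s) ^ l) +
      x₁ * ((∑ s ∈ B₁, μ s) ^ l - (∑ s ∈ B₂, μ s) ^ l) +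
      x₂ * ((∑ s ∈ B₂, μ s) ^ l - (∑ s ∈ B₃, μ s) ^ l) =
      ∑ σ : Fin l → S, (∏ i, μ (σ i)) *
        (x₀ * (1 - if ∀ i, σ i ∈ B₁ then 1 else 0) +
          x₁ * ((if ∀ i, σ i ∈ B₁ then 1 else 0) - if ∀ i, σ i ∈ B₂ then 1 else 0) +
          x₂ * ((if ∀ i, σ i ∈ B₂ then 1 else 0) - if ∀ i, σ i ∈ B₃ then 1 else 0)) := by
    have hsub : 1 - (∑ s ∈ B₁, μ s) ^ l =
        ∑ σ : Fin l → S, (∏ i, μ (σ i)) * (1 - if ∀ i, σ i ∈ B₁ then 1 else 0) := by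
      simp only [mul_sub, Finset.sum_sub_distrib, mul_one]
      rw [← hone, ← key]
    rw [hsub, key B₁, key B₂, key B₃]
    simp only [← Finset.sum_sub_distrib, Finset.mul_sum, ← Finset.sum_add_distrib]
    refine Finset.sum_congr rfl fun σ _ => ?_
    ring
  rw [hrw]
  refine Finset.sum_le_sum fun σ _ => ?_
  refine mul_le_mul_of_nonneg_left ?_ (Finset.prod_nonneg fun i _ => hμ _)
  by_cases c₁ : ∀ i, σ i ∈ B₁
  · by_cases c₂ : ∀ i, σ i ∈ B₂
    · by_cases c₃ : ∀ i, σ i ∈ B₃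
      · simpa [c₁, c₂, c₃] using hg σ
      · simpa [c₁, c₂, c₃] using h₂ σ c₂ (by push Not at c₃; exact c₃)
    · have c₃ : ¬ ∀ i, σ i ∈ B₃ := fun h => c₂ fun i => h₃₂ (h i)
      simpa [c₁, c₂, c₃] using h₁ σ c₁ (by push Not at c₂; exact c₂)
  · have c₂ : ¬ ∀ i, σ i ∈ B₂ := fun h => c₁ fun i => h₂₁ (h i)
    have c₃ : ¬ ∀ i, σ i ∈ B₃ := fun h => c₂ fun i => h₃₂ (h i)
    simpa [c₁, c₂, c₃] using h₀ σ (by push Not at c₁; exact c₁)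

/-- The smallest value of `D v a` over `a ∈ A`. -/
def setDist {V : Type*} (D : V → V → ℝ) (A : Finset V) (v : V) : ℝ := ⨅ a : A, D v a

/-- The cost of the weighted points `V` with respect to the centers `A`. -/
def locCost {V : Type*} [Fintype V] (w : V → ℕ) (D : V → V → ℝ) (A : Finset V) : ℝ :=
  ∑ v, (w v : ℝ) * setDist D A v

theorem setDist_le {V : Type*} (D : V → V → ℝ) {A : Finset V} (v : V) {a : V} (ha : a ∈ A) :
    setDist D A v ≤ D v a :=
  ciInf_le (Set.finite_range fun a : A => D v a).bddBelow ⟨a, ha⟩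

theorem le_setDist {V : Type*} (D : V → V → ℝ) {A : Finset V} (hA : A.Nonempty) (v : V) {x : ℝ}
    (h : ∀ a ∈ A, x ≤ D v a) : x ≤ setDist D A v := by
  have : Nonempty A := hA.to_subtype
  exact le_ciInf fun a => h a a.2

open Classical in
theorem setDist_insert {V : Type*} (D : V → V → ℝ) {A : Finset V} (hA : A.Nonempty) (u v : V) :
    setDist D (insert u A) v = min (setDist D A v) (D v u) := by
  apply le_antisymm
  · refine le_min ?_ (setDist_le D v (Finset.mem_insert_self u A))
    exact le_setDist D hA v fun a ha => setDist_le D v (Finset.mem_insert_of_mem ha)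
  · refine le_setDist D (Finset.insert_nonempty _ _) v fun a ha => ?_
    rcases Finset.mem_insert.1 ha with rfl | ha
    · exact min_le_right _ _
    · exact (min_le_left _ _).trans (setDist_le D v ha)

/-- The weighted points `V` with squared distances `D`, each point `v` being replaced by `w v`
points of `ℝ^d` in such a way that distinct points have squared distance `D v v' + e`. -/
structure IsRealization {V : Type*} (w : V → ℕ) (D : V → V → ℝ) (e : ℝ) {d : ℕ}
    (p : (Σ v, Fin (w v)) → Pt d) : Prop where
  e_pos : 0 < e
  w_pos : ∀ v, 0 < w v
  norm_sq : ∀ s t, ‖p s - p t‖ ^ 2 = D s.1 t.1 + open Classical in if s = t then 0 else e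
  nonneg : ∀ u v, 0 ≤ D u v

namespace IsRealization

variable {V : Type*} {w : V → ℕ} {D : V → V → ℝ} {e : ℝ} {d : ℕ}
  {p : (Σ v, Fin (w v)) → Pt d} (h : IsRealization w D e p)
include h

theorem self (v : V) : D v v = 0 := by
  have := h.norm_sq ⟨v, ⟨0, h.w_pos v⟩⟩ ⟨v, ⟨0, h.w_pos v⟩⟩
  simpa using this.symm

theorem injective : Function.Injective p := by
  intro s t hst
  by_contra hne
  have := h.norm_sq s t
  rw [hst, sub_self, norm_zero, if_neg hne] at this
  have h₁ := h.nonneg s.1 t.1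
  have h₂ := h.e_pos
  norm_num at this
  linarith

theorem setDist_nonneg (A : Finset V) (v : V) : 0 ≤ setDist D A v :=
  Real.iInf_nonneg fun _ => h.nonneg _ _

theorem setDist_eq_zero {A : Finset V} {v : V} (hv : v ∈ A) : setDist D A v = 0 :=
  le_antisymm ((setDist_le D v hv).trans (h.self v).le) (h.setDist_nonneg A v)

-- The perturbation is charged to exactly those points that are not centers. Hence the total cost is
-- the cost of the locations plus a term that depends only on the number of centers.
open Classical in
theorem pointCost_eq {C : Finset (Σ v, Fin (w v))} (hC : C.Nonempty) (s : Σ v, Fin (w v)) :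
    pointCost (p s) (C.image p) =
      setDist D (C.image Sigma.fst) s.1 + if s ∈ C then 0 else e := by
  have hle : ∀ c ∈ C.image p, pointCost (p s) (C.image p) ≤ ‖p s - c‖ ^ 2 := fun c hc =>
    ciInf_le (Set.finite_range fun c : (C.image p : Finset (Pt d)) => ‖p s - (c : Pt d)‖ ^ 2).bddBelow
      ⟨c, hc⟩
  by_cases hs : s ∈ C
  · rw [if_pos hs, add_zero, h.setDist_eq_zero (Finset.mem_image_of_mem _ hs)]
    refine le_antisymm ?_ (pointCost_nonneg _ _)
    have := hle (p s) (Finset.mem_image_of_mem _ hs)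
    simpa using this
  · rw [if_neg hs]
    have : Nonempty (C.image p) := (hC.image p).to_subtype
    apply le_antisymm
    · rw [← sub_le_iff_le_add]
      refine le_setDist D (hC.image _) _ fun a ha => ?_
      obtain ⟨t, ht, rfl⟩ := Finset.mem_image.1 ha
      have := hle (p t) (Finset.mem_image_of_mem _ ht)
      rw [h.norm_sq, if_neg (by rintro rfl; exact hs ht)] at this
      linarith
    · refine le_ciInf fun c => ?_
      obtain ⟨t, ht, hc⟩ := Finset.mem_image.1 c.2
      rw [← hc, h.norm_sq, if_neg (by rintro rfl; exact hs ht)]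
      have := setDist_le D s.1 (Finset.mem_image_of_mem Sigma.fst ht)
      linarith

variable [Fintype V]

omit h in
theorem sum_sigma_fst (f : V → ℝ) :
    ∑ s : (Σ v, Fin (w v)), f s.1 = ∑ v, (w v : ℝ) * f v := by
  rw [Fintype.sum_sigma]
  simp

open Classical in
omit h in
theorem sum_sigma_filter (L : Finset V) (f : V → ℝ) :
    ∑ s : (Σ v, Fin (w v)) with s.1 ∈ L, f s.1 = ∑ v ∈ L, (w v : ℝ) * f v := by
  rw [Finset.sum_filter, sum_sigma_fst (fun v => if v ∈ L then f v else 0)]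
  simp

/-- The points that realize `V`. -/
def points (_h : IsRealization w D e p) : Finset (Pt d) := Finset.univ.map ⟨p, _h.injective⟩

theorem mem_points {x : Pt d} : x ∈ h.points ↔ ∃ s, p s = x := by
  simp [points]

open Classical in
theorem cost_eq {C : Finset (Σ v, Fin (w v))} (hC : C.Nonempty) :
    cost h.points (C.image p) = locCost w D (C.image Sigma.fst) +
      e * (Fintype.card (Σ v, Fin (w v)) - C.card) := by
  rw [cost, points, Finset.sum_map]
  simp only [Function.Embedding.coeFn_mk]
  rw [Finset.sum_congr rfl fun s _ => h.pointCost_eq hC s, Finset.sum_add_distrib,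
    sum_sigma_fst (fun v => setDist D (C.image Sigma.fst) v)]
  congr 1
  have : ∀ s : (Σ v, Fin (w v)), (if s ∈ C then 0 else e) = e - if s ∈ C then e else 0 := by
    intro s
    split_ifs <;> ring
  rw [Finset.sum_congr rfl fun s _ => this s, Finset.sum_sub_distrib]
  simp
  ring

theorem card_points : h.points.card = Fintype.card (Σ v, Fin (w v)) := by
  rw [points, Finset.card_map, Finset.card_univ]

theorem candidatePMF_eq_zero (hX : h.points.Nonempty) (C : Finset (Pt d)) (a : Pt d)
    (ha : a ∉ Set.range p) : candidatePMF h.points hX C a = 0 := by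
  classical
  have hm : a ∉ h.points := fun hm => ha (h.mem_points.1 hm)
  rw [candidatePMF]
  split_ifs with hc
  · rw [costPMF, PMF.ofFinset_apply, if_neg hm]
  · rw [PMF.uniformOfFinset_apply, if_neg hm]

open Classical in
theorem candidatePMF_apply (hX : h.points.Nonempty) {C : Finset (Σ v, Fin (w v))}
    (hC : C.Nonempty) (hpos : 0 < cost h.points (C.image p)) (s : Σ v, Fin (w v)) :
    (candidatePMF h.points hX (C.image p) (p s)).toReal =
      (setDist D (C.image Sigma.fst) s.1 + if s ∈ C then 0 else e) /
        cost h.points (C.image p) := by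
  rw [candidatePMF, dif_pos ⟨hC.image p, hpos⟩, costPMF, PMF.ofFinset_apply,
    if_pos (h.mem_points.2 ⟨s, rfl⟩), ENNReal.toReal_ofReal
      (div_nonneg (pointCost_nonneg _ _) hpos.le), h.pointCost_eq hC]

theorem sum_candidatePMF (hX : h.points.Nonempty) (C : Finset (Pt d)) :
    ∑ s, (candidatePMF h.points hX C (p s)).toReal = 1 := by
  rw [← ENNReal.toReal_sum fun s _ => PMF.apply_ne_top _ _]
  rw [← ENNReal.toReal_one, ← (candidatePMF h.points hX C).tsum_coe,
    ← h.injective.tsum_eq, tsum_fintype]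
  intro a ha
  by_contra hr
  exact ha (h.candidatePMF_eq_zero hX C a hr)

open Classical in
/-- A candidate at a new location is at least as good as the chosen center only if this holds
for the locations. -/
theorem locCost_insert_le {l : ℕ} {r : Rule d l} (hr : IsGreedyRule h.points r)
    (C : Finset (Σ v, Fin (w v))) (σ : Fin l → Σ v, Fin (w v)) (i : Fin l)
    (hi : (σ i).1 ∉ C.image Sigma.fst) :
    locCost w D (insert (σ (r (C.image p) (p ∘ σ))).1 (C.image Sigma.fst)) ≤
      locCost w D (insert (σ i).1 (C.image Sigma.fst)) := by
  have hg := hr (C.image p) (p ∘ σ) i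
  simp only [Function.comp_apply] at hg
  rw [← Finset.image_insert, ← Finset.image_insert, h.cost_eq (Finset.insert_nonempty _ _),
    h.cost_eq (Finset.insert_nonempty _ _), Finset.image_insert, Finset.image_insert] at hg
  have hi' : σ i ∉ C := fun hm => hi (Finset.mem_image_of_mem _ hm)
  -- The candidate at a new location adds exactly one center and the chosen one adds at most one. So
  -- the perturbation term never favours the chosen center, and the comparison of locations needs no
  -- error.
  have h₁ : ((insert (σ i) C).card : ℝ) = C.card + 1 := by
    rw [Finset.card_insert_of_notMem hi']
    push_cast
    rfl
  have h₂ : ((insert (σ (r (C.image p) (p ∘ σ))) C).card : ℝ) ≤ C.card + 1 := by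
    exact_mod_cast Finset.card_insert_le _ _
  have := h.e_pos
  nlinarith

/-- The probability that a candidate lies in `L`, when no point of `L` is covered by `C`. -/
def mass (_h : IsRealization w D e p) (A : Finset V) (c : ℝ) (L : Finset V) : ℝ :=
  (∑ v ∈ L, (w v : ℝ) * (setDist D A v + e)) / c

open Classical in
theorem sum_candidatePMF_compl (hX : h.points.Nonempty) {C : Finset (Σ v, Fin (w v))}
    (hC : C.Nonempty) (hpos : 0 < cost h.points (C.image p)) (L : Finset V)
    (hL : ∀ v ∈ L, v ∉ C.image Sigma.fst) :
    ∑ s with s.1 ∉ L, (candidatePMF h.points hX (C.image p) (p s)).toReal =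
      1 - h.mass (C.image Sigma.fst) (cost h.points (C.image p)) L := by
  have h₁ := Finset.sum_filter_add_sum_filter_not Finset.univ
    (fun s : (Σ v, Fin (w v)) => s.1 ∈ L)
    (fun s => (candidatePMF h.points hX (C.image p) (p s)).toReal)
  rw [h.sum_candidatePMF] at h₁
  have h₂ : ∑ s with s.1 ∈ L, (candidatePMF h.points hX (C.image p) (p s)).toReal =
      h.mass (C.image Sigma.fst) (cost h.points (C.image p)) L := by
    rw [mass, ← sum_sigma_filter L (fun v => setDist D (C.image Sigma.fst) v + e),
      Finset.sum_div]
    refine Finset.sum_congr rfl fun s hs => ?_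
    rw [h.candidatePMF_apply hX hC hpos, if_neg]
    exact fun hm => hL _ (Finset.mem_filter.1 hs).2 (Finset.mem_image_of_mem _ hm)
  linarith

open Classical in
/-- A lower bound for the success probability in terms of the next step. -/
theorem stepProb_succ_ge {l : ℕ} {r : Rule d l} (hr : IsGreedyRule h.points r)
    (hX : h.points.Nonempty) (Ev : Set (Finset (Pt d))) (m : ℕ)
    {C : Finset (Σ v, Fin (w v))} (hC : C.Nonempty) (hpos : 0 < cost h.points (C.image p))
    (Z Y F : Finset V)
    (hcov : ∀ v ∈ Z ∪ Y ∪ F, v ∉ C.image Sigma.fst) (x₀ x₁ x₂ : ℝ)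
    (h₀ : ∀ v ∈ Z, ∀ s : (Σ v, Fin (w v)),
      locCost w D (insert s.1 (C.image Sigma.fst)) ≤ locCost w D (insert v (C.image Sigma.fst)) →
      x₀ ≤ stepProb h.points hX r Ev m ((insert s C).image p))
    (h₁ : ∀ v ∈ Y, ∀ s : (Σ v, Fin (w v)), s.1 ∉ Z →
      locCost w D (insert s.1 (C.image Sigma.fst)) ≤ locCost w D (insert v (C.image Sigma.fst)) →
      x₁ ≤ stepProb h.points hX r Ev m ((insert s C).image p))
    (h₂ : ∀ v ∈ F, ∀ s : (Σ v, Fin (w v)), s.1 ∉ Z → s.1 ∉ Y →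
      locCost w D (insert s.1 (C.image Sigma.fst)) ≤ locCost w D (insert v (C.image Sigma.fst)) →
      x₂ ≤ stepProb h.points hX r Ev m ((insert s C).image p)) :
    x₀ * (1 - (1 - h.mass (C.image Sigma.fst) (cost h.points (C.image p)) Z) ^ l) +
      x₁ * ((1 - h.mass (C.image Sigma.fst) (cost h.points (C.image p)) Z) ^ l -
        (1 - h.mass (C.image Sigma.fst) (cost h.points (C.image p)) (Z ∪ Y)) ^ l) +
      x₂ * ((1 - h.mass (C.image Sigma.fst) (cost h.points (C.image p)) (Z ∪ Y)) ^ l -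
        (1 - h.mass (C.image Sigma.fst) (cost h.points (C.image p)) (Z ∪ Y ∪ F)) ^ l) ≤
      stepProb h.points hX r Ev (m + 1) (C.image p) := by
  rw [stepProb_succ h.points hX r Ev p h.injective m (C.image p)
    (fun a ha => h.candidatePMF_eq_zero hX _ a ha)]
  rw [← h.sum_candidatePMF_compl hX hC hpos Z
      (fun v hv => hcov v (by simp [hv])),
    ← h.sum_candidatePMF_compl hX hC hpos (Z ∪ Y)
      (fun v hv => hcov v (Finset.mem_union_left _ hv)),
    ← h.sum_candidatePMF_compl hX hC hpos (Z ∪ Y ∪ F) hcov]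
  simp_rw [← Finset.image_insert]
  apply sum_prod_mul_ge (fun s => (candidatePMF h.points hX (C.image p) (p s)).toReal)
    (fun s => ENNReal.toReal_nonneg) (h.sum_candidatePMF hX _)
    (g := fun σ => stepProb h.points hX r Ev m
      ((insert (σ (r (C.image p) (p ∘ σ))) C).image p))
  · intro s hs
    simp only [Finset.mem_filter, Finset.mem_univ, true_and, Finset.mem_union, not_or] at hs ⊢
    exact hs.1
  · intro s hs
    simp only [Finset.mem_filter, Finset.mem_univ, true_and, Finset.mem_union, not_or] at hs ⊢
    exact hs.1
  · exact fun σ => stepProb_nonneg _ _ _ _ _ _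
  · rintro σ ⟨i, hi⟩
    simp only [Finset.mem_filter, Finset.mem_univ, true_and, not_not] at hi
    exact h₀ _ hi _ (h.locCost_insert_le hr C σ i (hcov _ (by simp [hi])))
  · rintro σ hσ ⟨i, hi⟩
    have hi' := hσ i
    have hr' := hσ (r (C.image p) (p ∘ σ))
    simp only [Finset.mem_filter, Finset.mem_univ, true_and, not_not, Finset.mem_union] at hi hi' hr'
    replace hi := hi.resolve_left hi'
    exact h₁ _ hi _ hr' (h.locCost_insert_le hr C σ i (hcov _ (by simp [hi])))
  · rintro σ hσ ⟨i, hi⟩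
    have hi' := hσ i
    have hr' := hσ (r (C.image p) (p ∘ σ))
    simp only [Finset.mem_filter, Finset.mem_univ, true_and, not_not, Finset.mem_union] at hi hi' hr'
    replace hi := hi.resolve_left hi'
    push Not at hr'
    exact h₂ _ hi _ hr'.1 hr'.2 (h.locCost_insert_le hr C σ i (hcov _ (by simp [hi])))

end IsRealization

/-! ### Races between success and failure in a long run -/

/-- These are the first two terms of the binomial expansion: no sample, or exactly one sample, falls
into the part of mass `p`. -/
theorem pow_add_mul_le (x p : ℝ) (hx : 0 ≤ x) (hp : 0 ≤ p) :
    ∀ l : ℕ, x ^ (l + 1) + (l + 1) * p * x ^ l ≤ (x + p) ^ (l + 1)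
  | 0 => by simp
  | l + 1 => by
    have h := mul_le_mul_of_nonneg_left (pow_add_mul_le x p hx hp l) (add_nonneg hx hp)
    have h₁ : 0 ≤ (l + 1) * p * p * x ^ l := by positivity
    rw [pow_succ (x + p) (l + 1)]
    push_cast
    have h₂ : x ^ (l + 1 + 1) = x * x * x ^ l := by ring
    have h₃ : x ^ (l + 1) = x * x ^ l := by ring
    rw [h₂]
    rw [h₃] at h ⊢
    nlinarith

/-- If `l` independent samples hit `Y` with probability at least `2 κ` times that of `Z ∪ Y`, then
with probability at least `κ` times that of hitting `Z ∪ Y`, only `Y` is hit. -/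
theorem pow_sub_pow_ge {l : ℕ} (hl : 1 ≤ l) {pZ pY κ : ℝ} (hZ : 0 ≤ pZ) (hκ : 0 ≤ κ)
    (hY : 2 * κ * (pZ + pY) ≤ pY) (hY₀ : 0 ≤ pY) (hsmall : l * (pZ + pY) ≤ 1 / 2) :
    κ * (1 - (1 - (pZ + pY)) ^ l) ≤ (1 - pZ) ^ l - (1 - (pZ + pY)) ^ l := by
  obtain ⟨m, rfl⟩ : ∃ m, l = m + 1 := ⟨l - 1, by omega⟩
  push_cast at hsmall
  have hs : pZ + pY ≤ 1 / 2 := by nlinarith [mul_nonneg (Nat.cast_nonneg (α := ℝ) m) (add_nonneg hZ hY₀)]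
  -- Hitting only `Y` is bounded below by one sample in `Y` with the other `m` missing both sets,
  -- which they do with probability at least 1/2 by smallness. Hitting `Z ∪ Y` is bounded above by
  -- the union bound.
  have h₁ := pow_add_mul_le (1 - (pZ + pY)) pY (by linarith) hY₀ m
  have h₂ : 1 + (m : ℝ) * -(pZ + pY) ≤ (1 + -(pZ + pY)) ^ m :=
    one_add_mul_le_pow (by linarith) m
  have h₃ : 1 + ((m + 1 : ℕ) : ℝ) * -(pZ + pY) ≤ (1 + -(pZ + pY)) ^ (m + 1) :=
    one_add_mul_le_pow (by linarith) (m + 1)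
  push_cast at h₃
  rw [← sub_eq_add_neg] at h₂ h₃
  have h₄ : 1 / 2 ≤ (1 - (pZ + pY)) ^ m := by nlinarith
  have h₅ : 1 - (pZ + pY) + pY = 1 - pZ := by ring
  rw [h₅] at h₁
  have h₆ : κ * (1 - (1 - (pZ + pY)) ^ (m + 1)) ≤ κ * ((m + 1) * (pZ + pY)) :=
    mul_le_mul_of_nonneg_left (by linarith) hκ
  have h₇ : (m + 1 : ℝ) * pY * (1 / 2) ≤ (m + 1) * pY * (1 - (pZ + pY)) ^ m :=
    mul_le_mul_of_nonneg_left h₄ (by positivity)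
  have h₈ : (m + 1 : ℝ) * (2 * κ * (pZ + pY)) ≤ (m + 1) * pY :=
    mul_le_mul_of_nonneg_left hY (by positivity)
  linarith

/-- A bound for the probability that a run with `u` remaining fillers ends badly, if the run is
ended in each step by a success of probability about `γ / u` or a failure of probability at most
`(K / u) ^ 2`. -/
def runErr (γ K : ℝ) (u₀ : ℕ) : ℕ → ℝ
  | 0 => 1
  | u + 1 => if u + 1 ≤ u₀ then 1
    else Real.exp (-(γ / (u + 1 : ℕ))) * runErr γ K u₀ u + (K / (u + 1 : ℕ)) ^ 2

theorem runErr_of_le (γ K : ℝ) {u₀ u : ℕ} (h : u ≤ u₀) : runErr γ K u₀ u = 1 := by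
  cases u with
  | zero => rfl
  | succ u => rw [runErr, if_pos h]

theorem runErr_of_lt (γ K : ℝ) {u₀ u : ℕ} (h : u₀ < u) :
    runErr γ K u₀ u = Real.exp (-(γ / u)) * runErr γ K u₀ (u - 1) + (K / u) ^ 2 := by
  cases u with
  | zero => omega
  | succ u => rw [runErr, if_neg (by omega)]; rfl

theorem runErr_nonneg (γ K : ℝ) (u₀ : ℕ) : ∀ u, 0 ≤ runErr γ K u₀ u
  | 0 => zero_le_one
  | u + 1 => by
    rw [runErr]
    have := runErr_nonneg γ K u₀ u
    split_ifs
    · exact zero_le_one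
    · positivity

/-- The factors `exp (-γ/u)` multiply to a power of a harmonic sum, which dominates the logarithm of
the ratio. The failure terms telescope through `1/(u+1)² ≤ 1/u - 1/(u+1)`. -/
theorem runErr_le {γ K : ℝ} (hγ : 0 ≤ γ) {u₀ : ℕ} (hu₀ : 1 ≤ u₀) {u : ℕ} (hu : u₀ ≤ u) :
    runErr γ K u₀ u ≤
      Real.exp (-(γ * Real.log ((u + 1) / (u₀ + 1)))) + K ^ 2 * (1 / u₀ - 1 / u) := by
  induction u, hu using Nat.le_induction with
  | base =>
    rw [runErr_of_le γ K le_rfl, div_self (by positivity)]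
    simp
  | succ u hu ih =>
    have hu' : (0 : ℝ) < u := by exact_mod_cast (show 0 < u by omega)
    rw [runErr_of_lt γ K (by omega)]
    push_cast
    have h₁ : Real.exp (-(γ / (u + 1))) ≤ 1 := by
      rw [Real.exp_le_one_iff]
      have : 0 ≤ γ / (u + 1 : ℝ) := by positivity
      linarith
    have h₂ : Real.exp (-(γ / (u + 1))) * Real.exp (-(γ * Real.log ((u + 1) / (u₀ + 1)))) ≤
        Real.exp (-(γ * Real.log ((u + 1 + 1) / (u₀ + 1)))) := by
      rw [← Real.exp_add]
      apply Real.exp_le_exp.2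
      have h : Real.log ((u + 1 + 1) / (u₀ + 1)) ≤
          1 / (u + 1) + Real.log ((u + 1) / (u₀ + 1)) := by
        have hsplit : ((u : ℝ) + 1 + 1) / (u₀ + 1) =
            ((u + 1 + 1) / (u + 1)) * ((u + 1) / (u₀ + 1)) := by
          field_simp
        rw [hsplit, Real.log_mul (by positivity) (by positivity)]
        have := Real.log_le_sub_one_of_pos (show (0 : ℝ) < (u + 1 + 1) / (u + 1) by positivity)
        have h' : ((u : ℝ) + 1 + 1) / (u + 1) - 1 = 1 / (u + 1) := by
          field_simp
          ring
        linarith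
      have := mul_le_mul_of_nonneg_left h hγ
      have h' : γ * (1 / (u + 1) + Real.log ((u + 1) / (u₀ + 1))) =
        γ / (u + 1) + γ * Real.log ((u + 1) / (u₀ + 1)) := by ring
      linarith
    have h₃ : (K / (u + 1)) ^ 2 ≤ K ^ 2 * (1 / u - 1 / (u + 1)) := by
      have : K ^ 2 * (1 / u - 1 / (u + 1)) - (K / (u + 1)) ^ 2 = K ^ 2 / (u * (u + 1) ^ 2) := by
        field_simp
        ring
      have h' : 0 ≤ K ^ 2 / (u * (u + 1) ^ 2 : ℝ) := by positivity
      linarith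
    have h₄ : 0 ≤ K ^ 2 * (1 / u₀ - 1 / u : ℝ) := by
      apply mul_nonneg (sq_nonneg _)
      rw [sub_nonneg]
      apply one_div_le_one_div_of_le
      · exact_mod_cast hu₀
      · exact_mod_cast hu
    have h₅ := mul_le_mul_of_nonneg_left ih (Real.exp_pos (-(γ / (u + 1)))).le
    have h₆ := mul_le_mul_of_nonneg_right h₁ h₄
    linarith

/-- One step of a run. -/
theorem run_step {l : ℕ} (hl : 2 ≤ l) {pH q R f V a γ K e' : ℝ} {u : ℕ}
    (hR₁ : R ≤ 1) (he' : 0 ≤ e') (hp : pH ≤ 1)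
    (hγ : γ / u ≤ l * pH) (hq₀ : 0 ≤ q) (hq₁ : q ≤ 1) (hq : q ≤ K / u)
    (hrew : R * (1 - (1 - pH) ^ l) ≤ f * (1 - a) + V * (a - (1 - pH) ^ l)) :
    R - (Real.exp (-(γ / u)) * e' + (K / u) ^ 2) ≤
      f * (1 - a) + V * (a - (1 - pH) ^ l) + (R - e') * ((1 - pH) ^ l - q ^ l) := by
  -- The right side weighs three outcomes: the bad half of the target is hit (`f`), only the good
  -- half is hit (`V`), or the target is missed but a filler is hit (`R - e'`). By `hrew` the first
  -- two together contribute at least `R` times their probability, so only the error `e'` and the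
  -- probability `q ^ l` of hitting nothing are lost.
  have hb₀ : 0 ≤ (1 - pH) ^ l := pow_nonneg (by linarith) l
  have hb : (1 - pH) ^ l ≤ Real.exp (-(γ / u)) := by
    calc (1 - pH) ^ l ≤ Real.exp (-pH) ^ l :=
          pow_le_pow_left₀ (by linarith) (Real.one_sub_le_exp_neg pH) l
      _ = Real.exp (l * -pH) := by rw [← Real.exp_nat_mul]
      _ ≤ Real.exp (-(γ / u)) := Real.exp_le_exp.2 (by linarith)
  -- Here two candidates per step are essential: they make the failure probability quadratic in
  -- `1/u`, hence summable along the run.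
  have hc₀ : 0 ≤ q ^ l := pow_nonneg hq₀ l
  have hc : q ^ l ≤ (K / u) ^ 2 :=
    (pow_le_pow_of_le_one hq₀ hq₁ hl).trans (pow_le_pow_left₀ hq₀ hq 2)
  have h₁ := mul_le_mul_of_nonneg_right hb he'
  nlinarith [mul_nonneg he' hc₀, mul_nonneg (sub_nonneg.2 hR₁) hc₀]

/-! ### Gains and candidate probabilities -/

/-- The amount by which the new center `u` decreases the cost. -/
def gain {V : Type*} [Fintype V] (w : V → ℕ) (D : V → V → ℝ) (A : Finset V) (u : V) : ℝ :=
  ∑ v, (w v : ℝ) * max 0 (setDist D A v - D v u)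

open Classical in
theorem locCost_insert {V : Type*} [Fintype V] (w : V → ℕ) (D : V → V → ℝ) {A : Finset V}
    (hA : A.Nonempty) (u : V) : locCost w D (insert u A) = locCost w D A - gain w D A u := by
  rw [locCost, locCost, gain, ← Finset.sum_sub_distrib]
  refine Finset.sum_congr rfl fun v _ => ?_
  rw [setDist_insert D hA]
  rcases le_total (setDist D A v) (D v u) with h | h
  · rw [min_eq_left h, max_eq_left (by linarith)]
    ring
  · rw [min_eq_right h, max_eq_right (by linarith)]
    ring

namespace IsRealization

variable {V : Type*} {w : V → ℕ} {D : V → V → ℝ} {e : ℝ} {d : ℕ}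
  {p : (Σ v, Fin (w v)) → Pt d} (h : IsRealization w D e p) [Fintype V]
include h

open Classical in
theorem locCost_le_cost {C : Finset (Σ v, Fin (w v))} (hC : C.Nonempty) :
    locCost w D (C.image Sigma.fst) ≤ cost h.points (C.image p) := by
  rw [h.cost_eq hC]
  have : (C.card : ℝ) ≤ Fintype.card (Σ v, Fin (w v)) := by exact_mod_cast Finset.card_le_univ C
  nlinarith [h.e_pos]

open Classical in
theorem cost_le {C : Finset (Σ v, Fin (w v))} (hC : C.Nonempty) :
    cost h.points (C.image p) ≤
      locCost w D (C.image Sigma.fst) + e * Fintype.card (Σ v, Fin (w v)) := by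
  rw [h.cost_eq hC]
  nlinarith [h.e_pos, (Nat.cast_nonneg C.card : (0 : ℝ) ≤ C.card)]

omit [Fintype V] in
theorem mass_nonneg (A L : Finset V) {c : ℝ} (hc : 0 ≤ c) : 0 ≤ h.mass A c L := by
  refine div_nonneg (Finset.sum_nonneg fun v _ => ?_) hc
  exact mul_nonneg (Nat.cast_nonneg _) (add_nonneg (h.setDist_nonneg A v) h.e_pos.le)

omit [Fintype V] in
theorem le_mass (A L : Finset V) {c : ℝ} (hc : 0 < c) :
    (∑ v ∈ L, (w v : ℝ) * setDist D A v) / c ≤ h.mass A c L := by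
  refine div_le_div_of_nonneg_right (Finset.sum_le_sum fun v _ => ?_) hc.le
  exact mul_le_mul_of_nonneg_left (by linarith [h.e_pos]) (Nat.cast_nonneg _)

open Classical in
theorem mass_le_one (hX : h.points.Nonempty) {C : Finset (Σ v, Fin (w v))}
    (hC : C.Nonempty) (hpos : 0 < cost h.points (C.image p)) (L : Finset V)
    (hL : ∀ v ∈ L, v ∉ C.image Sigma.fst) :
    h.mass (C.image Sigma.fst) (cost h.points (C.image p)) L ≤ 1 := by
  have := h.sum_candidatePMF_compl hX hC hpos L hL
  have h₁ : 0 ≤ ∑ s with s.1 ∉ L, (candidatePMF h.points hX (C.image p) (p s)).toReal :=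
    Finset.sum_nonneg fun s _ => ENNReal.toReal_nonneg
  linarith

-- What is not sampled from `L` is sampled in proportion to the cost outside `L`; the perturbation
-- is bounded by its total over all points.
open Classical in
theorem one_sub_mass_le (hX : h.points.Nonempty) {C : Finset (Σ v, Fin (w v))}
    (hC : C.Nonempty) (hpos : 0 < cost h.points (C.image p)) (L : Finset V)
    (hL : ∀ v ∈ L, v ∉ C.image Sigma.fst) :
    1 - h.mass (C.image Sigma.fst) (cost h.points (C.image p)) L ≤
      (∑ v with v ∉ L, (w v : ℝ) * setDist D (C.image Sigma.fst) v +
        e * Fintype.card (Σ v, Fin (w v))) / cost h.points (C.image p) := by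
  rw [← h.sum_candidatePMF_compl hX hC hpos L hL]
  have h₁ : ∀ s : (Σ v, Fin (w v)), (candidatePMF h.points hX (C.image p) (p s)).toReal ≤
      (setDist D (C.image Sigma.fst) s.1 + e) / cost h.points (C.image p) := by
    intro s
    rw [h.candidatePMF_apply hX hC hpos]
    refine div_le_div_of_nonneg_right ?_ hpos.le
    have := h.e_pos
    split_ifs <;> linarith
  refine (Finset.sum_le_sum fun s _ => h₁ s).trans ?_
  rw [← Finset.sum_div]
  refine div_le_div_of_nonneg_right ?_ hpos.le
  rw [Finset.sum_add_distrib]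
  refine add_le_add ?_ ?_
  · have := sum_sigma_filter (w := w) (Finset.univ.filter fun v => v ∉ L)
      (fun v => setDist D (C.image Sigma.fst) v)
    simp only [Finset.mem_filter, Finset.mem_univ, true_and] at this
    rw [this]
  · rw [Finset.sum_const, nsmul_eq_mul, mul_comm]
    refine mul_le_mul_of_nonneg_left ?_ h.e_pos.le
    exact_mod_cast Finset.card_le_univ _

end IsRealization

/-! ### The hard instance and its Euclidean embedding -/

open scoped RealInnerProductSpace

/-- The parameters of the hard instance: the number `P` of phases, the numbers `s`, `N`, `t` of
fillers per phase, of satellites and of light fillers, the weights `wb` and `n` of the base and of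
the core, the distance scale `a` of the satellites and the distance scales `ρ` of the phases. -/
structure Params where
  (P s N t wb n a : ℕ)
  (ρ : ℕ → ℝ)

/-- The locations of the hard instance. -/
inductive Loc (π : Params) : Type
  | base
  | shell (i : Fin π.P)
  | lure (i : Fin π.P)
  | decoy
  | core
  | sat (m : Fin π.N)
  | filler (i : Fin π.P) (m : Fin π.s)
  | light (m : Fin π.t)

namespace Loc

variable (π : Params)

/-- Locations as a sum type. -/
def equivSum : Loc π ≃ Unit ⊕ Fin π.P ⊕ Fin π.P ⊕ Unit ⊕ Unit ⊕ Fin π.N ⊕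
    (Fin π.P × Fin π.s) ⊕ Fin π.t where
  toFun
    | base => .inl ()
    | shell i => .inr (.inl i)
    | lure i => .inr (.inr (.inl i))
    | decoy => .inr (.inr (.inr (.inl ())))
    | core => .inr (.inr (.inr (.inr (.inl ()))))
    | sat m => .inr (.inr (.inr (.inr (.inr (.inl m)))))
    | filler i m => .inr (.inr (.inr (.inr (.inr (.inr (.inl (i, m)))))))
    | light m => .inr (.inr (.inr (.inr (.inr (.inr (.inr m))))))
  invFun
    | .inl () => base
    | .inr (.inl i) => shell i
    | .inr (.inr (.inl i)) => lure i
    | .inr (.inr (.inr (.inl ()))) => decoy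
    | .inr (.inr (.inr (.inr (.inl ())))) => core
    | .inr (.inr (.inr (.inr (.inr (.inl m))))) => sat m
    | .inr (.inr (.inr (.inr (.inr (.inr (.inl (i, m))))))) => filler i m
    | .inr (.inr (.inr (.inr (.inr (.inr (.inr m)))))) => light m
  left_inv v := by cases v <;> rfl
  right_inv v := by
    rcases v with _ | _ | _ | _ | _ | _ | ⟨_, _⟩ | _ <;> rfl

instance : Fintype (Loc π) := Fintype.ofEquiv _ (equivSum π).symm

variable {π}

theorem sum_eq {M : Type*} [AddCommMonoid M] (F : Loc π → M) :
    ∑ v, F v = F base + (∑ i, F (shell i) + (∑ i, F (lure i) + (F decoy + (F core +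
      (∑ m, F (sat m) + (∑ i, ∑ m, F (filler i m) + ∑ m, F (light m))))))) := by
  rw [← (equivSum π).symm.sum_comp F]
  simp only [Fintype.sum_sum_type, Fintype.sum_prod_type, Finset.univ_unique,
    Finset.sum_singleton]
  rfl

theorem card_eq : Fintype.card (Loc π) = 3 + 2 * π.P + π.N + π.P * π.s + π.t := by
  rw [Fintype.card_congr (equivSum π)]
  simp only [Fintype.card_sum, Fintype.card_unit, Fintype.card_fin, Fintype.card_prod]
  ring

/-- The number of points at a location. -/
def weight : Loc π → ℕ
  | base => π.wb
  | shell _ => π.P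
  | core => π.n
  | _ => 1

/-- The locations that have to be covered near the core from phase `j` on. -/
def InBall (j : ℕ) : Loc π → Prop
  | shell i => j ≤ i
  | lure i => j ≤ i
  | decoy => True
  | core => True
  | sat _ => True
  | _ => False

open Classical in
/-- The set of the locations that have to be covered near the core from phase `j` on. -/
def ball (π : Params) (j : ℕ) : Finset (Loc π) := Finset.univ.filter (InBall j)

theorem mem_ball {j : ℕ} {v : Loc π} : v ∈ ball π j ↔ InBall j v := by
  simp [ball]

/-- The weight of the ball of phase `j`. -/
def ballWeight (π : Params) (j : ℕ) : ℝ := ∑ v ∈ ball π j, (weight v : ℝ)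

/-- The cost of an uncovered filler of phase `j`. -/
def fillerCost (π : Params) (j : ℕ) : ℝ := ballWeight π j * π.ρ j ^ 2 + π.ρ (j + 1) ^ 3

/-- The cost of an uncovered light filler. -/
def lightCost (π : Params) : ℝ := 15 * (π.a : ℝ) ^ 2

/-- The inner products of the locations. -/
def gram : Loc π → Loc π → ℝ
  | base, base => π.ρ 0 ^ 2
  | base, filler _ _ => π.ρ 0 ^ 2
  | base, light _ => π.ρ 0 ^ 2
  | filler _ _, base => π.ρ 0 ^ 2
  | light _, base => π.ρ 0 ^ 2
  | filler _ _, light _ => π.ρ 0 ^ 2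
  | light _, filler _ _ => π.ρ 0 ^ 2
  | filler i m, filler i' m' =>
    π.ρ 0 ^ 2 + if i = i' ∧ m = m' then fillerCost π i else 0
  | light m, light m' => π.ρ 0 ^ 2 + if m = m' then lightCost π else 0
  | shell i, shell i' => if i = i' then π.ρ (i + 1) ^ 2 else 0
  | shell i, lure i' => if i = i' then π.ρ i * π.ρ (i + 1) else 0
  | lure i', shell i => if i = i' then π.ρ i * π.ρ (i + 1) else 0
  | lure i, lure i' => if i = i' then 2 * π.ρ i ^ 2 else 0
  | lure i, decoy => (1 / π.P) * π.ρ i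
  | decoy, lure i => (1 / π.P) * π.ρ i
  | decoy, decoy => 1 + π.P * (1 / π.P : ℝ) ^ 2
  | decoy, sat _ => -π.a
  | sat _, decoy => -π.a
  | sat m, sat m' => (π.a : ℝ) ^ 2 + if m = m' then 9 * (π.a : ℝ) ^ 2 else 0
  | _, _ => 0

/-- The squared distance of two locations. -/
def sqDist (u v : Loc π) : ℝ := gram u u + gram v v - 2 * gram u v

theorem gram_comm (u v : Loc π) : gram u v = gram v u := by
  cases u <;> cases v <;> simp only [gram, eq_comm] <;> split_ifs with h <;>
    first | rfl | simp [h]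

theorem sqDist_comm (u v : Loc π) : sqDist u v = sqDist v u := by
  rw [sqDist, sqDist, gram_comm u v]
  ring

theorem ballWeight_nonneg (π : Params) (j : ℕ) : 0 ≤ ballWeight π j :=
  Finset.sum_nonneg fun _ _ => Nat.cast_nonneg _

section position

variable {E : Type*} [NormedAddCommGroup E] [InnerProductSpace ℝ E] {S : Type*}
  (b : Loc π ⊕ Fin π.P ⊕ S → E)

/-- The location as a combination of orthonormal vectors. -/
def position : Loc π → E
  | base => π.ρ 0 • b (.inl base)
  | shell i => π.ρ (i + 1) • b (.inl (shell i))
  | lure i => π.ρ i • (b (.inl (shell i)) + b (.inr (.inl i)))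
  | decoy => b (.inl decoy) + (1 / π.P : ℝ) • ∑ i, b (.inr (.inl i))
  | core => 0
  | sat m => (-π.a : ℝ) • b (.inl decoy) + (3 * π.a : ℝ) • b (.inl (sat m))
  | filler i m => π.ρ 0 • b (.inl base) + √(fillerCost π i) • b (.inl (filler i m))
  | light m => π.ρ 0 • b (.inl base) + √(lightCost π) • b (.inl (light m))

variable {b} (hb : Orthonormal ℝ b)
include hb

theorem inner_position_inr (u : Loc π) (s : S) : ⟪position b u, b (.inr (.inr s))⟫ = 0 := by
  classical
  have hb' := orthonormal_iff_ite.1 hb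
  cases u <;>
    simp [position, inner_add_left, inner_smul_left, hb', sum_inner]

theorem inner_position (hF : ∀ i : Fin π.P, 0 ≤ fillerCost π i) (u v : Loc π) :
    ⟪position b u, position b v⟫ = gram u v := by
  classical
  have hb' := orthonormal_iff_ite.1 hb
  have hF' : ∀ i : Fin π.P, √(fillerCost π i) * √(fillerCost π i) = fillerCost π i :=
    fun i => Real.mul_self_sqrt (hF i)
  have hL : √(lightCost π) * √(lightCost π) = lightCost π :=
    Real.mul_self_sqrt (by unfold lightCost; positivity)
  cases u <;> cases v <;>
    simp only [position, gram, inner_add_left, inner_smul_left, inner_add_right, inner_smul_right,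
      hb', sum_inner, inner_sum, inner_zero_left, inner_zero_right, reduceCtorEq, if_false,
      Sum.inl.injEq, Sum.inr.injEq, if_true, mul_zero, add_zero, zero_add, mul_one,
      Finset.sum_ite_eq, Finset.sum_ite_eq', Finset.mem_univ, Finset.sum_const, Finset.card_univ,
      Fintype.card_fin, nsmul_eq_mul, Loc.shell.injEq, Loc.sat.injEq,
      Loc.filler.injEq, Loc.light.injEq, RCLike.conj_to_real, mul_ite]
  all_goals
    first
    | rfl
    | ring1
    | (split_ifs with h₁
       all_goals first
        | (exfalso; simp_all; done)
        | (try obtain ⟨rfl, rfl⟩ := h₁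
           try subst h₁
           first
           | ring1
           | (have := hF' ‹Fin π.P›; linear_combination this)
           | linear_combination hL))

theorem norm_position_sub_sq (hF : ∀ i : Fin π.P, 0 ≤ fillerCost π i) (u v : Loc π) :
    ‖position b u - position b v‖ ^ 2 = sqDist u v := by
  rw [norm_sub_sq_real, inner_position hb hF, ← real_inner_self_eq_norm_sq,
    ← real_inner_self_eq_norm_sq, inner_position hb hF, inner_position hb hF, sqDist]
  ring

/-- Two private orthogonal directions, each used with length `√(e/2)`, contribute `e` to every
squared distance, whether or not the two points share a location. -/
theorem norm_position_add_sub_sq (hF : ∀ i : Fin π.P, 0 ≤ fillerCost π i) {e : ℝ} (he : 0 ≤ e)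
    (u v : Loc π) {s s' : S} (hss : s ≠ s') :
    ‖position b u + √(e / 2) • b (.inr (.inr s)) -
      (position b v + √(e / 2) • b (.inr (.inr s')))‖ ^ 2 = sqDist u v + e := by
  classical
  have hb' := orthonormal_iff_ite.1 hb
  have h₁ : position b u + √(e / 2) • b (.inr (.inr s)) -
      (position b v + √(e / 2) • b (.inr (.inr s'))) = (position b u - position b v) +
        √(e / 2) • (b (.inr (.inr s)) - b (.inr (.inr s'))) := by
    rw [smul_sub]
    abel
  have h₂ : ‖b (.inr (.inr s)) - b (.inr (.inr s'))‖ ^ 2 = 2 := by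
    rw [norm_sub_sq_real, hb.1, hb.1, hb', if_neg (by simpa using hss)]
    norm_num
  rw [h₁, norm_add_sq_real, norm_position_sub_sq hb hF, norm_smul, mul_pow, h₂,
    Real.norm_eq_abs, sq_abs, Real.sq_sqrt (by linarith), inner_smul_right, inner_sub_left,
    inner_sub_right, inner_sub_right]
  simp only [inner_position_inr hb]
  ring

end position

theorem exists_isRealization (hF : ∀ i : Fin π.P, 0 ≤ fillerCost π i)
    (hw : ∀ v : Loc π, 0 < weight v) {e : ℝ} (he : 0 < e) :
    ∃ (d : ℕ) (p : (Σ v : Loc π, Fin (weight v)) → Pt d),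
      IsRealization weight sqDist e p := by
  classical
  -- One axis per location, one further axis per lure (shared between that lure and the decoy), and
  -- one private axis per point for the perturbation.
  let ι := Loc π ⊕ Fin π.P ⊕ (Σ v : Loc π, Fin (weight v))
  let b := (EuclideanSpace.basisFun (Fin (Fintype.card ι)) ℝ).reindex (Fintype.equivFin ι).symm
  have hb : Orthonormal ℝ b := b.orthonormal
  refine ⟨Fintype.card ι, fun s => position b s.1 + √(e / 2) • b (.inr (.inr s)), he, hw, ?_, ?_⟩
  · intro s t
    by_cases hst : s = t
    · rw [if_pos hst, hst, sub_self, norm_zero, sqDist]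
      ring
    · rw [if_neg hst]
      exact norm_position_add_sub_sq hb hF he.le _ _ hst
  · intro u v
    rw [← norm_position_sub_sq hb hF]
    positivity

end Loc

/-! ### Admissible parameters and separation of scales -/

/-- The parameters are in the range where the analysis applies; `Ω` bounds the quantities that do
not depend on the distance scales `ρ`. -/
structure Params.Valid (π : Params) (Ω : ℝ) : Prop where
  one_le_P : 1 ≤ π.P
  one_le_a : 1 ≤ π.a
  n_eq : π.n = 12 * π.P ^ 2
  ball_le_n : π.P * (π.P + 1) + 1 + π.N ≤ π.n
  wb_pos : 0 < π.wb
  N_eq : π.N = 8 * π.a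
  rho_rec : ∀ j < π.P, π.ρ j = π.ρ (j + 1) ^ 4
  one_le_Ω : 1 ≤ Ω
  le_rho : 100 * Ω ^ 3 ≤ π.ρ π.P
  ball_le : (π.P * (π.P + 1) + 1 + π.n + π.N : ℝ) ≤ Ω
  filler_le : (π.P * π.s : ℝ) ≤ Ω
  light_le : (π.t : ℝ) * (15 * π.a ^ 2) ≤ Ω
  a_le : 30 * (π.a : ℝ) ^ 3 ≤ Ω

namespace Loc

variable {π : Params} {Ω : ℝ}

theorem gram_filler {v : Loc π} {i : Fin π.P} {m : Fin π.s} (hv : v ≠ filler i m) :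
    gram v (filler i m) = gram v base := by
  cases v <;> simp_all [gram]

theorem gram_light {v : Loc π} {m : Fin π.t} (hv : v ≠ light m) :
    gram v (light m) = gram v base := by
  cases v <;> simp_all [gram]

theorem gram_sat (m : Fin π.N) : gram (sat m) (sat m) = 10 * (π.a : ℝ) ^ 2 := by
  simp only [gram, if_true]
  ring

theorem n_le_ballWeight (π : Params) (j : ℕ) : (π.n : ℝ) ≤ ballWeight π j :=
  Finset.single_le_sum (f := fun v : Loc π => (weight v : ℝ)) (fun _ _ => Nat.cast_nonneg _)
    (mem_ball.2 (show InBall j core from trivial))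

/-- `φ` is a location that is joined to the base by a segment of squared length `c` orthogonal to
everything else. -/
structure IsSpoke (φ : Loc π) (c : ℝ) : Prop where
  nonneg : 0 ≤ c
  weight_eq : weight φ = 1
  sqDist_eq : ∀ v, v ≠ φ → sqDist v φ = sqDist v base + c

theorem isSpoke_light (m : Fin π.t) : IsSpoke (light m) (lightCost π) where
  nonneg := by unfold lightCost; positivity
  weight_eq := rfl
  sqDist_eq v hv := by
    rw [sqDist, sqDist, gram_light hv]
    simp [gram]
    ring

theorem isSpoke_filler {i : Fin π.P} (hi : 0 ≤ fillerCost π i) (m : Fin π.s) :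
    IsSpoke (filler i m) (fillerCost π i) where
  nonneg := hi
  weight_eq := rfl
  sqDist_eq v hv := by
    rw [sqDist, sqDist, gram_filler hv]
    simp [gram]
    ring

end Loc

open Loc

namespace Params.Valid

variable {π : Params} {Ω : ℝ} (hπ : π.Valid Ω)
include hπ

theorem rho_P : 100 ≤ π.ρ π.P := by
  have h₁ := hπ.one_le_Ω
  have : 1 ≤ Ω ^ 3 := one_le_pow₀ h₁
  linarith [hπ.le_rho]

theorem rho_mono_aux : ∀ m j : ℕ, j + m = π.P → π.ρ π.P ≤ π.ρ j
  | 0, j, h => by rw [← h, add_zero]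
  | m + 1, j, h => by
    have h₁ := rho_mono_aux m (j + 1) (by omega)
    have h₂ := hπ.rho_P
    rw [hπ.rho_rec j (by omega)]
    exact h₁.trans (le_self_pow₀ (by linarith) (by norm_num))

theorem rho_P_le {j : ℕ} (hj : j ≤ π.P) : π.ρ π.P ≤ π.ρ j :=
  hπ.rho_mono_aux (π.P - j) j (by omega)

theorem rho_ge {j : ℕ} (hj : j ≤ π.P) : 100 ≤ π.ρ j := hπ.rho_P.trans (hπ.rho_P_le hj)

theorem rho_anti {i j : ℕ} (hij : i ≤ j) (hj : j ≤ π.P) : π.ρ j ≤ π.ρ i := by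
  induction j, hij using Nat.le_induction with
  | base => exact le_rfl
  | succ j hij ih =>
    refine le_trans ?_ (ih (by omega))
    rw [hπ.rho_rec j (by omega)]
    exact le_self_pow₀ (by linarith [hπ.rho_ge hj]) (by norm_num)

theorem four_le_n : 4 ≤ π.n := by
  rw [hπ.n_eq]
  have := Nat.one_le_pow 2 _ hπ.one_le_P
  omega

theorem a_real : (1 : ℝ) ≤ π.a := by exact_mod_cast hπ.one_le_a
theorem P_real : (1 : ℝ) ≤ π.P := by exact_mod_cast hπ.one_le_P
theorem n_real : (4 : ℝ) ≤ π.n := by exact_mod_cast hπ.four_le_n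

theorem P_le : (π.P : ℝ) ≤ Ω := by
  have := hπ.ball_le
  have h₁ : (0 : ℝ) ≤ π.n := Nat.cast_nonneg _
  have h₂ : (0 : ℝ) ≤ π.N := Nat.cast_nonneg _
  have h₃ := hπ.P_real
  nlinarith

theorem n_le : (π.n : ℝ) ≤ Ω := by
  have := hπ.ball_le
  have h₂ : (0 : ℝ) ≤ π.N := Nat.cast_nonneg _
  have h₃ := hπ.P_real
  nlinarith

theorem one_div_P_le : (1 / π.P : ℝ) ≤ 1 := by
  rw [div_le_one (by linarith [hπ.P_real])]
  exact hπ.P_real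

theorem gram_decoy : gram (decoy : Loc π) decoy ≤ 2 ∧ 1 ≤ gram (decoy : Loc π) decoy := by
  have h : gram (decoy : Loc π) decoy = 1 + 1 / π.P := by
    have := hπ.P_real
    simp only [gram]
    field_simp
  rw [h]
  have h₁ : (0 : ℝ) ≤ 1 / π.P := by positivity
  constructor <;> linarith [hπ.one_div_P_le]

omit hπ in
theorem _root_.KMeans.ballWeight_le_add (π : Params) (j : ℕ) :
    ballWeight π j ≤ π.P * (π.P + 1) + 1 + π.n + π.N := by
  classical
  have h₁ : ballWeight π j ≤ ∑ v : Loc π, if InBall 0 v then (weight v : ℝ) else 0 := by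
    rw [ballWeight, ball, Finset.sum_filter]
    refine Finset.sum_le_sum fun v _ => ?_
    have hv : InBall j v → InBall 0 v := by cases v <;> simp [InBall]
    by_cases hj : InBall j v
    · rw [if_pos hj, if_pos (hv hj)]
    · rw [if_neg hj]
      positivity
  refine h₁.trans ?_
  rw [sum_eq]
  simp [InBall, weight]
  ring_nf
  exact le_rfl

theorem ballWeight_le (j : ℕ) : ballWeight π j ≤ Ω := (ballWeight_le_add π j).trans hπ.ball_le

theorem ballWeight_le_two_mul (j : ℕ) : ballWeight π j ≤ 2 * π.n := by
  refine (ballWeight_le_add π j).trans ?_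
  have : ((π.P * (π.P + 1) + 1 + π.N : ℕ) : ℝ) ≤ π.n := by exact_mod_cast hπ.ball_le_n
  push_cast at this
  linarith

theorem four_le_ballWeight (j : ℕ) : 4 ≤ ballWeight π j := hπ.n_real.trans (n_le_ballWeight π j)

theorem sq_le_fillerCost {j : ℕ} (hj : j < π.P) :
    ballWeight π j * π.ρ j ^ 2 ≤ fillerCost π j := by
  rw [fillerCost]
  have := hπ.rho_ge (show j + 1 ≤ π.P by omega)
  have : 0 ≤ π.ρ (j + 1) ^ 3 := by positivity
  linarith

theorem rho_sq_le_fillerCost {j : ℕ} (hj : j < π.P) : 4 * π.ρ j ^ 2 ≤ fillerCost π j :=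
  (mul_le_mul_of_nonneg_right (hπ.four_le_ballWeight j) (sq_nonneg _)).trans
    (hπ.sq_le_fillerCost hj)

theorem fillerCost_nonneg (i : Fin π.P) : 0 ≤ fillerCost π i :=
  (by positivity : 0 ≤ 4 * π.ρ i ^ 2).trans (hπ.rho_sq_le_fillerCost i.2)

theorem weight_pos (v : Loc π) : 0 < weight v := by
  cases v <;> simp only [weight, zero_lt_one]
  · exact hπ.wb_pos
  · exact hπ.one_le_P
  · have := hπ.four_le_n
    omega

theorem one_le_weight (v : Loc π) : (1 : ℝ) ≤ weight v := by exact_mod_cast hπ.weight_pos v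

theorem isSpoke_filler (i : Fin π.P) (m : Fin π.s) : IsSpoke (filler i m) (fillerCost π i) :=
  Loc.isSpoke_filler (hπ.fillerCost_nonneg i) m

theorem lightCost_le : lightCost π ≤ Ω := by
  have := hπ.a_le
  have h := hπ.a_real
  unfold lightCost
  nlinarith [sq_nonneg (π.a : ℝ)]

/-- Bounds for the scale `ρ (j + 1)` of phase `j`. -/
theorem rho_bounds {j : ℕ} (hj : j < π.P) :
    100 * Ω ^ 3 ≤ π.ρ (j + 1) ∧ π.ρ j = π.ρ (j + 1) ^ 4 :=
  ⟨hπ.le_rho.trans (hπ.rho_P_le (by omega)), hπ.rho_rec j hj⟩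

/-- Fillers of later phases live on lower scales: the ball weight is at most one power of `ρ (j +
1)`, and `ρ i ≤ ρ (j + 1)`. So they cannot compete in phase `j`, where costs are of order `ρ (j + 1)
^ 8`. -/
theorem fillerCost_le {i j : ℕ} (hij : j < i) (hi : i < π.P) :
    fillerCost π i ≤ 2 * π.ρ (j + 1) ^ 3 := by
  have h₁ := hπ.rho_anti (show j + 1 ≤ i from hij) hi.le
  have h₂ := hπ.rho_anti (show j + 1 ≤ i + 1 by omega) (show i + 1 ≤ π.P from hi)
  have h₃ := hπ.rho_ge hi.le
  have h₄ := hπ.rho_ge (show i + 1 ≤ π.P from hi)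
  have h₅ := hπ.ballWeight_le i
  have h₆ := (hπ.rho_bounds (show j < π.P by omega)).1
  have h₇ := hπ.one_le_Ω
  have h₈ : Ω ≤ Ω ^ 3 := le_self_pow₀ h₇ (by norm_num)
  have h₉ : π.ρ i ^ 2 ≤ π.ρ (j + 1) ^ 2 := pow_le_pow_left₀ (by linarith) h₁ 2
  have h₁₀ : π.ρ (i + 1) ^ 3 ≤ π.ρ (j + 1) ^ 3 := pow_le_pow_left₀ (by linarith) h₂ 3
  have h₁₁ : ballWeight π i * π.ρ i ^ 2 ≤ π.ρ (j + 1) * π.ρ (j + 1) ^ 2 := by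
    apply mul_le_mul _ h₉ (sq_nonneg _) (by linarith)
    linarith
  rw [fillerCost]
  nlinarith

end Params.Valid

/-! ### Spokes, and distances at the front of a phase -/

namespace Loc

variable {π : Params} {e : ℝ} {d : ℕ} {p : (Σ v : Loc π, Fin (weight v)) → Pt d}

section
variable (h : IsRealization weight (sqDist (π := π)) e p)
include h

theorem IsSpoke.sqDist_base {φ : Loc π} {c : ℝ} (hφ : IsSpoke φ c) (hb : φ ≠ base) :
    sqDist φ base = c := by
  rw [sqDist_comm, hφ.sqDist_eq _ hb.symm, h.self, zero_add]

theorem IsSpoke.le_sqDist {φ : Loc π} {c : ℝ} (hφ : IsSpoke φ c) {v : Loc π} (hv : v ≠ φ) :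
    c ≤ sqDist φ v := by
  rw [sqDist_comm, hφ.sqDist_eq _ hv]
  linarith [h.nonneg v base]

/-- By orthogonality every other location is at least as far from the tip as the base is. So with
the base covered, a spoke costs a fixed amount, is helped by no center but itself, and helps no
other location. -/
theorem IsSpoke.setDist_eq {φ : Loc π} {c : ℝ} (hφ : IsSpoke φ c) {A : Finset (Loc π)}
    (hb : base ∈ A) (hA : φ ∉ A) : setDist sqDist A φ = c := by
  apply le_antisymm
  · have hne : φ ≠ base := by rintro rfl; exact hA hb
    exact (setDist_le _ _ hb).trans (hφ.sqDist_base h hne).le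
  · refine le_setDist _ ⟨_, hb⟩ _ fun a ha => hφ.le_sqDist h ?_
    rintro rfl
    exact hA ha

theorem IsSpoke.gain_eq {φ : Loc π} {c : ℝ} (hφ : IsSpoke φ c) {A : Finset (Loc π)}
    (hb : base ∈ A) (hA : φ ∉ A) : gain weight sqDist A φ = c := by
  rw [gain, Finset.sum_eq_single φ]
  · rw [hφ.weight_eq, hφ.setDist_eq h hb hA, h.self, sub_zero, max_eq_right hφ.nonneg]
    simp
  · intro v _ hv
    rw [max_eq_left, mul_zero]
    rw [hφ.sqDist_eq v hv]
    have := setDist_le sqDist v hb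
    linarith [hφ.nonneg]
  · exact fun hn => absurd (Finset.mem_univ _) hn

/-- A spoke contributes nothing to the gain of any other location. -/
theorem IsSpoke.max_eq_zero {φ : Loc π} {c : ℝ} (hφ : IsSpoke φ c) {A : Finset (Loc π)}
    (hb : base ∈ A) {x : Loc π} (hx : x ≠ φ) :
    max 0 (setDist sqDist A φ - sqDist φ x) = 0 := by
  by_cases hA : φ ∈ A
  · rw [h.setDist_eq_zero hA, max_eq_left]
    linarith [h.nonneg φ x]
  · rw [hφ.setDist_eq h hb hA, max_eq_left]
    linarith [hφ.le_sqDist h hx]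

theorem max_eq_zero_of_mem {A : Finset (Loc π)} {v : Loc π} (hv : v ∈ A) (x : Loc π) :
    max 0 (setDist sqDist A v - sqDist v x) = 0 := by
  rw [h.setDist_eq_zero hv, max_eq_left]
  linarith [h.nonneg v x]

omit h in
theorem gain_eq_zero_of_mem {A : Finset (Loc π)} {x : Loc π} (hx : x ∈ A) :
    gain weight sqDist A x = 0 := by
  refine Finset.sum_eq_zero fun v _ => ?_
  rw [max_eq_left, mul_zero]
  linarith [setDist_le (sqDist (π := π)) v hx]

theorem le_gain (A : Finset (Loc π)) (v : Loc π) :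
    weight v * setDist sqDist A v ≤ gain weight sqDist A v := by
  have := Finset.single_le_sum (f := fun u => (weight u : ℝ) *
    max 0 (setDist sqDist A u - sqDist u v)) (fun u _ => by positivity) (Finset.mem_univ v)
  refine le_trans ?_ this
  simp only [h.self, sub_zero]
  exact mul_le_mul_of_nonneg_left (le_max_right _ _) (Nat.cast_nonneg _)

end

-- In phase `j` all locations of the ball behave alike up to lower scales, with the lure of that
-- phase as the single exception. It has weight one, so its correction `x` enters once.
open Classical in
theorem sum_ball_le {j : ℕ} (hj : j < π.P) {f : Loc π → ℝ} {c x : ℝ}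
    (hf : ∀ v, InBall j v → f v ≤ c + if v = lure ⟨j, hj⟩ then x else 0) :
    ∑ v ∈ ball π j, (weight v : ℝ) * f v ≤ ballWeight π j * c + x := by
  calc _ ≤ ∑ v ∈ ball π j, (weight v : ℝ) * (c + if v = lure ⟨j, hj⟩ then x else 0) :=
        Finset.sum_le_sum fun v hv =>
          mul_le_mul_of_nonneg_left (hf v (mem_ball.1 hv)) (Nat.cast_nonneg _)
    _ = _ := by
        simp only [mul_add, Finset.sum_add_distrib, ← Finset.sum_mul, mul_ite, mul_zero]
        rw [Finset.sum_ite_eq', if_pos (mem_ball.2 (show InBall j (lure ⟨j, hj⟩) from le_rfl))]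
        simp [ballWeight, weight]

open Classical in
theorem le_sum_ball {j : ℕ} (hj : j < π.P) {f : Loc π → ℝ} {c x : ℝ}
    (hf : ∀ v, InBall j v → (c + if v = lure ⟨j, hj⟩ then x else 0) ≤ f v) :
    ballWeight π j * c + x ≤ ∑ v ∈ ball π j, (weight v : ℝ) * f v := by
  have := sum_ball_le hj (f := fun v => - f v) (c := -c) (x := -x) (fun v hv => by
    have := hf v hv
    split_ifs at this ⊢ <;> linarith)
  simp only [mul_neg, Finset.sum_neg_distrib] at this
  linarith

/-- The covered locations when phase `j` is reached and the core region is not covered. -/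
structure Front (A : Finset (Loc π)) (j : ℕ) : Prop where
  base_mem : base ∈ A
  shell_mem : ∀ i : Fin π.P, (i : ℕ) < j → shell i ∈ A
  ball_notMem : ∀ v, InBall j v → v ∉ A
  filler_notMem : ∀ (i : Fin π.P) (m : Fin π.s), j < i → filler i m ∉ A
  light_notMem : ∀ m : Fin π.t, light m ∉ A

section
variable {Ω : ℝ} (hπ : π.Valid Ω) (h : IsRealization weight (sqDist (π := π)) e p)
  {A : Finset (Loc π)} {j : ℕ}

/-- The center is the base for `j = 0` and shell `j - 1` otherwise. It has norm `ρ j` and is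
orthogonal to all locations of the ball, so Pythagoras applies. -/
theorem Front.exists_center (hA : Front A j) (hj : j < π.P) :
    ∃ c ∈ A, ∀ v : Loc π, InBall j v → sqDist v c = gram v v + π.ρ j ^ 2 := by
  cases j with
  | zero =>
    refine ⟨base, hA.base_mem, fun v hv => ?_⟩
    cases v <;> simp [InBall] at hv <;> simp [sqDist, gram]
  | succ j =>
    refine ⟨shell ⟨j, by omega⟩, hA.shell_mem _ (Nat.lt_succ_self j), fun v hv => ?_⟩
    cases v <;> simp only [InBall] at hv
    case shell i =>
      have : i ≠ ⟨j, by omega⟩ := by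
        rw [Ne, Fin.ext_iff]
        simp only
        omega
      simp [sqDist, gram, this]
    case lure i =>
      have : ⟨j, by omega⟩ ≠ i := by
        rw [Ne, Fin.ext_iff]
        simp only
        omega
      simp [sqDist, gram, this]
    all_goals simp [sqDist, gram]

include hπ h

-- No covered location is closer than the center of norm `ρ j`: earlier shells are orthogonal to the
-- ball and at least as long, a lure has squared norm `2 ρ i ^ 2` against an inner product of at
-- most `ρ i`, and spokes are farther than the base.
omit h in
theorem Front.setDist_eq (hA : Front A j) (hj : j < π.P) {v : Loc π} (hv : InBall j v) :
    setDist sqDist A v = gram v v + π.ρ j ^ 2 := by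
  apply le_antisymm
  · obtain ⟨c, hc, hcv⟩ := hA.exists_center hj
    exact (setDist_le _ _ hc).trans (hcv v hv).le
  refine le_setDist _ ⟨_, hA.base_mem⟩ _ fun a ha => ?_
  have hr0 : π.ρ j ^ 2 ≤ π.ρ 0 ^ 2 :=
    pow_le_pow_left₀ (by linarith [hπ.rho_ge hj.le]) (hπ.rho_anti (Nat.zero_le j) hj.le) 2
  have hbase : gram v v + π.ρ j ^ 2 ≤ sqDist v base := by
    cases v <;> simp [InBall] at hv <;> simp [sqDist, gram] <;> linarith
  have hva : v ≠ a := by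
    rintro rfl
    exact hA.ball_notMem _ hv ha
  cases a with
  | base => exact hbase
  | filler i m =>
    rw [(hπ.isSpoke_filler i m).sqDist_eq v hva]
    linarith [(hπ.isSpoke_filler i m).nonneg]
  | light m =>
    rw [(isSpoke_light m).sqDist_eq v hva]
    linarith [(isSpoke_light (π := π) m).nonneg]
  | decoy => exact absurd ha (hA.ball_notMem _ trivial)
  | core => exact absurd ha (hA.ball_notMem _ trivial)
  | sat m => exact absurd ha (hA.ball_notMem _ trivial)
  | shell i =>
    have hi : (i : ℕ) < j := by
      by_contra hi
      exact hA.ball_notMem (shell i) (not_lt.1 hi) ha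
    have hri : π.ρ j ^ 2 ≤ π.ρ (i + 1) ^ 2 :=
      pow_le_pow_left₀ (by linarith [hπ.rho_ge hj.le]) (hπ.rho_anti hi hj.le) 2
    cases v <;> simp only [InBall] at hv
    case shell i' =>
      have : i' ≠ i := by rintro rfl; omega
      simp [sqDist, gram, this, hri]
    case lure i' =>
      have : i ≠ i' := by rintro rfl; omega
      simp [sqDist, gram, this, hri]
    all_goals simp [sqDist, gram, hri]
  | lure i =>
    have hi : (i : ℕ) < j := by
      by_contra hi
      exact hA.ball_notMem (lure i) (not_lt.1 hi) ha
    have hri := hπ.rho_anti hi.le hj.le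
    have hj' := hπ.rho_ge hj.le
    have h₁ : π.ρ j ^ 2 + 2 * π.ρ i ≤ 2 * π.ρ i ^ 2 := by nlinarith
    have h₂ : (π.P : ℝ)⁻¹ * π.ρ i ≤ π.ρ i := by
      have := hπ.one_div_P_le
      rw [one_div] at this
      nlinarith
    have h₃ : 0 < π.ρ i := by linarith
    cases v <;> simp only [InBall] at hv
    case shell i' =>
      have : i' ≠ i := by rintro rfl; omega
      simp [sqDist, gram, this]
      linarith
    case lure i' =>
      have : i' ≠ i := by rintro rfl; omega
      simp [sqDist, gram, this]
      linarith
    all_goals simp [sqDist, gram]; linarith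

end

end Loc

/-! ### The greedy order of the candidates within a phase -/

namespace Loc

variable {π : Params} {e : ℝ} {d : ℕ} {p : (Σ v : Loc π, Fin (weight v)) → Pt d} {Ω : ℝ}

open Classical in
/-- The uncovered fillers of phase `j`. -/
def fillersLeft (A : Finset (Loc π)) (j : Fin π.P) : Finset (Loc π) :=
  Finset.univ.filter fun v => v ∉ A ∧ ∃ m, v = filler j m

theorem mem_fillersLeft {A : Finset (Loc π)} {j : Fin π.P} {v : Loc π} :
    v ∈ fillersLeft A j ↔ v ∉ A ∧ ∃ m, v = filler j m := by
  simp [fillersLeft]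

/-- The covered locations in the course of phase `j`, when the core region is not covered and `u`
fillers of the phase are left. -/
structure Pre (A : Finset (Loc π)) (j : Fin π.P) (u : ℕ) : Prop extends Front A j where
  lure_mem : ∀ i < j, lure i ∈ A
  filler_mem : ∀ i < j, ∀ m, filler i m ∈ A
  card_eq : (fillersLeft A j).card = u

variable (hπ : π.Valid Ω) (h : IsRealization weight (sqDist (π := π)) e p)
  {A : Finset (Loc π)} {j : Fin π.P} {u : ℕ}
include hπ h

/-- Outside the ball every location is covered or is a spoke, so only the ball contributes. There
the old cost is known exactly, and the norm of `v` cancels against the new distance. -/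
theorem Pre.gain_eq (hA : Pre A j u) {x : Loc π} (hx : InBall j x) :
    gain weight sqDist A x = ∑ v ∈ ball π j, (weight v : ℝ) *
      max 0 (π.ρ j ^ 2 + 2 * gram v x - gram x x) := by
  rw [gain]
  symm
  have key : ∀ v ∈ ball π j, (weight v : ℝ) * max 0 (π.ρ j ^ 2 + 2 * gram v x - gram x x) =
      weight v * max 0 (setDist sqDist A v - sqDist v x) := by
    intro v hv
    rw [hA.setDist_eq hπ j.2 (mem_ball.1 hv), sqDist]
    congr 2
    ring
  rw [Finset.sum_congr rfl key]
  refine Finset.sum_subset (Finset.subset_univ _) fun v _ hv => ?_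
  rw [mem_ball] at hv
  have hmem : v ∈ A → (weight v : ℝ) * max 0 (setDist sqDist A v - sqDist v x) = 0 := fun hvA => by
    rw [max_eq_zero_of_mem h hvA, mul_zero]
  cases v with
  | base => exact hmem hA.base_mem
  | shell i => exact hmem (hA.shell_mem i (not_le.1 hv))
  | lure i => exact hmem (hA.lure_mem i (not_le.1 hv))
  | decoy => exact absurd trivial hv
  | core => exact absurd trivial hv
  | sat m => exact absurd trivial hv
  | filler i m =>
    rw [(hπ.isSpoke_filler i m).max_eq_zero h hA.base_mem (by rintro rfl; exact hx), mul_zero]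
  | light m =>
    rw [(isSpoke_light m).max_eq_zero h hA.base_mem (by rintro rfl; exact hx), mul_zero]

omit h in
/-- The center `x` has at most the gain of the core, up to lower scales. -/
theorem two_gram_sub_le {v x : Loc π} (hv : InBall j v) (hx : InBall j x) (h₁ : x ≠ shell j)
    (h₂ : x ≠ decoy) (h₃ : x ≠ lure j) : 2 * gram v x - gram x x ≤ 2 * π.ρ (j + 1) ^ 2 := by
  have hH := hπ.rho_ge (show (j : ℕ) + 1 ≤ π.P from j.2)
  have hΩ := (hπ.rho_bounds j.2).1
  have hΩ₁ := hπ.one_le_Ω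
  have hΩ₂ : Ω ≤ Ω ^ 3 := le_self_pow₀ hΩ₁ (by norm_num)
  have ha := hπ.a_real
  have haΩ := hπ.a_le
  have ha2 : 10 * (π.a : ℝ) ^ 2 ≤ 2 * π.ρ (j + 1) ^ 2 := by
    nlinarith [sq_nonneg (π.a : ℝ), pow_pos (show (0 : ℝ) < π.a by linarith) 2]
  have hH2 : 0 ≤ π.ρ (j + 1) ^ 2 := sq_nonneg _
  cases x with
  | base => exact hx.elim
  | filler i m => exact hx.elim
  | light m => exact hx.elim
  | decoy => exact absurd rfl h₂
  | core =>
    have : gram v (core : Loc π) = 0 := by cases v <;> simp [gram]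
    rw [this]
    simp only [gram]
    linarith
  | sat m =>
    rw [gram_sat]
    cases v <;> simp only [InBall] at hv <;> simp only [gram]
    case sat m' =>
      split_ifs <;> nlinarith
    all_goals nlinarith
  | shell i =>
    have hij : (j : ℕ) + 1 ≤ i := by
      have : i ≠ j := by rintro rfl; exact h₁ rfl
      have h' : (j : ℕ) ≤ i := hx
      have := Fin.val_ne_of_ne this
      omega
    have r₁ := hπ.rho_anti hij i.2.le
    have r₂ := hπ.rho_anti (Nat.le_succ i) (show (i : ℕ) + 1 ≤ π.P from i.2)
    have r₃ := hπ.rho_ge (show (i : ℕ) + 1 ≤ π.P from i.2)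
    have r₄ : π.ρ i ^ 2 ≤ π.ρ (j + 1) ^ 2 := pow_le_pow_left₀ (by linarith) r₁ 2
    simp only [Nat.succ_eq_add_one] at r₂
    cases v <;> simp only [InBall] at hv <;> simp only [gram, if_true]
    case shell i' =>
      split_ifs with hii
      · subst hii
        nlinarith
      · nlinarith
    case lure i' =>
      split_ifs <;> nlinarith
    all_goals nlinarith [sq_nonneg (π.ρ (i + 1))]
  | lure i =>
    have hij : (j : ℕ) + 1 ≤ i := by
      have : i ≠ j := by rintro rfl; exact h₃ rfl
      have h' : (j : ℕ) ≤ i := hx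
      have := Fin.val_ne_of_ne this
      omega
    have r₁ := hπ.rho_anti hij i.2.le
    have r₂ := hπ.rho_anti (Nat.le_succ i) (show (i : ℕ) + 1 ≤ π.P from i.2)
    have r₃ := hπ.rho_ge (show (i : ℕ) + 1 ≤ π.P from i.2)
    have r₄ : π.ρ i ^ 2 ≤ π.ρ (j + 1) ^ 2 := pow_le_pow_left₀ (by linarith) r₁ 2
    simp only [Nat.succ_eq_add_one] at r₂
    have r₅ : (1 / π.P : ℝ) * π.ρ i ≤ π.ρ i := by
      have := hπ.one_div_P_le
      nlinarith
    cases v <;> simp only [InBall] at hv <;> simp only [gram, if_true]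
    case shell i' =>
      split_ifs with hii
      · subst hii
        nlinarith
      · nlinarith
    case lure i' =>
      split_ifs with hii
      · subst hii
        nlinarith
      · nlinarith
    all_goals nlinarith

/-- This rules out the core in particular. Without a bonus of order `ρ j` from the lure, the gain
exceeds `W ρ j ^ 2` by at most `2 W ρ (j + 1) ^ 2`, less than the surplus `ρ (j + 1) ^ 3` built into
the filler. -/
theorem Pre.gain_lt (hA : Pre A j u) {x : Loc π} (hx : InBall j x) (h₁ : x ≠ shell j)
    (h₂ : x ≠ decoy) : gain weight sqDist A x < fillerCost π j := by
  classical
  have hΩ := (hπ.rho_bounds j.2).1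
  have hΩ₁ := hπ.one_le_Ω
  have hΩ₂ : Ω ≤ Ω ^ 3 := le_self_pow₀ hΩ₁ (by norm_num)
  have hW := hπ.ballWeight_le j
  have hW₄ := hπ.four_le_ballWeight j
  have hH := hπ.rho_ge (show (j : ℕ) + 1 ≤ π.P from j.2)
  have hR := hπ.rho_ge j.2.le
  rw [hA.gain_eq hπ h hx]
  by_cases h₃ : x = lure j
  -- The lure itself has squared norm `2 ρ j ^ 2`, too far out to help anything but itself. Its own
  -- gain is `3 ρ j ^ 2`, while a filler costs at least `4 ρ j ^ 2`.
  · have := sum_ball_le j.2 (f := fun v => max 0 (π.ρ j ^ 2 + 2 * gram v x - gram x x))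
      (c := 0) (x := 3 * π.ρ j ^ 2) (fun v hv => by
        subst h₃
        have r₂ := hπ.rho_anti (Nat.le_succ j) (show (j : ℕ) + 1 ≤ π.P from j.2)
        simp only [Nat.succ_eq_add_one] at r₂
        have r₆ : 2 * π.ρ (j + 1) ≤ π.ρ j := by
          rw [(hπ.rho_bounds j.2).2]
          calc 2 * π.ρ (j + 1) ≤ π.ρ (j + 1) * π.ρ (j + 1) := by nlinarith
            _ = π.ρ (j + 1) ^ 2 := by ring
            _ ≤ π.ρ (j + 1) ^ 4 := pow_le_pow_right₀ (by linarith) (by norm_num)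
        have r₅ : (1 / π.P : ℝ) * π.ρ j ≤ π.ρ j := by
          have := hπ.one_div_P_le
          nlinarith
        rw [zero_add]
        cases v <;> simp only [InBall] at hv <;>
          simp only [gram, if_true, lure.injEq, Fin.eta, reduceCtorEq, if_false]
        case shell i =>
          refine max_le le_rfl ?_
          split_ifs with hij
          · subst hij
            nlinarith
          · nlinarith
        case lure i =>
          split_ifs with hij
          · subst hij
            refine max_le (by positivity) ?_
            linarith
          · refine max_le le_rfl ?_
            nlinarith
        all_goals
          refine max_le le_rfl ?_
          nlinarith)
    rw [mul_zero, zero_add] at this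
    have h' := hπ.rho_sq_le_fillerCost j.2
    nlinarith
  · have := sum_ball_le j.2 (f := fun v => max 0 (π.ρ j ^ 2 + 2 * gram v x - gram x x))
      (c := π.ρ j ^ 2 + 2 * π.ρ (j + 1) ^ 2) (x := 0) (fun v hv => by
        have := two_gram_sub_le hπ hv hx h₁ h₂ h₃
        simp only [ite_self, add_zero]
        refine max_le (by positivity) (by linarith))
    refine this.trans_lt ?_
    rw [fillerCost]
    have : 2 * ballWeight π j < π.ρ (j + 1) := by linarith
    nlinarith [pow_pos (show 0 < π.ρ (j + 1) by linarith) 2]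

/-- The inner product with the lure adds `2 ρ j ρ (j + 1) = 2 ρ (j + 1) ^ 5`. This pays for both the
loss `W ρ (j + 1) ^ 2` and the filler surplus `ρ (j + 1) ^ 3`. -/
theorem Pre.lt_gain_shell (hA : Pre A j u) : fillerCost π j < gain weight sqDist A (shell j) := by
  classical
  have hΩ := (hπ.rho_bounds j.2).1
  have hrec := (hπ.rho_bounds j.2).2
  have hΩ₁ := hπ.one_le_Ω
  have hΩ₂ : Ω ≤ Ω ^ 3 := le_self_pow₀ hΩ₁ (by norm_num)
  have hW := hπ.ballWeight_le j
  have hH := hπ.rho_ge (show (j : ℕ) + 1 ≤ π.P from j.2)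
  have hR := hπ.rho_ge j.2.le
  rw [hA.gain_eq hπ h (show InBall j (shell j) from le_rfl)]
  have := le_sum_ball j.2
    (f := fun v => max 0 (π.ρ j ^ 2 + 2 * gram v (shell j) - gram (shell j) (shell j)))
    (c := π.ρ j ^ 2 - π.ρ (j + 1) ^ 2) (x := 2 * (π.ρ j * π.ρ (j + 1))) (fun v hv => by
      refine le_trans ?_ (le_max_right _ _)
      cases v <;> simp only [InBall] at hv <;>
        simp only [gram, if_true, lure.injEq, Fin.eta, reduceCtorEq, if_false]
      case shell i =>
        split_ifs with hij
        · subst hij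
          nlinarith
        · linarith
      case lure i =>
        by_cases hij : i = j
        · subst hij
          simp only [if_true]
          linarith
        · have hji : ¬ j = i := fun hh => hij hh.symm
          simp only [hij, hji, if_false]
          linarith
      all_goals linarith)
  refine lt_of_lt_of_le ?_ this
  rw [fillerCost]
  generalize π.ρ (↑j + 1) = H at *
  rw [hrec] at *
  have h₁ : ballWeight π j * H ^ 2 ≤ H ^ 3 := by
    have : ballWeight π j ≤ H := by linarith
    calc ballWeight π j * H ^ 2 ≤ H * H ^ 2 := mul_le_mul_of_nonneg_right this (sq_nonneg _)
      _ = H ^ 3 := by ring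
  have h₂ : H ^ 3 < H ^ 4 * H := by
    calc H ^ 3 < H ^ 5 := pow_lt_pow_right₀ (by linarith) (by norm_num)
      _ = H ^ 4 * H := by ring
  linarith

/-- The bonus from the lure is `2 ρ j / P = 2 ρ (j + 1) ^ 4 / P`, still above the filler surplus
because `P < ρ (j + 1)`. The loss on the rest of the ball is at most `W (2 + 2a)`, caused mainly by
the satellites, which lean away. -/
theorem Pre.lt_gain_decoy (hA : Pre A j u) : fillerCost π j < gain weight sqDist A decoy := by
  classical
  have hΩ := (hπ.rho_bounds j.2).1
  have hrec := (hπ.rho_bounds j.2).2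
  have hΩ₁ := hπ.one_le_Ω
  have hΩ₂ : Ω ≤ Ω ^ 3 := le_self_pow₀ hΩ₁ (by norm_num)
  have hW := hπ.ballWeight_le j
  have hW₀ := ballWeight_nonneg π j
  have hH := hπ.rho_ge (show (j : ℕ) + 1 ≤ π.P from j.2)
  have hR := hπ.rho_ge j.2.le
  have hY := hπ.gram_decoy
  have ha := hπ.a_real
  have haΩ := hπ.a_le
  have hP := hπ.P_real
  have hPΩ := hπ.P_le
  rw [hA.gain_eq hπ h (show InBall j decoy from trivial)]
  have := le_sum_ball j.2
    (f := fun v => max 0 (π.ρ j ^ 2 + 2 * gram v decoy - gram (decoy : Loc π) decoy))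
    (c := π.ρ j ^ 2 - (2 + 2 * π.a)) (x := 2 * ((1 / π.P) * π.ρ j)) (fun v hv => by
      refine le_trans ?_ (le_max_right _ _)
      by_cases hv' : v = lure j
      · subst hv'
        simp only [Fin.eta, if_true]
        have : gram (lure j) (decoy : Loc π) = (1 / π.P) * π.ρ j := rfl
        rw [this]
        linarith
      · simp only [Fin.eta, hv', if_false]
        have : -(π.a : ℝ) ≤ gram v decoy := by
          cases v <;> simp only [InBall] at hv <;> simp only [gram]
          case lure i =>
            have := hπ.rho_ge i.2.le
            have : 0 ≤ (1 / π.P : ℝ) * π.ρ i := by positivity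
            linarith
          case decoy =>
            have : 0 ≤ 1 + π.P * (1 / π.P : ℝ) ^ 2 := by positivity
            linarith
          all_goals linarith
        linarith)
  refine lt_of_lt_of_le ?_ this
  rw [fillerCost]
  generalize π.ρ (↑j + 1) = H at *
  rw [hrec] at *
  have ha' : 2 + 2 * (π.a : ℝ) ≤ Ω := by nlinarith [sq_nonneg (π.a : ℝ), pow_pos (show (0 : ℝ) < π.a by linarith) 2]
  have h₁ : ballWeight π j * (2 + 2 * π.a) ≤ H ^ 3 := by
    have h' : ballWeight π j ≤ H := by linarith
    calc ballWeight π j * (2 + 2 * π.a) ≤ H * H := by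
          apply mul_le_mul h' (by linarith) (by linarith) (by linarith)
      _ = H ^ 2 := by ring
      _ ≤ H ^ 3 := pow_le_pow_right₀ (by linarith) (by norm_num)
  have h₂ : H ^ 3 < (1 / π.P) * H ^ 4 := by
    rw [one_div, inv_mul_eq_div, lt_div_iff₀ (by linarith)]
    have : (π.P : ℝ) < H := by linarith
    calc H ^ 3 * π.P < H ^ 3 * H := mul_lt_mul_of_pos_left this (by positivity)
      _ = H ^ 4 := by ring
  nlinarith

/-- A location that is at least as good as a filler of phase `j`. -/
theorem Pre.of_le_gain (hA : Pre A j u) {x : Loc π} (hx : fillerCost π j ≤ gain weight sqDist A x) :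
    x = shell j ∨ x = decoy ∨ x ∈ fillersLeft A j := by
  have hpos : 0 < fillerCost π j := by
    have := hπ.rho_sq_le_fillerCost j.2
    have := hπ.rho_ge j.2.le
    nlinarith
  have hmem : x ∉ A := by
    intro hxA
    rw [gain_eq_zero_of_mem hxA] at hx
    linarith
  by_contra hcon
  push Not at hcon
  by_cases hb : InBall j x
  · have := hA.gain_lt hπ h hb hcon.1 hcon.2.1
    linarith
  have hΩ := (hπ.rho_bounds j.2).1
  have hrec := (hπ.rho_bounds j.2).2
  have hΩ₁ := hπ.one_le_Ω
  have hΩ₂ : Ω ≤ Ω ^ 3 := le_self_pow₀ hΩ₁ (by norm_num)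
  have hH := hπ.rho_ge (show (j : ℕ) + 1 ≤ π.P from j.2)
  have hF := hπ.rho_sq_le_fillerCost j.2
  have hH8 : π.ρ j ^ 2 = π.ρ (j + 1) ^ 8 := by rw [hrec]; ring
  have hH3 : π.ρ (j + 1) ^ 3 ≤ π.ρ (j + 1) ^ 8 := pow_le_pow_right₀ (by linarith) (by norm_num)
  have hH1 : π.ρ (j + 1) ≤ π.ρ (j + 1) ^ 8 := le_self_pow₀ (by linarith) (by norm_num)
  cases x with
  | base => exact hmem hA.base_mem
  | shell i => exact hmem (hA.shell_mem i (not_le.1 hb))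
  | lure i => exact hmem (hA.lure_mem i (not_le.1 hb))
  | decoy => exact hb trivial
  | core => exact hb trivial
  | sat m => exact hb trivial
  | filler i m =>
    rcases lt_trichotomy i j with hij | rfl | hij
    · exact hmem (hA.filler_mem i hij m)
    · exact hcon.2.2 (mem_fillersLeft.2 ⟨hmem, m, rfl⟩)
    · rw [(hπ.isSpoke_filler i m).gain_eq h hA.base_mem hmem] at hx
      have := hπ.fillerCost_le (Fin.lt_def.1 hij) i.2
      linarith
  | light m =>
    rw [(isSpoke_light m).gain_eq h hA.base_mem hmem] at hx
    have := hπ.lightCost_le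
    linarith

end Loc

/-! ### Costs within a phase, and one step of it -/

namespace Loc

variable {π : Params} {e : ℝ} {d : ℕ} {p : (Σ v : Loc π, Fin (weight v)) → Pt d} {Ω : ℝ}
variable (hπ : π.Valid Ω) (h : IsRealization weight (sqDist (π := π)) e p)
  {A : Finset (Loc π)} {j : Fin π.P} {u : ℕ}

/-- A bound for the cost of the uncovered fillers after phase `j`. -/
def lowCost (j : ℕ) : Loc π → ℝ
  | filler i _ => if j < i then fillerCost π i else 0
  | light _ => lightCost π
  | _ => 0

include hπ

theorem lowCost_nonneg (j : ℕ) (v : Loc π) : 0 ≤ lowCost j v := by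
  cases v <;> simp only [lowCost, le_refl]
  · split_ifs
    · exact hπ.fillerCost_nonneg _
    · exact le_rfl
  · unfold lightCost
    positivity

theorem sum_lowCost_le {j : ℕ} (hj : j < π.P) :
    ∑ v : Loc π, lowCost j v ≤ Ω * (2 * π.ρ (j + 1) ^ 3) + Ω := by
  have hH := hπ.rho_ge (show j + 1 ≤ π.P from hj)
  rw [sum_eq]
  simp only [lowCost, Finset.sum_const_zero, zero_add]
  refine add_le_add ?_ ?_
  · calc _ ≤ ∑ _i : Fin π.P, ∑ _m : Fin π.s, 2 * π.ρ (j + 1) ^ 3 := by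
          refine Finset.sum_le_sum fun i _ => Finset.sum_le_sum fun m _ => ?_
          split_ifs with hij
          · exact hπ.fillerCost_le hij i.2
          · positivity
      _ = (π.P * π.s) * (2 * π.ρ (j + 1) ^ 3) := by
          simp
          ring
      _ ≤ _ := mul_le_mul_of_nonneg_right hπ.filler_le (by positivity)
  · have := hπ.light_le
    simpa [lightCost] using this

/-- The cost of the ball of phase `j` and of all later fillers. -/
theorem sum_ball_add_lowCost_le {j : ℕ} (hj : j < π.P) :
    ∑ v ∈ ball π j, (weight v : ℝ) * (gram v v + π.ρ j ^ 2) + ∑ v : Loc π, lowCost j v ≤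
      ballWeight π j * π.ρ j ^ 2 + 4 * π.ρ j ^ 2 - 1 := by
  classical
  have hH := hπ.rho_ge (show j + 1 ≤ π.P from hj)
  have hR := hπ.rho_ge hj.le
  have hΩ := (hπ.rho_bounds hj).1
  have hrec := (hπ.rho_bounds hj).2
  have hΩ₁ := hπ.one_le_Ω
  have hΩ₂ : Ω ≤ Ω ^ 3 := le_self_pow₀ hΩ₁ (by norm_num)
  have hW := hπ.ballWeight_le j
  have hY := hπ.gram_decoy
  have ha := hπ.a_real
  have haΩ := hπ.a_le
  have h₁ := sum_ball_le hj (f := fun v => gram v v + π.ρ j ^ 2)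
    (c := π.ρ j ^ 2 + 2 * π.ρ (j + 1) ^ 2) (x := 2 * π.ρ j ^ 2) (fun v hv => by
      have hq : ∀ i : Fin π.P, j + 1 ≤ i → π.ρ i ^ 2 ≤ π.ρ (j + 1) ^ 2 := fun i hi =>
        pow_le_pow_left₀ (by linarith [hπ.rho_ge i.2.le]) (hπ.rho_anti hi i.2.le) 2
      have hH2 : (2 : ℝ) ≤ π.ρ (j + 1) ^ 2 := by nlinarith
      cases v <;> simp only [InBall] at hv <;>
        simp only [reduceCtorEq, if_false, add_zero, lure.injEq]
      case shell i =>
        have h₂ : π.ρ (i + 1) ^ 2 ≤ π.ρ (j + 1) ^ 2 :=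
          pow_le_pow_left₀ (by linarith [hπ.rho_ge (show (i : ℕ) + 1 ≤ π.P from i.2)])
            (hπ.rho_anti (by omega) i.2) 2
        simp only [gram, if_true]
        nlinarith
      case lure i =>
        simp only [gram, if_true]
        split_ifs with hij
        · subst hij
          simp only
          nlinarith
        · have : j + 1 ≤ i := by
            rcases Nat.lt_or_ge j i with h' | h'
            · exact h'
            · exact absurd (Fin.ext (le_antisymm h' hv)) hij
          linarith [hq i this]
      case decoy => linarith
      case core =>
        simp only [gram]
        nlinarith
      case sat m =>
        rw [gram_sat]
        nlinarith [sq_nonneg (π.a : ℝ), pow_pos (show (0 : ℝ) < π.a by linarith) 2])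
  have h₂ := sum_lowCost_le hπ hj
  generalize π.ρ (j + 1) = H at *
  rw [hrec] at *
  have h₃ : ballWeight π j * (2 * H ^ 2) ≤ H ^ 3 := by
    have : 2 * ballWeight π j ≤ H := by linarith
    calc ballWeight π j * (2 * H ^ 2) = (2 * ballWeight π j) * H ^ 2 := by ring
      _ ≤ H * H ^ 2 := mul_le_mul_of_nonneg_right this (sq_nonneg _)
      _ = H ^ 3 := by ring
  have h₄ : Ω * (2 * H ^ 3) ≤ H ^ 4 := by
    calc Ω * (2 * H ^ 3) = (2 * Ω) * H ^ 3 := by ring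
      _ ≤ H * H ^ 3 := mul_le_mul_of_nonneg_right (by linarith) (by positivity)
      _ = H ^ 4 := by ring
  have h₅ : H ^ 3 ≤ H ^ 4 := pow_le_pow_right₀ (by linarith) (by norm_num)
  have h₆ : H ≤ H ^ 4 := le_self_pow₀ (by linarith) (by norm_num)
  have h₇ : 4 * H ^ 4 ≤ (H ^ 4) ^ 2 := by nlinarith
  linarith

include h

-- Apart from the fillers of the phase, the ball costs `W ρ j ^ 2`, and the excess of the lure
-- together with all lower scales fits into `4 ρ j ^ 2 ≤ W ρ j ^ 2`. The `- 1` leaves room for the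
-- total perturbation.
open Classical in
theorem Pre.sum_rest_le (hA : Pre A j u) : ∑ v with v ∉ fillersLeft A j,
    (weight v : ℝ) * setDist sqDist A v ≤ 2 * (ballWeight π j * π.ρ j ^ 2) - 1 := by
  have h₁ := sum_ball_add_lowCost_le hπ j.2
  have hW := mul_le_mul_of_nonneg_right (hπ.four_le_ballWeight j) (sq_nonneg (π.ρ j))
  refine le_trans ?_ (show ballWeight π j * π.ρ j ^ 2 + 4 * π.ρ j ^ 2 - 1 ≤ _ by linarith)
  refine le_trans ?_ h₁
  rw [ball, Finset.sum_filter, Finset.sum_filter, ← Finset.sum_add_distrib]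
  refine Finset.sum_le_sum fun v _ => ?_
  have hlow := lowCost_nonneg hπ j v
  by_cases hb : InBall j v
  · rw [if_pos hb, hA.setDist_eq hπ j.2 hb]
    have hpos : 0 ≤ (weight v : ℝ) * (gram v v + π.ρ j ^ 2) := by
      rw [← hA.setDist_eq hπ j.2 hb]
      exact mul_nonneg (Nat.cast_nonneg _) (h.setDist_nonneg A v)
    split_ifs <;> linarith
  rw [if_neg hb, zero_add]
  by_cases hvA : v ∈ A
  · rw [h.setDist_eq_zero hvA, mul_zero]
    split_ifs <;> exact hlow
  cases v with
  | base => exact absurd hA.base_mem hvA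
  | shell i => exact absurd (hA.shell_mem i (not_le.1 hb)) hvA
  | lure i => exact absurd (hA.lure_mem i (not_le.1 hb)) hvA
  | decoy => exact absurd trivial hb
  | core => exact absurd trivial hb
  | sat m => exact absurd trivial hb
  | filler i m =>
    rcases lt_trichotomy i j with hij | rfl | hij
    · exact absurd (hA.filler_mem i hij m) hvA
    · rw [if_neg]
      · exact hlow
      · rw [not_not]
        exact mem_fillersLeft.2 ⟨hvA, m, rfl⟩
    · split_ifs
      · exact hlow
      · rw [(hπ.isSpoke_filler i m).setDist_eq h hA.base_mem hvA]
        simp only [weight, lowCost]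
        rw [if_pos (Fin.lt_def.1 hij)]
        simp
  | light m =>
    split_ifs
    · exact hlow
    · rw [(isSpoke_light m).setDist_eq h hA.base_mem hvA]
      simp [weight, lowCost]

theorem Pre.sum_fillersLeft (hA : Pre A j u) : ∑ v ∈ fillersLeft A j,
    (weight v : ℝ) * setDist sqDist A v = u * fillerCost π j := by
  rw [← hA.card_eq, ← nsmul_eq_mul, ← Finset.sum_const]
  refine Finset.sum_congr rfl fun v hv => ?_
  obtain ⟨hvA, m, rfl⟩ := mem_fillersLeft.1 hv
  rw [(hπ.isSpoke_filler j m).setDist_eq h hA.base_mem hvA]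
  simp [weight]

theorem Pre.le_locCost (hA : Pre A j u) :
    u * (ballWeight π j * π.ρ j ^ 2) ≤ locCost weight sqDist A := by
  classical
  calc _ ≤ u * fillerCost π j :=
        mul_le_mul_of_nonneg_left (hπ.sq_le_fillerCost j.2) (Nat.cast_nonneg _)
    _ = _ := (hA.sum_fillersLeft hπ h).symm
    _ ≤ _ := Finset.sum_le_sum_of_subset_of_nonneg (Finset.subset_univ _) fun v _ _ =>
        mul_nonneg (Nat.cast_nonneg _) (h.setDist_nonneg A v)

open Classical in
theorem Pre.locCost_le (hA : Pre A j u) (hu : 1 ≤ u) :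
    locCost weight sqDist A + 1 ≤ u * (4 * (ballWeight π j * π.ρ j ^ 2)) := by
  have h₁ := hA.sum_rest_le hπ h
  have h₂ := hA.sum_fillersLeft hπ h
  have h₃ : locCost weight sqDist A = ∑ v ∈ fillersLeft A j, (weight v : ℝ) * setDist sqDist A v +
      ∑ v with v ∉ fillersLeft A j, (weight v : ℝ) * setDist sqDist A v := by
    rw [locCost, ← Finset.sum_filter_add_sum_filter_not Finset.univ (fun v => v ∈ fillersLeft A j)]
    congr 2
    ext v
    simp
  have hF : fillerCost π j ≤ 2 * (ballWeight π j * π.ρ j ^ 2) := by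
    have hH := hπ.rho_ge (show (j : ℕ) + 1 ≤ π.P from j.2)
    have hrec := (hπ.rho_bounds j.2).2
    have hW := hπ.four_le_ballWeight j
    have h₄ : π.ρ (j + 1) ^ 3 ≤ π.ρ j ^ 2 := by
      rw [hrec, ← pow_mul]
      exact pow_le_pow_right₀ (by linarith) (by norm_num)
    rw [fillerCost]
    nlinarith [sq_nonneg (π.ρ j)]
  have hu' : (1 : ℝ) ≤ u := by exact_mod_cast hu
  have hB : 0 ≤ ballWeight π j * π.ρ j ^ 2 :=
    mul_nonneg (ballWeight_nonneg π j) (sq_nonneg _)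
  rw [h₃, h₂]
  nlinarith [mul_le_mul_of_nonneg_left hF (show (0 : ℝ) ≤ u by linarith)]

end Loc

/-- Bounds for the probabilities that a candidate is at the shell and at the decoy. -/
theorem mass_bounds {P n u R H g e c W : ℝ} (hP : 1 ≤ P) (hn : n = 12 * P ^ 2) (hu : 1 ≤ u)
    (hW₁ : n ≤ W) (hW₂ : W ≤ 2 * n) (hR : 10000 ≤ R) (hH₀ : 0 ≤ H) (hH : H ≤ R) (hg₁ : 1 ≤ g)
    (hg₂ : g ≤ 2) (he₀ : 0 < e) (he : e ≤ 1) (hpos : 0 < c) (hc₁ : u * (W * R) ≤ c)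
    (hc₂ : c ≤ u * (4 * (W * R))) :
    2 * (1 / (6 * P)) * (P * (H + R + e) / c + (g + R + e) / c) ≤ (g + R + e) / c ∧
    P * (H + R + e) / c + (g + R + e) / c ≤ 1 / (3 * u) ∧
    P / (8 * n) / u ≤ P * (H + R + e) / c := by
  have hn₀ : 0 < n := by
    rw [hn]
    positivity
  refine ⟨?_, ?_, ?_⟩
  -- The shell has `P` times the weight of the decoy and at most about twice its cost per point, so
  -- the decoy has at least the share `1/(3P)` of the joint mass.
  · have h2P : P * (H + R + e) / c ≤ 2 * P * ((g + R + e) / c) := by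
      rw [mul_div_assoc', div_le_div_iff_of_pos_right hpos]
      nlinarith
    have hY₀ : 0 ≤ (g + R + e) / c := div_nonneg (by linarith) hpos.le
    rw [show 2 * (1 / (6 * P)) = 1 / (3 * P) by field_simp; norm_num, one_div,
      inv_mul_le_iff₀ (by positivity)]
    nlinarith
  · rw [← add_div, div_le_div_iff₀ hpos (by positivity), one_mul]
    have hc : u * (12 * P ^ 2 * R) ≤ c := by
      refine le_trans ?_ hc₁
      refine mul_le_mul_of_nonneg_left ?_ (by linarith)
      refine mul_le_mul_of_nonneg_right ?_ (by positivity)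
      linarith
    refine le_trans ?_ hc
    have hnum : P * (H + R + e) + (g + R + e) ≤ 4 * P ^ 2 * R := by
      have e₁ : P * (H + R + e) ≤ P * (2 * R + 1) :=
        mul_le_mul_of_nonneg_left (by linarith) (by linarith)
      have e₂ : 1 * (R + 3) ≤ P * (R + 3) :=
        mul_le_mul_of_nonneg_right hP (by positivity)
      have e₃ : P * (P * R) ≥ 1 * (P * R) := mul_le_mul_of_nonneg_right hP (by positivity)
      have e₄ : P * (3 * R + 4) ≤ P * (4 * R) :=
        mul_le_mul_of_nonneg_left (by linarith) (by linarith)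
      nlinarith
    have := mul_le_mul_of_nonneg_right hnum (show (0 : ℝ) ≤ 3 * u by linarith)
    linarith
  · rw [div_div, div_le_div_iff₀ (by positivity) hpos, mul_assoc]
    refine mul_le_mul_of_nonneg_left ?_ (by linarith)
    have hc : c ≤ u * (4 * (2 * n * R)) := by
      refine hc₂.trans ?_
      refine mul_le_mul_of_nonneg_left ?_ (by linarith)
      refine mul_le_mul_of_nonneg_left ?_ (by norm_num)
      exact mul_le_mul_of_nonneg_right hW₂ (by positivity)
    have h₃ : 0 ≤ (H + e) * (8 * n * u) := by positivity
    linarith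

namespace IsRealization

variable {V : Type*} [Fintype V] {w : V → ℕ} {D : V → V → ℝ} {e : ℝ} {d l : ℕ}
  {p : (Σ v, Fin (w v)) → Pt d} (h : IsRealization w D e p)
  {r : Rule d l} (hr : IsGreedyRule h.points r) (hX : h.points.Nonempty)
  (Ev : Set (Finset (Pt d))) (m : ℕ) {C : Finset (Σ v, Fin (w v))}
include hr

open Classical in
/-- A step in which, up to a probability `τ`, some candidate lies in `Z`. -/
theorem stepProb_succ_ge_sub (hl : 1 ≤ l) (hC : C.Nonempty)
    (hpos : 0 < cost h.points (C.image p)) (Z : Finset V)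
    (hcov : ∀ v ∈ Z, v ∉ C.image Sigma.fst) {x τ : ℝ} (hx : x ≤ 1)
    (hτ : 1 - h.mass (C.image Sigma.fst) (cost h.points (C.image p)) Z ≤ τ)
    (h₀ : ∀ v ∈ Z, ∀ s : (Σ v, Fin (w v)),
      gain w D (C.image Sigma.fst) v ≤ gain w D (C.image Sigma.fst) s.1 →
      x ≤ stepProb h.points hX r Ev m ((insert s C).image p)) :
    x - τ ≤ stepProb h.points hX r Ev (m + 1) (C.image p) := by
  have hq₀ : 0 ≤ 1 - h.mass (C.image Sigma.fst) (cost h.points (C.image p)) Z := by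
    have := h.mass_le_one hX hC hpos Z hcov
    linarith
  have hq₁ : 1 - h.mass (C.image Sigma.fst) (cost h.points (C.image p)) Z ≤ 1 := by
    have := h.mass_nonneg (C.image Sigma.fst) Z hpos.le
    linarith
  rcases lt_or_ge x 0 with hneg | hx₀
  · have := stepProb_nonneg h.points hX r Ev (m + 1) (C.image p)
    linarith
  have key := h.stepProb_succ_ge hr hX Ev m hC hpos Z ∅ ∅ (by simpa using hcov) x 0 0
    (fun v hv s hs => h₀ v hv s (by
      rw [locCost_insert _ _ (hC.image _), locCost_insert _ _ (hC.image _)] at hs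
      linarith)) (by simp) (by simp)
  refine le_trans ?_ key
  have h₁ := pow_le_of_le_one hq₀ hq₁ (show l ≠ 0 by omega)
  rw [zero_mul, zero_mul, add_zero, add_zero]
  have h₂ : x * (1 - h.mass (C.image Sigma.fst) (cost h.points (C.image p)) Z) ^ l ≤ 1 * τ :=
    mul_le_mul hx (h₁.trans hτ) (pow_nonneg hq₀ l) zero_le_one
  linarith

end IsRealization

namespace Loc

variable {π : Params} {e : ℝ} {d l : ℕ} {p : (Σ v : Loc π, Fin (weight v)) → Pt d} {Ω : ℝ}
variable (hπ : π.Valid Ω) (h : IsRealization weight (sqDist (π := π)) e p)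
  {r : Rule d l} (hr : IsGreedyRule h.points r) (hX : h.points.Nonempty)
  (Ev : Set (Finset (Pt d))) (m : ℕ) {C : Finset (Σ v : Loc π, Fin (weight v))}
  {j : Fin π.P} {u : ℕ}

include hπ hr

set_option maxHeartbeats 1000000 in
open Classical in
/-- One step in the course of a phase. -/
theorem Pre.stepProb_succ_ge (hA : Pre (C.image Sigma.fst) j u) (hl : 2 ≤ l) (hlu : l ≤ u)
    (he : e * Fintype.card (Σ v : Loc π, Fin (weight v)) ≤ 1) {f V e' : ℝ}
    (hfV : f ≤ V) (hV : V ≤ 1) (he' : 0 ≤ e')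
    (h₀ : ∀ s : (Σ v : Loc π, Fin (weight v)), s.1 = shell j →
      f ≤ stepProb h.points hX r Ev m ((insert s C).image p))
    (h₁ : ∀ s : (Σ v : Loc π, Fin (weight v)), s.1 = decoy →
      V ≤ stepProb h.points hX r Ev m ((insert s C).image p))
    (h₂ : ∀ s : (Σ v : Loc π, Fin (weight v)), s.1 ∈ fillersLeft (C.image Sigma.fst) j →
      f + 1 / (6 * π.P) * (V - f) - e' ≤ stepProb h.points hX r Ev m ((insert s C).image p)) :
    f + 1 / (6 * π.P) * (V - f) -
      (Real.exp (-(l * π.P / (8 * π.n) / u)) * e' + (2 / u) ^ 2) ≤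
      stepProb h.points hX r Ev (m + 1) (C.image p) := by
  have hC : C.Nonempty := by
    obtain ⟨s, hs, -⟩ := Finset.mem_image.1 hA.base_mem
    exact ⟨s, hs⟩
  have hCi := hC.image Sigma.fst
  have hu : (1 : ℝ) ≤ u := by exact_mod_cast (show 1 ≤ u by omega)
  have hlu' : (l : ℝ) ≤ u := by exact_mod_cast hlu
  have hl' : (2 : ℝ) ≤ l := by exact_mod_cast hl
  have hP := hπ.P_real
  have hn : (π.n : ℝ) = 12 * π.P ^ 2 := by rw [hπ.n_eq]; push_cast; rfl
  have hW₁ := n_le_ballWeight π j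
  have hW₂ := hπ.ballWeight_le_two_mul j
  have hR := hπ.rho_ge j.2.le
  have hRH : π.ρ (j + 1) ^ 2 ≤ π.ρ j ^ 2 :=
    pow_le_pow_left₀ (by linarith [hπ.rho_ge (show (j : ℕ) + 1 ≤ π.P from j.2)])
      (hπ.rho_anti (Nat.le_succ j) j.2) 2
  have hR2 : 10000 ≤ π.ρ j ^ 2 := by nlinarith
  have hcost₁ := hA.le_locCost hπ h
  have hcost₂ := hA.locCost_le hπ h (by omega)
  have hcost₃ := h.locCost_le_cost hC
  have hcost₄ := h.cost_le hC
  have hWR : 0 < ballWeight π j * π.ρ j ^ 2 :=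
    mul_pos (by linarith [hπ.n_real]) (by positivity)
  have hpos : 0 < cost h.points (C.image p) :=
    lt_of_lt_of_le (mul_pos (by linarith) hWR) (hcost₁.trans hcost₃)
  have he₁ : e ≤ 1 := by
    have h₁ : (1 : ℝ) ≤ Fintype.card (Σ v : Loc π, Fin (weight v)) := by
      have : 0 < Fintype.card (Σ v : Loc π, Fin (weight v)) :=
        Fintype.card_pos_iff.2 ⟨⟨base, 0, hπ.wb_pos⟩⟩
      exact_mod_cast this
    nlinarith [h.e_pos]
  have he₀ := h.e_pos
  have hrest := hA.sum_rest_le hπ h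
  have dZ := hA.setDist_eq hπ j.2 (show InBall j (shell j) from le_rfl)
  have dY := hA.setDist_eq hπ j.2 (show InBall j (decoy : Loc π) from trivial)
  have hgZ : gram (shell j) (shell j) = π.ρ (j + 1) ^ 2 := by simp [gram]
  have hgY := hπ.gram_decoy
  have hcov : ∀ v ∈ ({shell j} ∪ {decoy} ∪ fillersLeft (C.image Sigma.fst) j : Finset (Loc π)),
      v ∉ C.image Sigma.fst := by
    intro v hv
    simp only [Finset.mem_union, Finset.mem_singleton] at hv
    rcases hv with (rfl | rfl) | hv
    · exact hA.ball_notMem _ le_rfl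
    · exact hA.ball_notMem _ trivial
    · exact (mem_fillersLeft.1 hv).1
  have hgF : ∀ v ∈ fillersLeft (C.image Sigma.fst) j,
      gain weight sqDist (C.image Sigma.fst) v = fillerCost π j := by
    intro v hv
    obtain ⟨hvA, i, rfl⟩ := mem_fillersLeft.1 hv
    exact (hπ.isSpoke_filler j i).gain_eq h hA.base_mem hvA
  have hgS := hA.lt_gain_shell hπ h
  have hgD := hA.lt_gain_decoy hπ h
  have hins : ∀ v x : Loc π, locCost weight sqDist (insert x (C.image Sigma.fst)) ≤
      locCost weight sqDist (insert v (C.image Sigma.fst)) →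
      gain weight sqDist (C.image Sigma.fst) v ≤ gain weight sqDist (C.image Sigma.fst) x := by
    intro v x hx
    rw [locCost_insert _ _ hCi, locCost_insert _ _ hCi] at hx
    linarith
  -- A sampled shell may still lose to a sampled decoy, which is harmless because `f ≤ V`. If only
  -- the decoy is sampled, the chosen center is at the decoy; if neither is sampled but a filler is,
  -- the chosen center is an uncovered filler of the phase.
  have key := h.stepProb_succ_ge hr hX Ev m hC hpos {shell j} {decoy}
    (fillersLeft (C.image Sigma.fst) j) hcov f V (f + 1 / (6 * π.P) * (V - f) - e')
    (fun v hv s hs => by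
      rw [Finset.mem_singleton.1 hv] at hs
      have hg := hins _ _ hs
      rcases hA.of_le_gain hπ h (hgS.le.trans hg) with hs | hs | hs
      · exact h₀ s hs
      · exact hfV.trans (h₁ s hs)
      · rw [hgF _ hs] at hg
        linarith)
    (fun v hv s hs₁ hs => by
      rw [Finset.mem_singleton.1 hv] at hs
      have hg := hins _ _ hs
      rcases hA.of_le_gain hπ h (hgD.le.trans hg) with hs | hs | hs
      · exact absurd (Finset.mem_singleton.2 hs) hs₁
      · exact h₁ s hs
      · rw [hgF _ hs] at hg
        linarith)
    (fun v hv s hs₁ hs₂ hs => by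
      have hg := hins _ _ hs
      rw [hgF _ hv] at hg
      rcases hA.of_le_gain hπ h hg with hs | hs | hs
      · exact absurd (Finset.mem_singleton.2 hs) hs₁
      · exact absurd (Finset.mem_singleton.2 hs) hs₂
      · exact h₂ s hs)
  refine le_trans ?_ key
  have hq₀ := h.mass_le_one hX hC hpos _ hcov
  have hq₁ := h.mass_nonneg (C.image Sigma.fst)
    ({shell j} ∪ {decoy} ∪ fillersLeft (C.image Sigma.fst) j) hpos.le
  have hqle := h.one_sub_mass_le hX hC hpos _ hcov
  have hpH₁ := h.mass_le_one hX hC hpos ({shell j} ∪ {decoy})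
    (fun v hv => hcov v (Finset.mem_union_left _ hv))
  have hunion : h.mass (C.image Sigma.fst) (cost h.points (C.image p)) ({shell j} ∪ {decoy}) =
      h.mass (C.image Sigma.fst) (cost h.points (C.image p)) {shell j} +
      h.mass (C.image Sigma.fst) (cost h.points (C.image p)) {decoy} := by
    rw [IsRealization.mass, IsRealization.mass, IsRealization.mass,
      Finset.sum_union (by simp), add_div]
  have hZ : h.mass (C.image Sigma.fst) (cost h.points (C.image p)) {shell j} =
      π.P * (π.ρ (j + 1) ^ 2 + π.ρ j ^ 2 + e) / cost h.points (C.image p) := by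
    rw [IsRealization.mass, Finset.sum_singleton, dZ, hgZ]
    rfl
  have hY : h.mass (C.image Sigma.fst) (cost h.points (C.image p)) {decoy} =
      (gram (decoy : Loc π) decoy + π.ρ j ^ 2 + e) / cost h.points (C.image p) := by
    rw [IsRealization.mass, Finset.sum_singleton, dY]
    simp [weight]
  have hZ₀ := h.mass_nonneg (C.image Sigma.fst) {shell j} hpos.le
  have hY₀ := h.mass_nonneg (C.image Sigma.fst) {decoy} hpos.le
  obtain ⟨hm₁, hm₂, hm₃⟩ := mass_bounds hP hn hu hW₁ hW₂ hR2 (sq_nonneg (π.ρ (j + 1))) hRH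
    hgY.2 hgY.1 he₀ he₁ hpos (hcost₁.trans hcost₃) (by linarith)
  rw [← hZ, ← hY] at hm₁ hm₂
  rw [← hZ] at hm₃
  -- The joint mass is at most `1/(3u)`, so `l ≤ u` makes the union bound over candidates effective.
  have hsmall : (l : ℝ) * (h.mass (C.image Sigma.fst) (cost h.points (C.image p)) {shell j} +
      h.mass (C.image Sigma.fst) (cost h.points (C.image p)) {decoy}) ≤ 1 / 2 := by
    have h₃ : (l : ℝ) * (1 / (3 * u)) ≤ 1 / 2 := by
      rw [mul_one_div, div_le_div_iff₀ (by positivity) (by norm_num)]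
      linarith
    exact (mul_le_mul_of_nonneg_left hm₂ (by linarith)).trans h₃
  have hκ : 1 / (6 * π.P : ℝ) ≤ 1 := by
    rw [div_le_one (by positivity)]
    linarith
  have hκ₀ : 0 ≤ 1 / (6 * π.P : ℝ) := by positivity
  have hb := pow_sub_pow_ge (l := l) (by omega) hZ₀ hκ₀ hm₁ hY₀ hsmall
  rw [← hunion] at hb
  apply run_step (l := l) hl (R := f + 1 / (6 * π.P) * (V - f)) (pH :=
    h.mass (C.image Sigma.fst) (cost h.points (C.image p)) ({shell j} ∪ {decoy}))
    _ he' hpH₁ _ (by linarith) (by linarith) _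
  · have hb₁ := mul_le_mul_of_nonneg_left hb (sub_nonneg.2 hfV)
    linarith
  · have := mul_le_mul_of_nonneg_right hκ (sub_nonneg.2 hfV)
    linarith
  · rw [hunion, mul_div_assoc, mul_div_assoc]
    exact mul_le_mul_of_nonneg_left (by linarith) (by linarith)
  -- Everything but the fillers of the phase costs at most `2 W ρ j ^ 2`, perturbation included, out
  -- of at least `u W ρ j ^ 2`. This is the constant `K = 2`.
  · refine hqle.trans ?_
    rw [div_le_div_iff₀ hpos (by linarith)]
    have hsub : ∑ v with v ∉ ({shell j} ∪ {decoy} ∪ fillersLeft (C.image Sigma.fst) j),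
        (weight v : ℝ) * setDist sqDist (C.image Sigma.fst) v ≤
        ∑ v with v ∉ fillersLeft (C.image Sigma.fst) j,
        (weight v : ℝ) * setDist sqDist (C.image Sigma.fst) v := by
      refine Finset.sum_le_sum_of_subset_of_nonneg ?_ fun v _ _ =>
        mul_nonneg (Nat.cast_nonneg _) (h.setDist_nonneg _ v)
      intro v hv
      simp only [Finset.mem_filter, Finset.mem_univ, true_and, Finset.mem_union, not_or] at hv ⊢
      exact hv.2
    have h₃ := mul_le_mul_of_nonneg_right
      ((add_le_add (hsub.trans hrest) he).trans (sub_add_cancel _ _).le) (show (0 : ℝ) ≤ u by linarith)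
    refine h₃.trans ?_
    linarith

end Loc

/-! ### From the decoy to the core: satellites and light fillers -/

namespace Loc

variable {π : Params} {e : ℝ} {d l : ℕ} {p : (Σ v : Loc π, Fin (weight v)) → Pt d} {Ω : ℝ}

/-- The locations that are far away from the core even compared to the satellites. -/
def IsFar : Loc π → Prop
  | shell _ => True
  | lure _ => True
  | filler _ _ => True
  | _ => False

/-- The covered locations once the decoy is covered, when the core and the satellites are not. -/
structure Caught (A : Finset (Loc π)) : Prop where
  base_mem : base ∈ A
  decoy_mem : decoy ∈ A
  core_notMem : core ∉ A
  sat_notMem : ∀ m, sat m ∉ A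

open Classical in
/-- The uncovered light fillers. -/
def lightsLeft (A : Finset (Loc π)) : Finset (Loc π) :=
  Finset.univ.filter fun v => v ∉ A ∧ ∃ m, v = light m

theorem mem_lightsLeft {A : Finset (Loc π)} {v : Loc π} :
    v ∈ lightsLeft A ↔ v ∉ A ∧ ∃ m, v = light m := by
  simp [lightsLeft]

open Classical in
/-- The uncovered far locations. -/
def farLeft (A : Finset (Loc π)) : Finset (Loc π) :=
  Finset.univ.filter fun v => v ∉ A ∧ IsFar v

theorem mem_farLeft {A : Finset (Loc π)} {v : Loc π} : v ∈ farLeft A ↔ v ∉ A ∧ IsFar v := by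
  simp [farLeft]

/-- The covered locations when `v` light fillers are left, all far locations are covered, and the
core is not. -/
structure Last (A : Finset (Loc π)) (v : ℕ) : Prop extends Caught A where
  far_mem : ∀ x, IsFar x → x ∈ A
  card_eq : (lightsLeft A).card = v

variable (hπ : π.Valid Ω) (h : IsRealization weight (sqDist (π := π)) e p)
  {A : Finset (Loc π)}

include hπ

theorem _root_.KMeans.Params.Valid.sq_a_le : 16 * (π.a : ℝ) ^ 2 ≤ Ω ∧ 2 * (π.a : ℝ) + 2 ≤ Ω := by
  have h₁ := hπ.a_real
  have h₂ := hπ.a_le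
  have h₃ : (π.a : ℝ) ^ 2 ≤ π.a ^ 3 := pow_le_pow_right₀ h₁ (by norm_num)
  have h₄ : (π.a : ℝ) ≤ π.a ^ 3 := le_self_pow₀ h₁ (by norm_num)
  have h₅ : (1 : ℝ) ≤ π.a ^ 3 := one_le_pow₀ h₁
  constructor <;> linarith

theorem _root_.KMeans.Params.Valid.Ω_le_rho {j : ℕ} (hj : j ≤ π.P) :
    100 * Ω ≤ π.ρ j ∧ 100 * Ω ≤ π.ρ j ^ 2 := by
  have h₁ := hπ.one_le_Ω
  have h₂ : Ω ≤ Ω ^ 3 := le_self_pow₀ h₁ (by norm_num)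
  have h₃ := hπ.le_rho.trans (hπ.rho_P_le hj)
  have h₄ : π.ρ j ≤ π.ρ j ^ 2 := le_self_pow₀ (by linarith) (by norm_num)
  constructor <;> linarith

theorem sqDist_sat_decoy (m : Fin π.N) : sqDist (sat m) decoy ≤ 10 * (π.a : ℝ) ^ 2 + 2 * π.a + 2 := by
  have := hπ.gram_decoy
  rw [sqDist, gram_sat]
  have h₁ : gram (sat m) (decoy : Loc π) = -π.a := rfl
  rw [h₁]
  linarith

theorem Caught.setDist_sat_le (hA : Caught A) (m : Fin π.N) :
    setDist sqDist A (sat m) ≤ 14 * (π.a : ℝ) ^ 2 := by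
  refine (setDist_le _ _ hA.decoy_mem).trans ((sqDist_sat_decoy hπ m).trans ?_)
  have := hπ.a_real
  nlinarith

theorem Caught.setDist_core_le (hA : Caught A) : setDist sqDist A core ≤ 2 := by
  refine (setDist_le _ _ hA.decoy_mem).trans ?_
  have := hπ.gram_decoy
  simp only [sqDist]
  have h₁ : gram (core : Loc π) (decoy : Loc π) = 0 := rfl
  have h₂ : gram (core : Loc π) (core : Loc π) = 0 := rfl
  rw [h₁, h₂]
  linarith

theorem gram_self_ge {v : Loc π} (hv : v ≠ core) : 1 ≤ gram v v := by
  have h₀ := (hπ.Ω_le_rho (Nat.zero_le π.P)).2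
  have hΩ := hπ.one_le_Ω
  cases v with
  | base => simp only [gram]; linarith
  | shell i =>
    have := (hπ.Ω_le_rho (show (i : ℕ) + 1 ≤ π.P from i.2)).2
    simp only [gram, if_true]
    linarith
  | lure i =>
    have := (hπ.Ω_le_rho i.2.le).2
    simp only [gram, if_true]
    linarith
  | decoy => exact hπ.gram_decoy.2
  | core => exact absurd rfl hv
  | sat m =>
    rw [gram_sat]
    have := hπ.a_real
    nlinarith
  | filler i m =>
    have := hπ.fillerCost_nonneg i
    simp only [gram, and_self, if_true]
    linarith
  | light m =>
    have : 0 ≤ lightCost π := by unfold lightCost; positivity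
    simp only [gram, if_true]
    linarith

theorem Caught.le_setDist_core (hA : Caught A) : 1 ≤ setDist sqDist A core := by
  refine le_setDist _ ⟨_, hA.base_mem⟩ _ fun a ha => ?_
  have hne : a ≠ core := by
    rintro rfl
    exact hA.core_notMem ha
  rw [sqDist]
  have h₁ : gram (core : Loc π) a = 0 := by cases a <;> rfl
  have h₂ : gram (core : Loc π) core = 0 := rfl
  rw [h₁, h₂]
  linarith [gram_self_ge hπ hne]

/-- The inner product `-a` with the decoy puts each satellite `2a` farther from the decoy than from
the core, and all other possible centers are farther still. This excess is what covering the core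
will save. -/
theorem Caught.le_setDist_sat (hA : Caught A) (m : Fin π.N) :
    10 * (π.a : ℝ) ^ 2 + 2 * π.a ≤ setDist sqDist A (sat m) := by
  have ha := hπ.sq_a_le.2
  have h₀ := (hπ.Ω_le_rho (Nat.zero_le π.P)).2
  have hΩ := hπ.one_le_Ω
  refine le_setDist _ ⟨_, hA.base_mem⟩ _ fun a ha => ?_
  rw [sqDist, gram_sat]
  cases a with
  | base => simp only [gram]; linarith
  | shell i =>
    have := (hπ.Ω_le_rho (show (i : ℕ) + 1 ≤ π.P from i.2)).2
    simp only [gram, if_true]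
    linarith
  | lure i =>
    have := (hπ.Ω_le_rho i.2.le).2
    simp only [gram, if_true]
    linarith
  | decoy =>
    have := hπ.gram_decoy.2
    have h₁ : gram (sat m) (decoy : Loc π) = -π.a := rfl
    rw [h₁]
    linarith
  | core => exact absurd ha hA.core_notMem
  | sat m' => exact absurd ha (hA.sat_notMem m')
  | filler i m =>
    have := hπ.fillerCost_nonneg i
    simp only [gram, and_self, if_true]
    linarith
  | light m =>
    have : 0 ≤ lightCost π := by unfold lightCost; positivity
    simp only [gram, if_true]
    linarith

include h

/-- The `8a` satellites save `2a` each, which is `16 a²` against the price `15 a²` of a light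
filler; the core's own points add at least `n`. -/
theorem Caught.lt_gain_core (hA : Caught A) : lightCost π < gain weight sqDist A core := by
  have hn : lightCost π < π.n + (16 : ℝ) * π.a ^ 2 := by
    have := hπ.n_real
    have := sq_nonneg (π.a : ℝ)
    unfold lightCost
    linarith
  refine lt_of_lt_of_le hn ?_
  have h₀ : ∀ v : Loc π, 0 ≤ (weight v : ℝ) * max 0 (setDist sqDist A v - sqDist v core) :=
    fun v => by positivity
  have hN : (π.N : ℝ) = 8 * π.a := by rw [hπ.N_eq]; push_cast; rfl
  rw [gain, sum_eq]
  have h₁ : (π.n : ℝ) ≤ (weight (core : Loc π) : ℝ) *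
      max 0 (setDist sqDist A core - sqDist (core : Loc π) core) := by
    rw [h.self, sub_zero]
    have h₂ := hA.le_setDist_core hπ
    have : (1 : ℝ) ≤ max 0 (setDist sqDist A core) := h₂.trans (le_max_right _ _)
    exact le_mul_of_one_le_right (Nat.cast_nonneg _) this
  have h₂ : (16 : ℝ) * π.a ^ 2 ≤ ∑ m : Fin π.N, (weight (sat m : Loc π) : ℝ) *
      max 0 (setDist sqDist A (sat m) - sqDist (sat m) core) := by
    calc (16 : ℝ) * π.a ^ 2 = ∑ m : Fin π.N, 2 * (π.a : ℝ) := by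
          simp [hN]
          ring
      _ ≤ _ := Finset.sum_le_sum fun m _ => by
        have h₃ := hA.le_setDist_sat hπ m
        have h₄ : sqDist (sat m) core = 10 * (π.a : ℝ) ^ 2 := by
          rw [sqDist, gram_sat]
          simp [gram]
        rw [h₄]
        simp only [weight, Nat.cast_one, one_mul]
        refine le_trans ?_ (le_max_right _ _)
        linarith
  have s₁ : 0 ≤ ∑ i : Fin π.P, (weight (shell i : Loc π) : ℝ) *
      max 0 (setDist sqDist A (shell i) - sqDist (shell i) core) :=
    Finset.sum_nonneg fun i _ => h₀ (shell i)
  have s₂ : 0 ≤ ∑ i : Fin π.P, (weight (lure i : Loc π) : ℝ) *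
      max 0 (setDist sqDist A (lure i) - sqDist (lure i) core) :=
    Finset.sum_nonneg fun i _ => h₀ (lure i)
  have s₃ : 0 ≤ ∑ i : Fin π.P, ∑ m : Fin π.s, (weight (filler i m : Loc π) : ℝ) *
      max 0 (setDist sqDist A (filler i m) - sqDist (filler i m) core) :=
    Finset.sum_nonneg fun i _ => Finset.sum_nonneg fun m _ => h₀ (filler i m)
  have s₄ : 0 ≤ ∑ m : Fin π.t, (weight (light m : Loc π) : ℝ) *
      max 0 (setDist sqDist A (light m) - sqDist (light m) core) :=
    Finset.sum_nonneg fun m _ => h₀ (light m)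
  linarith [h₀ base, h₀ decoy]

/-- A satellite helps only itself: every other uncovered location is at least as close to the decoy.
Two satellites share the inner product `a²`, too little against the squared norm `10 a²`. -/
theorem Caught.gain_sat_le (hA : Caught A) (m : Fin π.N) :
    gain weight sqDist A (sat m) ≤ 14 * (π.a : ℝ) ^ 2 := by
  have ha := hπ.a_real
  rw [gain, Finset.sum_eq_single (sat m)]
  · rw [h.self, sub_zero]
    simp only [weight, Nat.cast_one, one_mul]
    exact max_le (by positivity) (hA.setDist_sat_le hπ m)
  · intro v _ hv
    rw [max_eq_left, mul_zero]
    rw [sub_nonpos]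
    by_cases hvA : v ∈ A
    · rw [h.setDist_eq_zero hvA]
      exact h.nonneg _ _
    have hd := setDist_le sqDist v hA.decoy_mem
    have hY := hπ.gram_decoy
    refine hd.trans ?_
    have key : gram (decoy : Loc π) decoy - 2 * gram v decoy ≤
        10 * (π.a : ℝ) ^ 2 - 2 * gram v (sat m) := by
      have h10 : (2 : ℝ) ≤ 10 * π.a ^ 2 := by nlinarith
      cases v with
      | base => exact absurd hA.base_mem hvA
      | shell i => simp only [gram] at *; linarith
      | lure i =>
        have := hπ.rho_ge i.2.le
        have h₁ : 0 ≤ (1 / π.P : ℝ) * π.ρ i := by positivity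
        have h₂ : gram (lure i) (decoy : Loc π) = (1 / π.P : ℝ) * π.ρ i := rfl
        have h₃ : gram (lure i) (sat m) = 0 := rfl
        rw [h₂, h₃]
        linarith
      | decoy => exact absurd hA.decoy_mem hvA
      | core => simp only [gram] at *; linarith
      | sat m' =>
        have hne : m' ≠ m := by rintro rfl; exact hv rfl
        have h₂ : gram (sat m') (decoy : Loc π) = -π.a := rfl
        have h₃ : gram (sat m') (sat m) = (π.a : ℝ) ^ 2 := by simp [gram, hne]
        rw [h₂, h₃]
        nlinarith
      | filler i m' => simp only [gram] at *; linarith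
      | light m' => simp only [gram] at *; linarith
    rw [sqDist, sqDist, gram_sat]
    linarith
  · exact fun hn => absurd (Finset.mem_univ _) hn

omit hπ in
theorem Caught.gain_light_le (hA : Caught A) (m : Fin π.t) :
    gain weight sqDist A (light m) ≤ lightCost π := by
  by_cases hm : light m ∈ A
  · rw [gain_eq_zero_of_mem hm]
    unfold lightCost
    positivity
  · exact ((isSpoke_light m).gain_eq h hA.base_mem hm).le

/-- The cost apart from the light fillers and the far locations. -/
theorem Caught.sum_le (hA : Caught A) (L : Finset (Loc π))
    (hL : ∀ v ∈ L, (IsFar v ∨ ∃ m, v = light m) → v ∈ A) :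
    ∑ v ∈ L, (weight v : ℝ) * setDist sqDist A v ≤
      2 * π.n + 112 * (π.a : ℝ) ^ 3 := by
  have hN : (π.N : ℝ) = 8 * π.a := by rw [hπ.N_eq]; push_cast; rfl
  have hle : ∀ v ∈ L, (weight v : ℝ) * setDist sqDist A v ≤
      (fun v : Loc π => match v with
        | core => 2 * (π.n : ℝ)
        | sat _ => 14 * (π.a : ℝ) ^ 2
        | _ => 0) v := by
    intro v hv
    have hmem : v ∈ A → (weight v : ℝ) * setDist sqDist A v = 0 := fun hvA => by
      rw [h.setDist_eq_zero hvA, mul_zero]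
    cases v with
    | base => exact (hmem hA.base_mem).le
    | shell i => exact (hmem (hL _ hv (.inl trivial))).le
    | lure i => exact (hmem (hL _ hv (.inl trivial))).le
    | decoy => exact (hmem hA.decoy_mem).le
    | core =>
      have := hA.setDist_core_le hπ
      simp only [weight]
      rw [mul_comm]
      exact mul_le_mul_of_nonneg_right this (Nat.cast_nonneg _)
    | sat m =>
      have := hA.setDist_sat_le hπ m
      simpa [weight] using this
    | filler i m => exact (hmem (hL _ hv (.inl trivial))).le
    | light m => exact (hmem (hL _ hv (.inr ⟨m, rfl⟩))).le
  refine (Finset.sum_le_sum hle).trans ?_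
  refine (Finset.sum_le_sum_of_subset_of_nonneg (Finset.subset_univ L) fun v _ _ => ?_).trans ?_
  · cases v <;> simp only [le_refl] <;> positivity
  · rw [sum_eq]
    simp [hN]
    ring_nf
    exact le_rfl

open Classical in
theorem Last.sum_rest_le {v : ℕ} (hA : Last A v) : ∑ x with x ∉ lightsLeft A,
    (weight x : ℝ) * setDist sqDist A x ≤ 2 * π.n + 112 * (π.a : ℝ) ^ 3 := by
  refine hA.sum_le hπ h _ fun x hx hx' => ?_
  rcases hx' with hx' | hx'
  · exact hA.far_mem _ hx'
  · by_contra hxA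
    exact (Finset.mem_filter.1 hx).2 (mem_lightsLeft.2 ⟨hxA, hx'⟩)

-- Only the `8a` satellites remain, at `14 a²` each. Against `15 a² v` for the light fillers this
-- yields the failure ratio `8a / v`.
open Classical in
theorem Last.sum_rest_le' {v : ℕ} (hA : Last A v) : ∑ x with x ∉ {core} ∪ lightsLeft A,
    (weight x : ℝ) * setDist sqDist A x ≤ 112 * (π.a : ℝ) ^ 3 := by
  have hN : (π.N : ℝ) = 8 * π.a := by rw [hπ.N_eq]; push_cast; rfl
  refine (Finset.sum_le_sum (g := fun v : Loc π => match v with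
        | sat _ => 14 * (π.a : ℝ) ^ 2
        | _ => 0) fun x hx => ?_).trans ?_
  · rw [Finset.mem_filter, Finset.mem_union, Finset.mem_singleton, not_or] at hx
    have hmem : x ∈ A → (weight x : ℝ) * setDist sqDist A x = 0 := fun hvA => by
      rw [h.setDist_eq_zero hvA, mul_zero]
    cases x with
    | base => exact (hmem hA.base_mem).le
    | shell i => exact (hmem (hA.far_mem _ trivial)).le
    | lure i => exact (hmem (hA.far_mem _ trivial)).le
    | decoy => exact (hmem hA.decoy_mem).le
    | core => exact absurd rfl hx.2.1
    | sat m => simpa [weight] using hA.setDist_sat_le hπ m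
    | filler i m => exact (hmem (hA.far_mem _ trivial)).le
    | light m =>
      refine (hmem ?_).le
      by_contra hxA
      exact hx.2.2 (mem_lightsLeft.2 ⟨hxA, m, rfl⟩)
  · refine (Finset.sum_le_sum_of_subset_of_nonneg (Finset.filter_subset _ _) fun v _ _ => ?_).trans ?_
    · cases v <;> simp only [le_refl]
      positivity
    · rw [sum_eq]
      simp [hN]
      ring_nf
      exact le_rfl

omit hπ in
theorem Last.sum_lightsLeft {v : ℕ} (hA : Last A v) : ∑ x ∈ lightsLeft A,
    (weight x : ℝ) * setDist sqDist A x = v * lightCost π := by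
  rw [← hA.card_eq, ← nsmul_eq_mul, ← Finset.sum_const]
  refine Finset.sum_congr rfl fun x hx => ?_
  obtain ⟨hxA, m, rfl⟩ := mem_lightsLeft.1 hx
  rw [(isSpoke_light m).setDist_eq h hA.base_mem hxA]
  simp [weight]

open Classical in
omit hπ in
theorem Last.locCost_eq {v : ℕ} (hA : Last A v) : locCost weight sqDist A = v * lightCost π +
    ∑ x with x ∉ lightsLeft A, (weight x : ℝ) * setDist sqDist A x := by
  rw [locCost, ← hA.sum_lightsLeft h,
    ← Finset.sum_filter_add_sum_filter_not Finset.univ (fun v => v ∈ lightsLeft A)]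
  congr 2
  ext v
  simp

/-- A location that is at least as good as a light filler. -/
theorem Last.of_le_gain {v : ℕ} (hA : Last A v) {x : Loc π}
    (hx : lightCost π ≤ gain weight sqDist A x) : x = core ∨ x ∈ lightsLeft A := by
  have ha := hπ.a_real
  have hmem : x ∉ A := by
    intro hxA
    rw [gain_eq_zero_of_mem hxA] at hx
    unfold lightCost at hx
    nlinarith
  cases x with
  | base => exact absurd hA.base_mem hmem
  | shell i => exact absurd (hA.far_mem (shell i) trivial) hmem
  | lure i => exact absurd (hA.far_mem (lure i) trivial) hmem
  | decoy => exact absurd hA.decoy_mem hmem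
  | core => exact .inl rfl
  | sat m =>
    have := hA.gain_sat_le hπ h m
    unfold lightCost at hx
    nlinarith
  | filler i m => exact absurd (hA.far_mem (filler i m) trivial) hmem
  | light m => exact .inr (mem_lightsLeft.2 ⟨hmem, m, rfl⟩)

end Loc

theorem Params.Valid.e_le_one {π : Params} {Ω e : ℝ} (hπ : π.Valid Ω) (he₀ : 0 < e)
    (he : e * Fintype.card (Σ v : Loc π, Fin (Loc.weight v)) ≤ 1) : e ≤ 1 := by
  have h₁ : (1 : ℝ) ≤ Fintype.card (Σ v : Loc π, Fin (Loc.weight v)) := by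
    have : 0 < Fintype.card (Σ v : Loc π, Fin (Loc.weight v)) :=
      Fintype.card_pos_iff.2 ⟨⟨.base, 0, hπ.wb_pos⟩⟩
    exact_mod_cast this
  nlinarith

namespace Loc

variable {π : Params} {e : ℝ} {d l : ℕ} {p : (Σ v : Loc π, Fin (weight v)) → Pt d} {Ω : ℝ}

/-- While the core and the satellites are uncovered, at least two locations are. This excludes
running out of steps, since the invariant of the inductions leaves exactly one location uncovered at
the end. -/
theorem Caught.card_lt {A : Finset (Loc π)} (hcore : core ∉ A) (hsat : ∀ m, sat m ∉ A)
    (hN : 0 < π.N) : A.card + 2 ≤ Fintype.card (Loc π) := by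
  classical
  have h₁ : (insert core (insert (sat ⟨0, hN⟩) A)).card = A.card + 2 := by
    rw [Finset.card_insert_of_notMem, Finset.card_insert_of_notMem (hsat _)]
    simp [hcore]
  rw [← h₁]
  exact Finset.card_le_univ _

variable (hπ : π.Valid Ω) (h : IsRealization weight (sqDist (π := π)) e p)
  {r : Rule d l} (hr : IsGreedyRule h.points r) (hX : h.points.Nonempty)
  (Ev : Set (Finset (Pt d)))

open Classical in
/-- The event contains all sets of centers that cover both the decoy and the core. -/
def IsSuccess (_h : IsRealization weight (sqDist (π := π)) e p) (Ev : Set (Finset (Pt d))) : Prop :=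
  ∀ (C : Finset (Σ v : Loc π, Fin (weight v))) (C' : Finset (Pt d)), C.image p ⊆ C' →
    decoy ∈ C.image Sigma.fst → core ∈ C.image Sigma.fst → C' ∈ Ev

variable {Ev} (hEv : IsSuccess h Ev)

include hπ hr hEv

open Classical in
omit hπ hr in
theorem IsSuccess.stepProb_eq_one {C : Finset (Σ v : Loc π, Fin (weight v))}
    (h₁ : decoy ∈ C.image Sigma.fst) (h₂ : core ∈ C.image Sigma.fst) (m : ℕ) :
    stepProb h.points hX r Ev m (C.image p) = 1 :=
  KMeans.stepProb_eq_one _ _ _ _ _ _ fun C' hC' => hEv C C' hC' h₁ h₂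

open Classical in
/-- The success probability when only the light fillers are left. -/
theorem Last.le_stepProb (hl : 2 ≤ l)
    (he : e * Fintype.card (Σ v : Loc π, Fin (weight v)) ≤ 1) {u₀ : ℕ}
    (hu₀ : 2 * π.n + 112 * (π.a : ℝ) ^ 3 + 1 ≤ 15 * π.a ^ 2 * u₀) :
    ∀ (m v : ℕ) (C : Finset (Σ v : Loc π, Fin (weight v))), Last (C.image Sigma.fst) v →
      (C.image Sigma.fst).card + m + 1 = Fintype.card (Loc π) →
      1 - runErr (l * π.n / (30 * π.a ^ 2)) (8 * π.a) u₀ v ≤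
        stepProb h.points hX r Ev m (C.image p)
  | 0, v, C, hA, hm => by
    have := Caught.card_lt hA.core_notMem hA.sat_notMem
      (by rw [hπ.N_eq]; have := hπ.one_le_a; omega)
    omega
  | m + 1, v, C, hA, hm => by
    rcases Nat.lt_or_ge u₀ v with hv | hv
    swap
    · rw [runErr_of_le _ _ hv, sub_self]
      exact stepProb_nonneg _ _ _ _ _ _
    have ih := Last.le_stepProb hl he hu₀ m
    have hC : C.Nonempty := by
      obtain ⟨s, hs, -⟩ := Finset.mem_image.1 hA.base_mem
      exact ⟨s, hs⟩
    have hCi := hC.image Sigma.fst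
    have ha := hπ.a_real
    have hn := hπ.n_real
    have hv' : (1 : ℝ) ≤ v := by exact_mod_cast (show 1 ≤ v by omega)
    have huv : (u₀ : ℝ) ≤ v := by exact_mod_cast hv.le
    have he₀ := h.e_pos
    have he₁ := hπ.e_le_one he₀ he
    have hlc := hA.locCost_eq h
    have hrest := hA.sum_rest_le hπ h
    have hrest' := hA.sum_rest_le' hπ h
    have hL : lightCost π = 15 * (π.a : ℝ) ^ 2 := rfl
    have hcost₃ := h.locCost_le_cost hC
    have hcost₄ := h.cost_le hC
    have hrest₀ : 0 ≤ ∑ x with x ∉ lightsLeft (C.image Sigma.fst),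
        (weight x : ℝ) * setDist sqDist (C.image Sigma.fst) x :=
      Finset.sum_nonneg fun v _ => mul_nonneg (Nat.cast_nonneg _) (h.setDist_nonneg _ v)
    rw [hL] at hlc
    have ha2 : 1 ≤ (π.a : ℝ) ^ 2 := one_le_pow₀ ha
    have hc₁ : v * (15 * (π.a : ℝ) ^ 2) ≤ cost h.points (C.image p) := by linarith
    have hc₂ : cost h.points (C.image p) ≤ 30 * π.a ^ 2 * v := by
      have := mul_le_mul_of_nonneg_left huv (show 0 ≤ 15 * (π.a : ℝ) ^ 2 by positivity)
      linarith
    have hpos : 0 < cost h.points (C.image p) := lt_of_lt_of_le (by positivity) hc₁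
    have hcov : ∀ x ∈ ({core} ∪ ∅ ∪ lightsLeft (C.image Sigma.fst) : Finset (Loc π)),
        x ∉ C.image Sigma.fst := by
      intro x hx
      simp only [Finset.mem_union, Finset.mem_singleton, Finset.notMem_empty, or_false] at hx
      rcases hx with rfl | hx
      · exact hA.core_notMem
      · exact (mem_lightsLeft.1 hx).1
    have hins : ∀ v x : Loc π, locCost weight sqDist (insert x (C.image Sigma.fst)) ≤
        locCost weight sqDist (insert v (C.image Sigma.fst)) →
        gain weight sqDist (C.image Sigma.fst) v ≤ gain weight sqDist (C.image Sigma.fst) x := by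
      intro v x hx
      rw [locCost_insert _ _ hCi, locCost_insert _ _ hCi] at hx
      linarith
    have hgF : ∀ x ∈ lightsLeft (C.image Sigma.fst),
        gain weight sqDist (C.image Sigma.fst) x = lightCost π := by
      intro x hx
      obtain ⟨hxA, i, rfl⟩ := mem_lightsLeft.1 hx
      exact (isSpoke_light i).gain_eq h hA.base_mem hxA
    have hgC := hA.lt_gain_core hπ h
    have hsucc : ∀ s : (Σ v : Loc π, Fin (weight v)), s.1 = core →
        1 ≤ stepProb h.points hX r Ev m ((insert s C).image p) := fun s hs => by
      refine (hEv.stepProb_eq_one h hX ?_ ?_ m).ge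
      · exact Finset.image_subset_image (Finset.subset_insert _ _) hA.decoy_mem
      · rw [← hs]
        exact Finset.mem_image_of_mem _ (Finset.mem_insert_self _ _)
    -- Here hitting the target is outright success, so both values are 1 and the middle class is
    -- empty. The only bad outcome is that no candidate is at the core or at an uncovered light
    -- filler.
    have key := h.stepProb_succ_ge hr hX Ev m hC hpos {core} ∅
      (lightsLeft (C.image Sigma.fst)) hcov 1 1
      (1 - runErr (l * π.n / (30 * π.a ^ 2)) (8 * π.a) u₀ (v - 1))
      (fun x hx s hs => by
        rw [Finset.mem_singleton.1 hx] at hs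
        have hg := hins _ _ hs
        rcases hA.of_le_gain hπ h (hgC.le.trans hg) with hs | hs
        · exact hsucc s hs
        · rw [hgF _ hs] at hg
          linarith)
      (by simp)
      (fun x hx s hs₁ hs₂ hs => by
        have hg := hins _ _ hs
        rw [hgF _ hx] at hg
        rcases hA.of_le_gain hπ h hg with hs | hs
        · exact absurd (Finset.mem_singleton.2 hs) hs₁
        · have hsA := (mem_lightsLeft.1 hs).1
          obtain ⟨i, hi⟩ := (mem_lightsLeft.1 hs).2
          apply ih
          · rw [Finset.image_insert]
            refine ⟨⟨Finset.mem_insert_of_mem hA.base_mem, Finset.mem_insert_of_mem hA.decoy_mem,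
              ?_, fun i' => ?_⟩, fun x hx => Finset.mem_insert_of_mem (hA.far_mem x hx), ?_⟩
            · rw [Finset.mem_insert, not_or, hi]
              exact ⟨by simp, hA.core_notMem⟩
            · rw [Finset.mem_insert, not_or, hi]
              exact ⟨by simp, hA.sat_notMem i'⟩
            · rw [← hA.card_eq, ← Finset.card_erase_of_mem hs]
              congr 1
              ext y
              rw [Finset.mem_erase, mem_lightsLeft, mem_lightsLeft, Finset.mem_insert]
              tauto
          · rw [Finset.image_insert, Finset.card_insert_of_notMem hsA]
            omega)
    refine le_trans ?_ key
    rw [runErr_of_lt _ _ hv, Finset.union_empty]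
    rw [Finset.union_empty] at hcov
    have hZ : ∀ x ∈ ({core} : Finset (Loc π)), x ∉ C.image Sigma.fst :=
      fun x hx => hcov x (Finset.mem_union_left _ hx)
    have hpH := h.mass_le_one hX hC hpos _ hZ
    have hq₀ := h.mass_le_one hX hC hpos _ hcov
    have hq₁ := h.mass_nonneg (C.image Sigma.fst) ({core} ∪ lightsLeft (C.image Sigma.fst)) hpos.le
    have hqle := h.one_sub_mass_le hX hC hpos _ hcov
    refine run_step (l := l) hl le_rfl (runErr_nonneg _ _ _ _) hpH ?_ (by linarith) (by linarith)
      ?_ (by linarith)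
    · have h₁ : (π.n : ℝ) / (30 * π.a ^ 2) / v ≤
          h.mass (C.image Sigma.fst) (cost h.points (C.image p)) {core} := by
        refine le_trans ?_ (h.le_mass _ _ hpos)
        rw [Finset.sum_singleton, div_div, div_le_div_iff₀ (by positivity) hpos]
        have h₂ := hA.le_setDist_core hπ
        have h₃ : (weight (core : Loc π) : ℝ) = π.n := rfl
        rw [h₃, mul_assoc]
        refine mul_le_mul_of_nonneg_left ?_ (by linarith)
        refine hc₂.trans ?_
        exact le_mul_of_one_le_left (by positivity) h₂
      rw [mul_div_assoc, mul_div_assoc]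
      exact mul_le_mul_of_nonneg_left h₁ (Nat.cast_nonneg _)
    -- The satellites and the perturbation cost at most `112 a³ + 1`, which is at most `8a · 15 a²`.
    · refine hqle.trans ?_
      rw [div_le_div_iff₀ hpos (by linarith)]
      have h₁ := mul_le_mul_of_nonneg_right (add_le_add hrest' he) (show (0 : ℝ) ≤ v by linarith)
      have h₂ := mul_le_mul_of_nonneg_left hc₁ (show (0 : ℝ) ≤ 8 * π.a by linarith)
      have h₃ : (1 : ℝ) ≤ π.a ^ 3 := one_le_pow₀ ha
      have h₄ := mul_le_mul_of_nonneg_right h₃ (show (0 : ℝ) ≤ v by linarith)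
      nlinarith

end Loc

/-! ### After the decoy: clearing the far locations -/

namespace Loc

variable {π : Params} {e : ℝ} {d l : ℕ} {p : (Σ v : Loc π, Fin (weight v)) → Pt d} {Ω : ℝ}

/-- The covered locations once the decoy is covered, but no light fillers. -/
structure Taken (A : Finset (Loc π)) : Prop extends Caught A where
  light_notMem : ∀ m, light m ∉ A

section
variable (hπ : π.Valid Ω) (h : IsRealization weight (sqDist (π := π)) e p) {A : Finset (Loc π)}
include hπ

theorem lure_le_sqDist (i : Fin π.P) {u : Loc π} (hu : u ≠ lure i) :
    π.ρ i ^ 2 ≤ sqDist (lure i) u := by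
  have hr := hπ.rho_ge i.2.le
  have hg : gram (lure i) (lure i) = 2 * π.ρ i ^ 2 := by simp [gram]
  have hr2 : 2 * π.ρ i ≤ π.ρ i ^ 2 := by nlinarith
  rw [sqDist, hg]
  by_cases hc : u = core
  · subst hc
    simp only [gram]
    nlinarith
  have hu₁ := gram_self_ge hπ hc
  cases u with
  | shell i' =>
    simp only [gram, if_true] at *
    split_ifs with hii
    · subst hii
      nlinarith [sq_nonneg (π.ρ i' - π.ρ (i' + 1))]
    · nlinarith
  | lure i' =>
    have : i ≠ i' := by rintro rfl; exact hu rfl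
    have h' : gram (lure i) (lure i') = 0 := by simp [gram, this]
    rw [h']
    nlinarith
  | decoy =>
    have h' : gram (lure i) (decoy : Loc π) = (1 / π.P) * π.ρ i := rfl
    have := mul_le_mul_of_nonneg_right hπ.one_div_P_le (show 0 ≤ π.ρ i by linarith)
    rw [h']
    linarith
  | base => simp only [gram] at *; nlinarith
  | core => exact absurd rfl hc
  | sat m =>
    have h' : gram (lure i) (sat m) = 0 := rfl
    rw [h']
    nlinarith
  | filler i' m =>
    have h' : gram (lure i) (filler i' m) = 0 := rfl
    rw [h']
    nlinarith
  | light m =>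
    have h' : gram (lure i) (light m) = 0 := rfl
    rw [h']
    nlinarith

theorem shell_le_sqDist (i : Fin π.P) {u : Loc π} (hu : u ≠ shell i) :
    π.ρ (i + 1) ^ 2 ≤ sqDist (shell i) u := by
  have hr := hπ.rho_ge (show (i : ℕ) + 1 ≤ π.P from i.2)
  have hr' := hπ.rho_anti (Nat.le_succ i) (show (i : ℕ) + 1 ≤ π.P from i.2)
  simp only [Nat.succ_eq_add_one] at hr'
  have hg : gram (shell i) (shell i) = π.ρ (i + 1) ^ 2 := by simp [gram]
  rw [sqDist, hg]
  by_cases hc : u = core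
  · subst hc
    simp only [gram]
    linarith
  have hu₁ := gram_self_ge hπ hc
  by_cases hul : u = lure i
  · subst hul
    simp only [gram, if_true]
    nlinarith
  have h' : gram (shell i) u = 0 := by
    cases u with
    | shell i' =>
      have : i ≠ i' := by rintro rfl; exact hu rfl
      simp [gram, this]
    | lure i' =>
      have : i ≠ i' := by rintro rfl; exact hul rfl
      simp [gram, this]
    | _ => rfl
  rw [h']
  linarith

theorem rho_sq_le_rho_sq {i j : ℕ} (hij : i ≤ j) (hj : j ≤ π.P) : π.ρ j ^ 2 ≤ π.ρ i ^ 2 :=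
  pow_le_pow_left₀ (by linarith [hπ.rho_ge hj]) (hπ.rho_anti hij hj) 2

include h

theorem far_le_sqDist {v u : Loc π} (hv : IsFar v) (hu : u ≠ v) :
    π.ρ π.P ^ 2 ≤ sqDist v u := by
  cases v <;> simp only [IsFar] at hv
  case shell i =>
    exact (rho_sq_le_rho_sq hπ i.2 le_rfl).trans (shell_le_sqDist hπ i hu)
  case lure i =>
    exact (rho_sq_le_rho_sq hπ i.2.le le_rfl).trans (lure_le_sqDist hπ i hu)
  case filler i m =>
    have h₁ := rho_sq_le_rho_sq hπ i.2.le le_rfl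
    have h₂ := hπ.rho_sq_le_fillerCost i.2
    have h₃ := (hπ.isSpoke_filler i m).le_sqDist h hu
    linarith [sq_nonneg (π.ρ i)]

/-- All locations but the decoy and the core are far from each other. -/
theorem sq_a_le_sqDist {v u : Loc π} (h₁ : v ≠ decoy) (h₂ : v ≠ core) (hu : u ≠ v) :
    (π.a : ℝ) ^ 2 ≤ sqDist v u := by
  have hΩ := hπ.sq_a_le.1
  have hΩP := (hπ.Ω_le_rho le_rfl).2
  have ha := hπ.a_real
  have ha2 := sq_nonneg (π.a : ℝ)
  have hΩ₁ := hπ.one_le_Ω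
  have hfar : ∀ v u : Loc π, IsFar v → u ≠ v → (π.a : ℝ) ^ 2 ≤ sqDist v u := fun v u hv hu => by
    have := far_le_sqDist hπ h hv hu
    linarith
  have hlight : ∀ (m : Fin π.t) (u : Loc π), u ≠ light m → (π.a : ℝ) ^ 2 ≤ sqDist (light m) u :=
    fun m u hu => by
      have := (isSpoke_light m).le_sqDist h hu
      unfold lightCost at this
      linarith
  have hbase : ∀ u : Loc π, gram base u = 0 → (π.a : ℝ) ^ 2 ≤ sqDist base u := fun u hu => by
    have h₀ := (hπ.Ω_le_rho (Nat.zero_le π.P)).2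
    have hg : gram (base : Loc π) base = π.ρ 0 ^ 2 := rfl
    have : 0 ≤ gram u u := by
      by_cases hc : u = core
      · rw [hc]
        exact le_rfl
      · linarith [gram_self_ge hπ hc]
    rw [sqDist, hu, hg]
    linarith
  by_cases hv : IsFar v
  · exact hfar v u hv hu
  by_cases hu' : IsFar u
  · rw [sqDist_comm]
    exact hfar u v hu' hu.symm
  cases v with
  | shell i => exact absurd trivial hv
  | lure i => exact absurd trivial hv
  | filler i m => exact absurd trivial hv
  | decoy => exact absurd rfl h₁
  | core => exact absurd rfl h₂
  | light m => exact hlight m u hu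
  | base =>
    cases u with
    | light m =>
      rw [sqDist_comm]
      exact hlight m _ hu.symm
    | base => exact absurd rfl hu
    | filler i m => exact absurd trivial hu'
    | _ => exact hbase _ rfl
  | sat m =>
    cases u with
    | shell i => exact absurd trivial hu'
    | lure i => exact absurd trivial hu'
    | filler i m => exact absurd trivial hu'
    | light m =>
      rw [sqDist_comm]
      exact hlight m _ hu.symm
    | base =>
      rw [sqDist_comm]
      exact hbase _ rfl
    | core =>
      rw [sqDist, gram_sat]
      simp only [gram]
      linarith
    | decoy =>
      have h' : gram (sat m) (decoy : Loc π) = -π.a := rfl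
      rw [sqDist, gram_sat, h']
      linarith [hπ.gram_decoy]
    | sat m' =>
      have hne : m ≠ m' := by rintro rfl; exact hu rfl
      have h' : gram (sat m) (sat m') = (π.a : ℝ) ^ 2 := by simp [gram, hne]
      rw [sqDist, gram_sat, gram_sat, h']
      linarith

end

variable (hπ : π.Valid Ω) (h : IsRealization weight (sqDist (π := π)) e p)
  {r : Rule d l} (hr : IsGreedyRule h.points r) (hX : h.points.Nonempty)
  {Ev : Set (Finset (Pt d))} (hEv : IsSuccess h Ev)

include hπ hr hEv

open Classical in
/-- The success probability once the decoy is covered. -/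
theorem Taken.le_stepProb (hl : 2 ≤ l)
    (he : e * Fintype.card (Σ v : Loc π, Fin (weight v)) ≤ 1) {u₀ : ℕ}
    (hu₀ : 2 * π.n + 112 * (π.a : ℝ) ^ 3 + 1 ≤ 15 * π.a ^ 2 * u₀) {V τ : ℝ} (hV : V ≤ 1)
    (hVt : V ≤ 1 - runErr (l * π.n / (30 * π.a ^ 2)) (8 * π.a) u₀ π.t)
    (hτ₀ : 0 ≤ τ) (hτ : 100 * Ω ^ 3 ≤ τ * π.ρ π.P) :
    ∀ (m : ℕ) (C : Finset (Σ v : Loc π, Fin (weight v))), Taken (C.image Sigma.fst) →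
      (C.image Sigma.fst).card + m + 1 = Fintype.card (Loc π) →
      V - m * τ ≤ stepProb h.points hX r Ev m (C.image p)
  | 0, C, hA, hm => by
    have := Caught.card_lt hA.core_notMem hA.sat_notMem
      (by rw [hπ.N_eq]; have := hπ.one_le_a; omega)
    omega
  | m + 1, C, hA, hm => by
    have ih := Taken.le_stepProb hl he hu₀ hV hVt hτ₀ hτ m
    have hC : C.Nonempty := by
      obtain ⟨s, hs, -⟩ := Finset.mem_image.1 hA.base_mem
      exact ⟨s, hs⟩
    have hτm : 0 ≤ (m : ℝ) * τ := by positivity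
    rcases (farLeft (C.image Sigma.fst)).eq_empty_or_nonempty with hempty | ⟨x, hx⟩
    · have hlast : Last (C.image Sigma.fst) π.t := by
        refine ⟨hA.toCaught, fun x hx => ?_, ?_⟩
        · by_contra hxA
          have := mem_farLeft.2 ⟨hxA, hx⟩
          rw [hempty] at this
          exact absurd this (Finset.notMem_empty _)
        · have : lightsLeft (C.image Sigma.fst) = Finset.univ.map
              ⟨fun m : Fin π.t => (light m : Loc π), fun a b hab => by simpa using hab⟩ := by
            ext v
            rw [mem_lightsLeft, Finset.mem_map]
            constructor
            · rintro ⟨-, i, rfl⟩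
              exact ⟨i, Finset.mem_univ _, rfl⟩
            · rintro ⟨i, -, rfl⟩
              exact ⟨hA.light_notMem i, i, rfl⟩
          rw [this, Finset.card_map, Finset.card_univ, Fintype.card_fin]
      have := hlast.le_stepProb hπ h hr hX hEv hl he hu₀ (m + 1) _ _ hm
      push_cast
      nlinarith
    have he₀ := h.e_pos
    have hΩ₁ := hπ.one_le_Ω
    have hΩ₂ : Ω ≤ Ω ^ 3 := le_self_pow₀ hΩ₁ (by norm_num)
    have hΩP := hπ.Ω_le_rho le_rfl
    have hL : lightCost π ≤ Ω := hπ.lightCost_le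
    have hρ := hπ.rho_P
    have hfar : ∀ v ∈ farLeft (C.image Sigma.fst), π.ρ π.P ^ 2 ≤
        (weight v : ℝ) * setDist sqDist (C.image Sigma.fst) v := by
      intro v hv
      obtain ⟨hvA, hvf⟩ := mem_farLeft.1 hv
      have h₁ : π.ρ π.P ^ 2 ≤ setDist sqDist (C.image Sigma.fst) v := by
        refine le_setDist _ ⟨_, hA.base_mem⟩ _ fun a ha => far_le_sqDist hπ h hvf ?_
        rintro rfl
        exact hvA ha
      have h₂ := h.setDist_nonneg (C.image Sigma.fst) v
      exact h₁.trans (le_mul_of_one_le_left h₂ (hπ.one_le_weight v))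
    have hcost : π.ρ π.P ^ 2 ≤ cost h.points (C.image p) := by
      refine ((hfar x hx).trans ?_).trans (h.locCost_le_cost hC)
      exact Finset.single_le_sum
        (f := fun v => (weight v : ℝ) * setDist sqDist (C.image Sigma.fst) v)
        (fun v _ => mul_nonneg (Nat.cast_nonneg _) (h.setDist_nonneg _ v)) (Finset.mem_univ x)
    have hpos : 0 < cost h.points (C.image p) := lt_of_lt_of_le (by positivity) hcost
    have hcov : ∀ v ∈ farLeft (C.image Sigma.fst), v ∉ C.image Sigma.fst :=
      fun v hv => (mem_farLeft.1 hv).1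
    -- One uncovered far location already costs `ρ P ^ 2`, while everything else is bounded in terms
    -- of `Ω`; so some candidate is far up to probability `τ`.
    have hstep := h.stepProb_succ_ge_sub hr hX Ev m (x := V - m * τ) (τ := τ) (by omega) hC hpos
      (farLeft (C.image Sigma.fst)) hcov (by linarith) ?_ ?_
    · push_cast
      linarith
    · refine (h.one_sub_mass_le hX hC hpos _ hcov).trans ?_
      rw [div_le_iff₀ hpos]
      have hsum : ∑ v with v ∉ farLeft (C.image Sigma.fst),
          (weight v : ℝ) * setDist sqDist (C.image Sigma.fst) v ≤
          2 * π.n + 112 * (π.a : ℝ) ^ 3 + π.t * lightCost π := by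
        rw [← Finset.sum_filter_add_sum_filter_not _ (fun v => v ∈ lightsLeft (C.image Sigma.fst)),
          add_comm]
        refine add_le_add (hA.sum_le hπ h _ fun v hv hv' => ?_) ?_
        · by_contra hvA
          simp only [Finset.mem_filter, Finset.mem_univ, true_and] at hv
          rcases hv' with hv' | hv'
          · exact hv.1 (mem_farLeft.2 ⟨hvA, hv'⟩)
          · exact hv.2 (mem_lightsLeft.2 ⟨hvA, hv'⟩)
        · refine (Finset.sum_le_sum_of_subset_of_nonneg
            (t := Finset.univ.image fun m : Fin π.t => (light m : Loc π)) ?_ fun v _ _ =>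
              mul_nonneg (Nat.cast_nonneg _) (h.setDist_nonneg _ v)).trans ?_
          · intro v hv
            obtain ⟨-, i, rfl⟩ := mem_lightsLeft.1 (Finset.mem_filter.1 hv).2
            exact Finset.mem_image_of_mem _ (Finset.mem_univ i)
          · rw [Finset.sum_image (fun a _ b _ hab => by simpa using hab)]
            calc _ ≤ ∑ _i : Fin π.t, lightCost π := Finset.sum_le_sum fun i _ => by
                  rw [(isSpoke_light i).setDist_eq h hA.base_mem (hA.light_notMem i)]
                  simp [weight]
              _ = _ := by simp
      have hlight : (π.t : ℝ) * lightCost π ≤ Ω := hπ.light_le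
      have h₁ := hπ.n_le
      have h₂ := hπ.a_le
      have h₃ : τ * π.ρ π.P * π.ρ π.P ≤ τ * cost h.points (C.image p) := by
        rw [mul_assoc, ← sq]
        exact mul_le_mul_of_nonneg_left hcost hτ₀
      have h₄ : 100 * Ω ^ 3 * 1 ≤ τ * π.ρ π.P * π.ρ π.P :=
        mul_le_mul hτ (by linarith) zero_le_one (by positivity)
      linarith
    · intro v hv s hs
      have hg₁ := (hfar v hv).trans (le_gain h (C.image Sigma.fst) v)
      have hgs : 100 * Ω ≤ gain weight sqDist (C.image Sigma.fst) s.1 := by linarith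
      have hsA : s.1 ∉ C.image Sigma.fst := by
        intro hsA
        rw [gain_eq_zero_of_mem hsA] at hgs
        linarith
      by_cases hsc : s.1 = core
      · have := hEv.stepProb_eq_one h hX (C := insert s C) (r := r)
          (Finset.image_subset_image (Finset.subset_insert _ _) hA.decoy_mem) (by
            rw [← hsc]
            exact Finset.mem_image_of_mem _ (Finset.mem_insert_self _ _)) m
        rw [this]
        linarith
      have hsf : IsFar s.1 := by
        revert hgs hsA hsc
        generalize s.1 = y
        intro hgs hsA hsc
        cases y with
        | base => exact absurd hA.base_mem hsA
        | decoy => exact absurd hA.decoy_mem hsA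
        | core => exact absurd rfl hsc
        | sat i =>
          have h₁ := hA.gain_sat_le hπ h i
          have h₂ := hπ.sq_a_le.1
          have := sq_nonneg (π.a : ℝ)
          linarith
        | light i =>
          have := hA.gain_light_le h i
          linarith
        | _ => trivial
      apply ih
      · rw [Finset.image_insert]
        refine ⟨⟨Finset.mem_insert_of_mem hA.base_mem, Finset.mem_insert_of_mem hA.decoy_mem, ?_,
          fun i => ?_⟩, fun i => ?_⟩
        all_goals
          rw [Finset.mem_insert, not_or]
        · exact ⟨fun hh => hsc hh.symm, hA.core_notMem⟩
        · exact ⟨fun hh => by rw [← hh] at hsf; exact hsf, hA.sat_notMem i⟩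
        · exact ⟨fun hh => by rw [← hh] at hsf; exact hsf, hA.light_notMem i⟩
      · rw [Finset.image_insert, Finset.card_insert_of_notMem hsA]
        omega

end Loc

/-! ### Transition between phases -/

namespace Loc

variable {π : Params} {e : ℝ} {d l : ℕ} {p : (Σ v : Loc π, Fin (weight v)) → Pt d} {Ω : ℝ}

/-- The covered locations after the shell of phase `i` has been covered, as long as the core region
is not covered and the later phases have not begun. -/
structure Trans (A : Finset (Loc π)) (i : Fin π.P) : Prop extends Front A (i + 1) where
  lure_mem : ∀ i' < i, lure i' ∈ A
  filler_mem : ∀ i' < i, ∀ m, filler i' m ∈ A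
  next_notMem : ∀ (i' : Fin π.P) (m : Fin π.s), i < i' → filler i' m ∉ A

open Classical in
/-- The uncovered locations of the scale of phase `i`. -/
def tierLeft (A : Finset (Loc π)) (i : Fin π.P) : Finset (Loc π) :=
  Finset.univ.filter fun v => v ∉ A ∧ (v = lure i ∨ ∃ m, v = filler i m)

theorem mem_tierLeft {A : Finset (Loc π)} {i : Fin π.P} {v : Loc π} :
    v ∈ tierLeft A i ↔ v ∉ A ∧ (v = lure i ∨ ∃ m, v = filler i m) := by
  simp [tierLeft]

section
variable (hπ : π.Valid Ω) (h : IsRealization weight (sqDist (π := π)) e p) {A : Finset (Loc π)}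
  {i : Fin π.P}

theorem Trans.pre (hA : Trans A i) (hi : (i : ℕ) + 1 < π.P) (hempty : tierLeft A i = ∅) :
    Pre A ⟨i + 1, hi⟩ π.s := by
  have hmem : ∀ v : Loc π, (v = lure i ∨ ∃ m, v = filler i m) → v ∈ A := fun v hv => by
    by_contra hvA
    have := mem_tierLeft.2 ⟨hvA, hv⟩
    rw [hempty] at this
    exact absurd this (Finset.notMem_empty _)
  refine ⟨hA.toFront, fun i' hi' => ?_, fun i' hi' m => ?_, ?_⟩
  · rcases Nat.lt_succ_iff_lt_or_eq.1 (Fin.lt_def.1 hi') with hlt | heq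
    · exact hA.lure_mem i' (Fin.lt_def.2 hlt)
    · rw [Fin.ext heq]
      exact hmem _ (.inl rfl)
  · rcases Nat.lt_succ_iff_lt_or_eq.1 (Fin.lt_def.1 hi') with hlt | heq
    · exact hA.filler_mem i' (Fin.lt_def.2 hlt) m
    · rw [Fin.ext heq]
      exact hmem _ (.inr ⟨m, rfl⟩)
  · have : fillersLeft A ⟨i + 1, hi⟩ = Finset.univ.map
        ⟨fun m : Fin π.s => (filler ⟨i + 1, hi⟩ m : Loc π), fun a b hab => by simpa using hab⟩ := by
      ext v
      rw [mem_fillersLeft, Finset.mem_map]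
      constructor
      · rintro ⟨-, m, rfl⟩
        exact ⟨m, Finset.mem_univ _, rfl⟩
      · rintro ⟨m, -, rfl⟩
        exact ⟨hA.next_notMem _ m (Fin.lt_def.2 (Nat.lt_succ_self i)), m, rfl⟩
    rw [this, Finset.card_map, Finset.card_univ, Fintype.card_fin]

include hπ h

theorem Trans.le_mul_setDist (hA : Trans A i) {v : Loc π} (hv : v ∈ tierLeft A i) :
    π.ρ i ^ 2 ≤ (weight v : ℝ) * setDist sqDist A v := by
  obtain ⟨hvA, hv⟩ := mem_tierLeft.1 hv
  have h₁ : π.ρ i ^ 2 ≤ setDist sqDist A v := by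
    rcases hv with rfl | ⟨m, rfl⟩
    · refine le_setDist _ ⟨_, hA.base_mem⟩ _ fun a ha => lure_le_sqDist hπ i ?_
      rintro rfl
      exact hvA ha
    · rw [(hπ.isSpoke_filler i m).setDist_eq h hA.base_mem hvA]
      linarith [hπ.rho_sq_le_fillerCost i.2, sq_nonneg (π.ρ i)]
  exact h₁.trans (le_mul_of_one_le_left (h.setDist_nonneg A v) (hπ.one_le_weight v))

omit h in
theorem sum_ball_next_le {j : ℕ} (hj : j < π.P) :
    ∑ v ∈ ball π j, (weight v : ℝ) * (gram v v + π.ρ j ^ 2) ≤ (Ω + 4) * π.ρ j ^ 2 := by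
  have h₁ := sum_ball_add_lowCost_le hπ hj
  have h₂ : 0 ≤ ∑ v : Loc π, lowCost j v := Finset.sum_nonneg fun v _ => lowCost_nonneg hπ j v
  have h₃ := mul_le_mul_of_nonneg_right (hπ.ballWeight_le j) (sq_nonneg (π.ρ j))
  linarith

/-- Every uncovered location of the current tier gains at least `ρ i ^ 2 = ρ (i + 1) ^ 8`. With
shell `i` covered, the ball costs only order `Ω ρ (i + 1) ^ 2`, and later fillers at most `2 ρ (i +
1) ^ 3`, so greedy stays in the tier once one of its locations is sampled. -/
theorem Trans.gain_lt (hA : Trans A i) (hi : (i : ℕ) + 1 < π.P) {x : Loc π}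
    (hx : x ∉ tierLeft A i) : gain weight sqDist A x < π.ρ i ^ 2 := by
  classical
  have hΩ₁ := hπ.one_le_Ω
  have hΩ₂ : Ω ≤ Ω ^ 3 := le_self_pow₀ hΩ₁ (by norm_num)
  have hΩ := (hπ.rho_bounds i.2).1
  have hrec := (hπ.rho_bounds i.2).2
  have hH := hπ.rho_ge (show (i : ℕ) + 1 ≤ π.P from i.2)
  have hH8 : π.ρ i ^ 2 = π.ρ (i + 1) ^ 8 := by rw [hrec]; ring
  have hH3 : π.ρ (i + 1) * π.ρ (i + 1) ^ 3 ≤ π.ρ (i + 1) ^ 8 := by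
    rw [← pow_succ']
    exact pow_le_pow_right₀ (by linarith) (by norm_num)
  have hH3' : 2 * π.ρ (i + 1) ^ 3 < π.ρ (i + 1) * π.ρ (i + 1) ^ 3 :=
    mul_lt_mul_of_pos_right (by linarith) (by positivity)
  have hH1 : π.ρ (i + 1) ≤ π.ρ (i + 1) ^ 8 := le_self_pow₀ (by linarith) (by norm_num)
  have hmem : x ∈ A → gain weight sqDist A x < π.ρ i ^ 2 := fun hxA => by
    rw [gain_eq_zero_of_mem hxA, hH8]
    positivity
  have hball : InBall (i + 1) x → gain weight sqDist A x < π.ρ i ^ 2 := by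
    intro hb
    have hle : ∀ v : Loc π, (weight v : ℝ) * max 0 (setDist sqDist A v - sqDist v x) ≤
        (if InBall (i + 1) v then (weight v : ℝ) * (gram v v + π.ρ (i + 1) ^ 2) else 0) +
        if v = lure i then π.ρ (i + 1) ^ 2 else 0 := by
      intro v
      have hzero : max 0 (setDist sqDist A v - sqDist v x) = 0 → ¬ InBall (i + 1) v →
          (weight v : ℝ) * max 0 (setDist sqDist A v - sqDist v x) ≤
          (if InBall (i + 1) v then (weight v : ℝ) * (gram v v + π.ρ (i + 1) ^ 2) else 0) +
          if v = lure i then π.ρ (i + 1) ^ 2 else 0 := fun h₀ h₁ => by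
        rw [h₀, mul_zero, if_neg h₁, zero_add]
        split_ifs <;> positivity
      by_cases hv : InBall (i + 1) v
      · rw [if_pos hv]
        have h₁ := hA.setDist_eq hπ hi hv
        have h₂ : (0 : ℝ) ≤ if v = lure i then π.ρ (i + 1) ^ 2 else 0 := by
          split_ifs <;> positivity
        have h₃ : (weight v : ℝ) * max 0 (setDist sqDist A v - sqDist v x) ≤
            (weight v : ℝ) * setDist sqDist A v := by
          refine mul_le_mul_of_nonneg_left (max_le (h.setDist_nonneg A v) ?_) (Nat.cast_nonneg _)
          linarith [h.nonneg v x]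
        rw [← h₁]
        linarith
      by_cases hvA : v ∈ A
      · exact hzero (max_eq_zero_of_mem h hvA x) hv
      cases v with
      | base => exact absurd hA.base_mem hvA
      | shell i' => exact absurd (hA.shell_mem i' (not_le.1 hv)) hvA
      | lure i' =>
        have hii : i' = i := by
          have h₁ : (i' : ℕ) < i + 1 := not_le.1 hv
          by_contra hne
          have h₂ := Fin.val_ne_of_ne hne
          exact hvA (hA.lure_mem i' (Fin.lt_def.2 (by omega)))
        subst hii
        rw [if_neg hv, zero_add, if_pos rfl]
        simp only [weight, Nat.cast_one, one_mul]
        refine max_le (sq_nonneg _) ?_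
        -- The lure is the only tier location that a center in the ball can help. Its distance to
        -- the covered shell is already reduced by `2 ρ i ρ (i + 1)`, whereas its inner product with
        -- any center in the next ball is at most `ρ i`.
        have h₁ := setDist_le sqDist (lure i') (hA.shell_mem i' (Nat.lt_succ_self _))
        have hg : gram (lure i') (lure i') = 2 * π.ρ i' ^ 2 := by simp [gram]
        have h₂ : sqDist (lure i') (shell i') =
            2 * π.ρ i' ^ 2 + π.ρ (i' + 1) ^ 2 - 2 * (π.ρ i' * π.ρ (i' + 1)) := by
          rw [sqDist, hg]
          simp [gram]
        have hr := hπ.rho_ge i'.2.le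
        have h₃ : gram (lure i') x ≤ π.ρ i' := by
          cases x with
          | decoy =>
            have := mul_le_mul_of_nonneg_right hπ.one_div_P_le (show 0 ≤ π.ρ i' by linarith)
            rw [one_mul] at this
            exact this
          | shell i'' =>
            have h₁ : (i' : ℕ) + 1 ≤ i'' := hb
            have : i'' ≠ i' := by rintro rfl; omega
            simp only [gram, this, if_false]
            linarith
          | lure i'' =>
            have h₁ : (i' : ℕ) + 1 ≤ i'' := hb
            have : i' ≠ i'' := by rintro rfl; omega
            simp only [gram, this, if_false]
            linarith
          | _ => simp only [gram]; linarith
        have h₄ : 0 ≤ gram x x := by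
          by_cases hc : x = core
          · rw [hc]
            exact le_rfl
          · linarith [gram_self_ge hπ hc]
        have h₅ : sqDist (lure i') x = 2 * π.ρ i' ^ 2 + gram x x - 2 * gram (lure i') x := by
          rw [sqDist, hg]
        rw [h₅]
        nlinarith
      | decoy => exact absurd trivial hv
      | core => exact absurd trivial hv
      | sat m => exact absurd trivial hv
      | filler i' m =>
        exact hzero ((hπ.isSpoke_filler i' m).max_eq_zero h hA.base_mem
          (by rintro rfl; exact hb)) hv
      | light m =>
        exact hzero ((isSpoke_light m).max_eq_zero h hA.base_mem (by rintro rfl; exact hb)) hv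
    have hsum := Finset.sum_le_sum fun v (_ : v ∈ Finset.univ) => hle v
    rw [Finset.sum_add_distrib, Finset.sum_ite_eq', if_pos (Finset.mem_univ _),
      ← Finset.sum_filter] at hsum
    have h₁ := sum_ball_next_le hπ hi
    have h₂ : gain weight sqDist A x ≤ (Ω + 5) * π.ρ (i + 1) ^ 2 := by
      rw [gain]
      refine hsum.trans ?_
      rw [ball] at h₁
      linarith
    rw [hH8]
    have h₃ : (Ω + 5) * π.ρ (i + 1) ^ 2 < π.ρ (i + 1) * π.ρ (i + 1) ^ 2 :=
      mul_lt_mul_of_pos_right (by linarith) (by positivity)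
    have h₄ : π.ρ (i + 1) * π.ρ (i + 1) ^ 2 ≤ π.ρ (i + 1) ^ 8 := by
      rw [← pow_succ']
      exact pow_le_pow_right₀ (by linarith) (by norm_num)
    linarith
  by_cases hxA : x ∈ A
  · exact hmem hxA
  by_cases hb : InBall (i + 1) x
  · exact hball hb
  cases x with
  | base => exact absurd hA.base_mem hxA
  | shell i' => exact absurd (hA.shell_mem i' (not_le.1 hb)) hxA
  | lure i' =>
    have h₁ : (i' : ℕ) < i + 1 := not_le.1 hb
    have hne : i' ≠ i := by
      rintro rfl
      exact hx (mem_tierLeft.2 ⟨hxA, .inl rfl⟩)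
    have h₂ := Fin.val_ne_of_ne hne
    exact absurd (hA.lure_mem i' (Fin.lt_def.2 (by omega))) hxA
  | decoy => exact absurd trivial hb
  | core => exact absurd trivial hb
  | sat m => exact absurd trivial hb
  | filler i' m =>
    rcases lt_trichotomy i' i with hij | rfl | hij
    · exact absurd (hA.filler_mem i' hij m) hxA
    · exact absurd (mem_tierLeft.2 ⟨hxA, .inr ⟨m, rfl⟩⟩) hx
    · rw [(hπ.isSpoke_filler i' m).gain_eq h hA.base_mem hxA, hH8]
      have := hπ.fillerCost_le (Fin.lt_def.1 hij) i'.2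
      linarith
  | light m =>
    rw [(isSpoke_light m).gain_eq h hA.base_mem hxA, hH8]
    have := hπ.lightCost_le
    linarith

open Classical in
theorem Trans.sum_rest_le (hA : Trans A i) (hi : (i : ℕ) + 1 < π.P) :
    ∑ v with v ∉ tierLeft A i, (weight v : ℝ) * setDist sqDist A v + 1 ≤
      100 * Ω ^ 3 * π.ρ (i + 1) ^ 3 := by
  have hΩ₁ := hπ.one_le_Ω
  have hΩ₂ : Ω ≤ Ω ^ 3 := le_self_pow₀ hΩ₁ (by norm_num)
  have hH := hπ.rho_ge (show (i : ℕ) + 1 ≤ π.P from i.2)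
  have h₁ := sum_ball_next_le hπ hi
  have h₂ := sum_lowCost_le hπ i.2
  have h₃ : ∑ v with v ∉ tierLeft A i, (weight v : ℝ) * setDist sqDist A v ≤
      ∑ v ∈ ball π (i + 1), (weight v : ℝ) * (gram v v + π.ρ (i + 1) ^ 2) +
        ∑ v : Loc π, lowCost i v := by
    rw [ball, Finset.sum_filter, Finset.sum_filter, ← Finset.sum_add_distrib]
    refine Finset.sum_le_sum fun v _ => ?_
    have hlow := lowCost_nonneg hπ i v
    by_cases hb : InBall (i + 1) v
    · rw [if_pos hb, ← hA.setDist_eq hπ hi hb]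
      have hpos : 0 ≤ (weight v : ℝ) * setDist sqDist A v :=
        mul_nonneg (Nat.cast_nonneg _) (h.setDist_nonneg A v)
      split_ifs <;> linarith
    rw [if_neg hb, zero_add]
    by_cases hvA : v ∈ A
    · rw [h.setDist_eq_zero hvA, mul_zero]
      split_ifs <;> exact hlow
    by_cases hvt : v ∈ tierLeft A i
    · rw [if_neg (not_not.2 hvt)]
      exact hlow
    rw [if_pos hvt]
    cases v with
    | base => exact absurd hA.base_mem hvA
    | shell i' => exact absurd (hA.shell_mem i' (not_le.1 hb)) hvA
    | lure i' =>
      have h₁ : (i' : ℕ) < i + 1 := not_le.1 hb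
      have hne : i' ≠ i := by
        rintro rfl
        exact hvt (mem_tierLeft.2 ⟨hvA, .inl rfl⟩)
      have h₂ := Fin.val_ne_of_ne hne
      exact absurd (hA.lure_mem i' (Fin.lt_def.2 (by omega))) hvA
    | decoy => exact absurd trivial hb
    | core => exact absurd trivial hb
    | sat m => exact absurd trivial hb
    | filler i' m =>
      rcases lt_trichotomy i' i with hij | rfl | hij
      · exact absurd (hA.filler_mem i' hij m) hvA
      · exact absurd (mem_tierLeft.2 ⟨hvA, .inr ⟨m, rfl⟩⟩) hvt
      · rw [(hπ.isSpoke_filler i' m).setDist_eq h hA.base_mem hvA]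
        simp only [weight, lowCost]
        rw [if_pos (Fin.lt_def.1 hij)]
        simp
    | light m =>
      rw [(isSpoke_light m).setDist_eq h hA.base_mem hvA]
      simp [weight, lowCost]
  have h₄ : π.ρ (i + 1) ^ 2 ≤ π.ρ (i + 1) ^ 3 := pow_le_pow_right₀ (by linarith) (by norm_num)
  have h₅ : 1 ≤ π.ρ (i + 1) ^ 3 := one_le_pow₀ (by linarith)
  have h₆ : (Ω + 4) * π.ρ (i + 1) ^ 2 ≤ (5 * Ω ^ 3) * π.ρ (i + 1) ^ 3 :=
    mul_le_mul (by linarith) h₄ (by positivity) (by positivity)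
  have h₇ : Ω * (2 * π.ρ (i + 1) ^ 3) ≤ Ω ^ 3 * (2 * π.ρ (i + 1) ^ 3) :=
    mul_le_mul_of_nonneg_right hΩ₂ (by positivity)
  have h₈ : Ω + 1 ≤ 2 * Ω ^ 3 * π.ρ (i + 1) ^ 3 := by
    have : 2 * Ω ^ 3 * 1 ≤ 2 * Ω ^ 3 * π.ρ (i + 1) ^ 3 :=
      mul_le_mul_of_nonneg_left h₅ (by positivity)
    linarith
  have h₉ : 0 ≤ Ω ^ 3 * π.ρ (i + 1) ^ 3 := by positivity
  linarith

end

end Loc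

/-! ### Induction over the steps of all phases -/

namespace Loc

variable {π : Params} {e : ℝ} {d l : ℕ} {p : (Σ v : Loc π, Fin (weight v)) → Pt d} {Ω : ℝ}
variable (hπ : π.Valid Ω) (h : IsRealization weight (sqDist (π := π)) e p)
  {r : Rule d l} (hr : IsGreedyRule h.points r) (hX : h.points.Nonempty)
  {Ev : Set (Finset (Pt d))} (hEv : IsSuccess h Ev) {A : Finset (Loc π)} {j : Fin π.P} {u : ℕ}

open Classical in
theorem Pre.insert_shell (hA : Pre A j u) : Trans (insert (shell j) A) j := by
  refine ⟨⟨Finset.mem_insert_of_mem hA.base_mem, fun i hi => ?_, fun v hv => ?_,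
    fun i m hi => ?_, fun m => ?_⟩, fun i hi => Finset.mem_insert_of_mem (hA.lure_mem i hi),
    fun i hi m => Finset.mem_insert_of_mem (hA.filler_mem i hi m), fun i m hi => ?_⟩
  · rcases Nat.lt_succ_iff_lt_or_eq.1 hi with hlt | heq
    · exact Finset.mem_insert_of_mem (hA.shell_mem i hlt)
    · rw [Fin.ext heq]
      exact Finset.mem_insert_self _ _
  · rw [Finset.mem_insert, not_or]
    constructor
    · rintro rfl
      exact absurd (show (j : ℕ) + 1 ≤ j from hv) (by omega)
    · apply hA.ball_notMem
      cases v <;> simp only [InBall] at hv ⊢ <;> omega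
  · rw [Finset.mem_insert, not_or]
    exact ⟨by simp, hA.filler_notMem i m (by omega)⟩
  · rw [Finset.mem_insert, not_or]
    exact ⟨by simp, hA.light_notMem m⟩
  · rw [Finset.mem_insert, not_or]
    exact ⟨by simp, hA.filler_notMem i m hi⟩

open Classical in
theorem Pre.insert_decoy (hA : Pre A j u) : Taken (insert decoy A) := by
  refine ⟨⟨Finset.mem_insert_of_mem hA.base_mem, Finset.mem_insert_self _ _, ?_, fun m => ?_⟩,
    fun m => ?_⟩
  all_goals rw [Finset.mem_insert, not_or]
  · exact ⟨by simp, hA.ball_notMem _ trivial⟩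
  · exact ⟨by simp, hA.ball_notMem _ trivial⟩
  · exact ⟨by simp, hA.light_notMem m⟩

open Classical in
theorem Pre.insert_filler (hA : Pre A j u) {x : Loc π} (hx : x ∈ fillersLeft A j) :
    Pre (insert x A) j (u - 1) := by
  obtain ⟨hxA, m, hm⟩ := mem_fillersLeft.1 hx
  refine ⟨⟨Finset.mem_insert_of_mem hA.base_mem,
    fun i hi => Finset.mem_insert_of_mem (hA.shell_mem i hi), fun v hv => ?_,
    fun i m' hi => ?_, fun m' => ?_⟩, fun i hi => Finset.mem_insert_of_mem (hA.lure_mem i hi),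
    fun i hi m => Finset.mem_insert_of_mem (hA.filler_mem i hi m), ?_⟩
  · rw [Finset.mem_insert, not_or]
    refine ⟨?_, hA.ball_notMem _ hv⟩
    rintro rfl
    rw [hm] at hv
    exact hv
  · rw [Finset.mem_insert, not_or, hm]
    refine ⟨?_, hA.filler_notMem i m' hi⟩
    rw [filler.injEq]
    rintro ⟨rfl, -⟩
    omega
  · rw [Finset.mem_insert, not_or, hm]
    exact ⟨by simp, hA.light_notMem m'⟩
  · rw [← hA.card_eq, ← Finset.card_erase_of_mem hx]
    congr 1
    ext y
    rw [Finset.mem_erase, mem_fillersLeft, mem_fillersLeft, Finset.mem_insert]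
    tauto

open Classical in
theorem Trans.insert_tier {i : Fin π.P} (hA : Trans A i) {x : Loc π} (hx : x ∈ tierLeft A i) :
    Trans (insert x A) i := by
  obtain ⟨hxA, hm⟩ := mem_tierLeft.1 hx
  refine ⟨⟨Finset.mem_insert_of_mem hA.base_mem,
    fun i hi => Finset.mem_insert_of_mem (hA.shell_mem i hi), fun v hv => ?_,
    fun i m' hi => ?_, fun m' => ?_⟩, fun i hi => Finset.mem_insert_of_mem (hA.lure_mem i hi),
    fun i hi m => Finset.mem_insert_of_mem (hA.filler_mem i hi m), fun i m' hi => ?_⟩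
  · rw [Finset.mem_insert, not_or]
    refine ⟨?_, hA.ball_notMem _ hv⟩
    rintro rfl
    rcases hm with rfl | ⟨m, rfl⟩
    · exact absurd (show (i : ℕ) + 1 ≤ i from hv) (by omega)
    · exact hv
  · rw [Finset.mem_insert, not_or]
    refine ⟨?_, hA.filler_notMem i m' hi⟩
    rintro rfl
    rcases hm with hm | ⟨m, hm⟩
    · simp at hm
    · rw [filler.injEq] at hm
      rw [hm.1] at hi
      omega
  · rw [Finset.mem_insert, not_or]
    refine ⟨?_, hA.light_notMem m'⟩
    rintro rfl
    rcases hm with hm | ⟨m, hm⟩ <;> simp at hm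
  · rw [Finset.mem_insert, not_or]
    refine ⟨?_, hA.next_notMem i m' hi⟩
    rintro rfl
    rcases hm with hm | ⟨m, hm⟩
    · simp at hm
    · rw [filler.injEq] at hm
      rw [hm.1] at hi
      exact lt_irrefl _ hi

include hπ hr hEv

open Classical in
/-- The success probability in the phases. -/
theorem le_stepProb (hl : 2 ≤ l)
    (he : e * Fintype.card (Σ v : Loc π, Fin (weight v)) ≤ 1) {u₀ v₀ : ℕ} (hu₀ : l ≤ u₀ + 1)
    (hv₀ : 2 * π.n + 112 * (π.a : ℝ) ^ 3 + 1 ≤ 15 * π.a ^ 2 * v₀) {V τ : ℝ} (hV : V ≤ 1)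
    (hVt : V ≤ 1 - runErr (l * π.n / (30 * π.a ^ 2)) (8 * π.a) v₀ π.t)
    (hτ₀ : 0 ≤ τ) (hτ : 100 * Ω ^ 3 ≤ τ * π.ρ π.P) (f : ℕ → ℝ) (hfP : f π.P ≤ 0)
    (hfV : ∀ j < π.P, f (j + 1) ≤ V)
    (hf : ∀ j < π.P, f j ≤ f (j + 1) + 1 / (6 * π.P) * (V - f (j + 1)) -
      runErr (l * π.P / (8 * π.n)) 2 u₀ π.s) :
    ∀ (m : ℕ) (C : Finset (Σ v : Loc π, Fin (weight v))),
      (C.image Sigma.fst).card + m + 1 = Fintype.card (Loc π) →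
      (∀ (j : Fin π.P) (u : ℕ), Pre (C.image Sigma.fst) j u →
        f (j + 1) + 1 / (6 * π.P) * (V - f (j + 1)) - runErr (l * π.P / (8 * π.n)) 2 u₀ u -
          m * τ ≤ stepProb h.points hX r Ev m (C.image p)) ∧
      (∀ i : Fin π.P, Trans (C.image Sigma.fst) i →
        f (i + 1) - m * τ ≤ stepProb h.points hX r Ev m (C.image p))
  | 0, C, hm => by
    have key : core ∉ C.image Sigma.fst → (∀ m, sat m ∉ C.image Sigma.fst) → False :=
      fun h₁ h₂ => by
        have := Caught.card_lt h₁ h₂ (by rw [hπ.N_eq]; have := hπ.one_le_a; omega)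
        omega
    exact ⟨fun j u hA => (key (hA.ball_notMem _ trivial) fun m => hA.ball_notMem _ trivial).elim,
      fun i hA => (key (hA.ball_notMem _ trivial) fun m => hA.ball_notMem _ trivial).elim⟩
  | m + 1, C, hm => by
    have ih := le_stepProb hl he hu₀ hv₀ hV hVt hτ₀ hτ f hfP hfV hf m
    have hτm : 0 ≤ (m : ℝ) * τ := by positivity
    have hprob := stepProb_nonneg h.points hX r Ev (m + 1) (C.image p)
    have hP := hπ.P_real
    have hcard : ∀ s : (Σ v : Loc π, Fin (weight v)), s.1 ∉ C.image Sigma.fst →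
        ((insert s C).image Sigma.fst).card + m + 1 = Fintype.card (Loc π) := fun s hs => by
      rw [Finset.image_insert, Finset.card_insert_of_notMem hs]
      omega
    have hpre : ∀ (j : Fin π.P) (u : ℕ), Pre (C.image Sigma.fst) j u →
        f (j + 1) + 1 / (6 * π.P) * (V - f (j + 1)) - runErr (l * π.P / (8 * π.n)) 2 u₀ u -
          (m + 1 : ℕ) * τ ≤ stepProb h.points hX r Ev (m + 1) (C.image p) := by
      intro j u hA
      have hfVj := hfV j j.2
      push_cast
      rcases Nat.lt_or_ge u₀ u with hu | hu
      swap
      · rw [runErr_of_le _ _ hu]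
        have hκ : 1 / (6 * π.P : ℝ) ≤ 1 := by
          rw [div_le_one (by positivity)]
          linarith
        have := mul_le_mul_of_nonneg_right hκ (sub_nonneg.2 hfVj)
        linarith
      -- Both values are shifted by the transition error `m * τ` of the remaining steps; the
      -- difference `V - f` is unaffected, so the shift passes through the recursion unchanged.
      have hstep := hA.stepProb_succ_ge hπ h hr hX Ev m hl (by omega) he
        (f := f (j + 1) - m * τ) (V := V - m * τ)
        (e' := runErr (l * π.P / (8 * π.n)) 2 u₀ (u - 1)) (by linarith) (by linarith)
        (runErr_nonneg _ _ _ _) (fun s hs => ?_) (fun s hs => ?_) (fun s hs => ?_)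
      · rw [runErr_of_lt _ _ hu]
        linarith
      · refine (ih (insert s C) (hcard s ?_)).2 j ?_
        · rw [hs]
          exact hA.ball_notMem _ le_rfl
        · rw [Finset.image_insert, hs]
          exact hA.insert_shell
      · refine Taken.le_stepProb hπ h hr hX hEv hl he hv₀ hV hVt hτ₀ hτ m _ ?_ (hcard s ?_)
        · rw [Finset.image_insert, hs]
          exact hA.insert_decoy
        · rw [hs]
          exact hA.ball_notMem _ trivial
      · refine le_trans ?_ ((ih (insert s C) (hcard s (mem_fillersLeft.1 hs).1)).1 j (u - 1) ?_)
        · linarith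
        · rw [Finset.image_insert]
          exact hA.insert_filler hs
    refine ⟨hpre, fun i hA => ?_⟩
    have hfVi := hfV i i.2
    -- After the last shell there is no further attempt, and nothing is claimed because `f P ≤ 0`.
    by_cases hi : (i : ℕ) + 1 < π.P
    swap
    · have : (i : ℕ) + 1 = π.P := by omega
      rw [this]
      push_cast
      linarith
    rcases (tierLeft (C.image Sigma.fst) i).eq_empty_or_nonempty with hempty | ⟨x, hx⟩
    · refine le_trans ?_ (hpre _ _ (hA.pre hi hempty))
      have := hf _ hi
      simp only at this ⊢
      linarith
    have hC : C.Nonempty := by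
      obtain ⟨s, hs, -⟩ := Finset.mem_image.1 hA.base_mem
      exact ⟨s, hs⟩
    have hρ := hπ.rho_ge i.2.le
    have hcost : π.ρ i ^ 2 ≤ cost h.points (C.image p) := by
      refine ((hA.le_mul_setDist hπ h hx).trans ?_).trans (h.locCost_le_cost hC)
      exact Finset.single_le_sum
        (f := fun v => (weight v : ℝ) * setDist sqDist (C.image Sigma.fst) v)
        (fun v _ => mul_nonneg (Nat.cast_nonneg _) (h.setDist_nonneg _ v)) (Finset.mem_univ x)
    have hpos : 0 < cost h.points (C.image p) := lt_of_lt_of_le (by positivity) hcost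
    have hcov : ∀ v ∈ tierLeft (C.image Sigma.fst) i, v ∉ C.image Sigma.fst :=
      fun v hv => (mem_tierLeft.1 hv).1
    have hstep := h.stepProb_succ_ge_sub hr hX Ev m (x := f (i + 1) - m * τ) (τ := τ) (by omega)
      hC hpos (tierLeft (C.image Sigma.fst) i) hcov (by linarith) ?_ ?_
    · push_cast
      linarith
    · refine (h.one_sub_mass_le hX hC hpos _ hcov).trans ?_
      rw [div_le_iff₀ hpos]
      refine (add_le_add le_rfl he).trans ((hA.sum_rest_le hπ h hi).trans ?_)
      have hH := hπ.rho_ge (show (i : ℕ) + 1 ≤ π.P from i.2)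
      have h₁ : τ * π.ρ i ^ 2 ≤ τ * cost h.points (C.image p) :=
        mul_le_mul_of_nonneg_left hcost hτ₀
      refine le_trans ?_ h₁
      have h₂ : 100 * Ω ^ 3 ≤ τ * π.ρ (i + 1) :=
        hτ.trans (mul_le_mul_of_nonneg_left (hπ.rho_P_le i.2) hτ₀)
      calc 100 * Ω ^ 3 * π.ρ (i + 1) ^ 3 ≤ τ * π.ρ (i + 1) * π.ρ (i + 1) ^ 3 :=
            mul_le_mul_of_nonneg_right h₂ (by positivity)
        _ = τ * π.ρ (i + 1) ^ 4 := by ring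
        _ ≤ τ * π.ρ (i + 1) ^ 8 :=
            mul_le_mul_of_nonneg_left (pow_le_pow_right₀ (by linarith) (by norm_num)) hτ₀
        _ = τ * π.ρ i ^ 2 := by rw [(hπ.rho_bounds i.2).2]; ring
    · intro v hv s hs
      have hg := ((hA.le_mul_setDist hπ h hv).trans (le_gain h (C.image Sigma.fst) v)).trans hs
      have hst : s.1 ∈ tierLeft (C.image Sigma.fst) i := by
        by_contra hst
        have := hA.gain_lt hπ h hi hst
        linarith
      refine (ih (insert s C) (hcard s (hcov _ hst))).2 i ?_
      rw [Finset.image_insert]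
      exact hA.insert_tier hst

end Loc

/-! ### General facts on the optimum, and the trivial instance -/

section
variable {d l : ℕ} (X : Finset (Pt d)) (hX : X.Nonempty) (r : Rule d l)

theorem cost_nonneg (C : Finset (Pt d)) : 0 ≤ cost X C :=
  Finset.sum_nonneg fun _ _ => pointCost_nonneg _ _

theorem pointCost_anti (x : Pt d) {C C' : Finset (Pt d)} (hC : C.Nonempty) (h : C ⊆ C') :
    pointCost x C' ≤ pointCost x C := by
  have : Nonempty C := hC.to_subtype
  exact le_ciInf fun c => ciInf_le
    (Set.finite_range fun c : C' => ‖x - (c : Pt d)‖ ^ 2).bddBelow ⟨c, h c.2⟩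

theorem cost_anti {C C' : Finset (Pt d)} (hC : C.Nonempty) (h : C ⊆ C') :
    cost X C' ≤ cost X C :=
  Finset.sum_le_sum fun x _ => pointCost_anti x hC h

theorem exists_pointCost_eq (x : Pt d) {C : Finset (Pt d)} (hC : C.Nonempty) :
    ∃ c ∈ C, pointCost x C = ‖x - c‖ ^ 2 := by
  have : Nonempty C := hC.to_subtype
  obtain ⟨c, hc⟩ := exists_eq_ciInf_of_finite (f := fun c : C => ‖x - (c : Pt d)‖ ^ 2)
  exact ⟨c, c.2, hc.symm⟩

theorem opt_le {k : ℕ} {C : Finset (Pt d)} (hC : C.card = k) : opt X k ≤ cost X C :=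
  ciInf_le (f := fun C : {C : Finset (Pt d) // C.card = k} => cost X C.1)
    ⟨0, by rintro _ ⟨C, rfl⟩; exact cost_nonneg X C.1⟩ ⟨C, hC⟩

/-- Two of more than `k` points share a nearest center, and then cost at least half of their squared
distance. The minimum over all pairs bounds the infimum uniformly, also for centers outside `X`. -/
theorem opt_pos {k : ℕ} (hk : 1 ≤ k) (hkX : k < X.card) : 0 < opt X k := by
  classical
  have hne : X.offDiag.Nonempty := by
    obtain ⟨x, hx, y, hy, hxy⟩ := Finset.one_lt_card.1 (show 1 < X.card by omega)
    exact ⟨(x, y), Finset.mem_offDiag.2 ⟨hx, hy, hxy⟩⟩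
  obtain ⟨z, hz, hmin⟩ := X.offDiag.exists_min_image (fun z => ‖z.1 - z.2‖ ^ 2) hne
  have hpos : 0 < ‖z.1 - z.2‖ ^ 2 := by
    have := sub_ne_zero.2 (Finset.mem_offDiag.1 hz).2.2
    positivity
  obtain ⟨C₀, -, hC₀⟩ := Finset.exists_subset_card_eq hkX.le
  have : Nonempty {C : Finset (Pt d) // C.card = k} := ⟨⟨C₀, hC₀⟩⟩
  refine lt_of_lt_of_le (half_pos hpos) (le_ciInf fun ⟨C, hC⟩ => ?_)
  have hCne : C.Nonempty := Finset.card_pos.1 (by omega)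
  choose g hg hgc using fun x => exists_pointCost_eq x hCne
  obtain ⟨x, hx, y, hy, hxy, hgxy⟩ := Finset.exists_ne_map_eq_of_card_lt_of_maps_to
    (show C.card < X.card by omega) (f := g) (fun x _ => hg x)
  have h₁ := hmin (x, y) (Finset.mem_offDiag.2 ⟨hx, hy, hxy⟩)
  have h₂ : pointCost x C + pointCost y C ≤ cost X C := by
    rw [← Finset.sum_pair (f := fun x => pointCost x C) hxy]
    refine Finset.sum_le_sum_of_subset_of_nonneg ?_ fun _ _ _ => pointCost_nonneg _ _
    intro v hv
    rcases Finset.mem_insert.1 hv with rfl | hv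
    · exact hx
    · rwa [Finset.mem_singleton.1 hv]
  rw [hgc, hgc, hgxy] at h₂
  have h₃ : ‖x - y‖ ≤ ‖x - g y‖ + ‖y - g y‖ := by
    have := norm_sub_le (x - g y) (y - g y)
    rwa [sub_sub_sub_cancel_right] at this
  have h₄ : ‖x - y‖ ^ 2 ≤ (‖x - g y‖ + ‖y - g y‖) ^ 2 :=
    pow_le_pow_left₀ (norm_nonneg _) h₃ 2
  simp only at h₁
  nlinarith [sq_nonneg (‖x - g y‖ - ‖y - g y‖)]

theorem mem_of_candidatePMF_ne_zero {C : Finset (Pt d)} {a : Pt d}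
    (ha : candidatePMF X hX C a ≠ 0) : a ∈ X := by
  classical
  by_contra hm
  apply ha
  rw [candidatePMF]
  split_ifs with hc
  · rw [costPMF, PMF.ofFinset_apply, if_neg hm]
  · rw [PMF.uniformOfFinset_apply, if_neg hm]

theorem iterPMF_support_subset :
    ∀ (m : ℕ) (C C' : Finset (Pt d)), C ⊆ X → C' ∈ (iterPMF X hX r m C).support → C' ⊆ X
  | 0, C, C', hC, h => by
    rw [iterPMF, PMF.support_pure, Set.mem_singleton_iff] at h
    rwa [h]
  | m + 1, C, C', hC, h => by
    classical
    rw [iterPMF, PMF.mem_support_bind_iff] at h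
    obtain ⟨C₁, h₁, h₂⟩ := h
    rw [stepPMF, PMF.mem_support_map_iff] at h₁
    obtain ⟨c, hc, rfl⟩ := h₁
    refine iterPMF_support_subset m _ _ (Finset.insert_subset ?_ hC) h₂
    rw [PMF.mem_support_iff, iidPMF_apply] at hc
    exact mem_of_candidatePMF_ne_zero X hX (Finset.prod_ne_zero_iff.1 hc _ (Finset.mem_univ _))

theorem card_le_of_mem_support_seedingPMF {k : ℕ} (hk : 1 ≤ k) {C : Finset (Pt d)}
    (hC : C ∈ (seedingPMF X hX r k).support) : C.card ≤ k ∧ C.Nonempty ∧ C ⊆ X := by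
  rw [seedingPMF_eq_iterPMF] at hC
  have h := card_of_mem_support_iterPMF X hX r k ∅ C hC
  rw [Finset.card_empty, zero_add] at h
  exact ⟨h.1, h.2 hk, iterPMF_support_subset X hX r k ∅ C (Finset.empty_subset _) hC⟩

/-- No set of at most `k` centers beats the optimum. -/
theorem opt_le_of_card_le {k : ℕ} {C : Finset (Pt d)} (hd : 1 ≤ d) (hC : C.Nonempty)
    (hk : C.card ≤ k) : opt X k ≤ cost X C := by
  have : Nonempty (Fin d) := ⟨⟨0, hd⟩⟩
  have : Infinite (Pt d) := Module.Free.infinite ℝ (Pt d)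
  obtain ⟨C', hsub, hC'⟩ := Infinite.exists_superset_card_eq C k hk
  exact (opt_le X hC').trans (cost_anti X hC hsub)

end

/-- A bound by a multiple of the optimum that holds for every seeding. -/
theorem exists_seeding_trivial {k l : ℕ} (hk : 1 ≤ k) {β p : ℝ} (hβ : β ≤ 1) (hp : p ≤ 1) :
    ∃ (d : ℕ) (X : Finset (Pt d)) (hX : X.Nonempty), 0 < opt X k ∧
      ∀ r : Rule d l, IsGreedyRule X r → ENNReal.ofReal p ≤
        (seedingPMF X hX r k).toOuterMeasure {C | β * opt X k ≤ cost X C} := by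
  have : Infinite (Pt 1) := Module.Free.infinite ℝ (Pt 1)
  obtain ⟨X, hXc⟩ := Infinite.exists_subset_card_eq (Pt 1) (k + 1)
  have hX : X.Nonempty := Finset.card_pos.1 (by omega)
  have hpos := opt_pos X hk (by omega)
  refine ⟨1, X, hX, hpos, fun r _ => ?_⟩
  rw [(PMF.toOuterMeasure_apply_eq_one_iff _ _).2]
  · exact ENNReal.ofReal_le_one.2 hp
  · intro C hC
    obtain ⟨h₁, h₂, -⟩ := card_le_of_mem_support_seedingPMF X hX r hk hC
    have h₃ := opt_le_of_card_le X le_rfl h₂ h₁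
    have h₄ : β * opt X k ≤ 1 * opt X k := mul_le_mul_of_nonneg_right hβ hpos.le
    rw [one_mul] at h₄
    exact h₄.trans h₃

/-! ### Assembly of the hard instance -/

namespace Loc

variable {π : Params} {e : ℝ} {d l : ℕ} {p : (Σ v : Loc π, Fin (weight v)) → Pt d} {Ω : ℝ}
variable (hπ : π.Valid Ω) (h : IsRealization weight (sqDist (π := π)) e p)

theorem pre_base (hP : 0 < π.P) : Pre ({base} : Finset (Loc π)) ⟨0, hP⟩ π.s := by
  refine ⟨⟨Finset.mem_singleton_self _, fun i hi => absurd hi (Nat.not_lt_zero _),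
    fun v hv => ?_, fun i m hi => by simp, fun m => by simp⟩,
    fun i hi => absurd hi (Nat.not_lt_zero _), fun i hi => absurd hi (Nat.not_lt_zero _), ?_⟩
  · rw [Finset.mem_singleton]
    rintro rfl
    exact hv
  · have : fillersLeft ({base} : Finset (Loc π)) ⟨0, hP⟩ = Finset.univ.map
        ⟨fun m : Fin π.s => (filler ⟨0, hP⟩ m : Loc π), fun a b hab => by simpa using hab⟩ := by
      ext v
      rw [mem_fillersLeft, Finset.mem_map]
      constructor
      · rintro ⟨-, m, rfl⟩
        exact ⟨m, Finset.mem_univ _, rfl⟩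
      · rintro ⟨m, -, rfl⟩
        exact ⟨by simp, m, rfl⟩
    rw [this, Finset.card_map, Finset.card_univ, Fintype.card_fin]

include hπ

/-- A representative of a location. -/
theorem exists_representatives (L : Finset (Loc π)) :
    ∃ C : Finset (Σ v : Loc π, Fin (weight v)), C.card = L.card ∧
      open Classical in C.image Sigma.fst = L := by
  classical
  refine ⟨L.map ⟨fun v => ⟨v, 0, hπ.weight_pos v⟩, fun u v huv => congrArg Sigma.fst huv⟩,
    Finset.card_map _, ?_⟩
  ext v
  simp only [Finset.mem_image, Finset.mem_map]
  constructor
  · rintro ⟨_, ⟨u, hu, rfl⟩, rfl⟩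
    exact hu
  · exact fun hv => ⟨_, ⟨v, hv, rfl⟩, rfl⟩

include h

/-- One center at each location except the decoy: the core serves the decoy at squared distance at
most 2, and the perturbation adds at most 1. -/
theorem opt_le_three {k : ℕ} (hk : Fintype.card (Loc π) = k + 1)
    (he : e * Fintype.card (Σ v : Loc π, Fin (weight v)) ≤ 1) : opt h.points k ≤ 3 := by
  classical
  obtain ⟨C, hC, hCL⟩ := exists_representatives hπ (Finset.univ.erase (decoy : Loc π))
  have hC' : C.card = k := by
    rw [hC, Finset.card_erase_of_mem (Finset.mem_univ _), Finset.card_univ, hk]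
    rfl
  have hcore : core ∈ C.image Sigma.fst := by
    rw [show C.image Sigma.fst = Finset.univ.erase (decoy : Loc π) by convert hCL]
    simp
  have hCne : C.Nonempty := by
    obtain ⟨s, hs, -⟩ := Finset.mem_image.1 hcore
    exact ⟨s, hs⟩
  refine (opt_le h.points (C := C.image p) ?_).trans ((h.cost_le hCne).trans ?_)
  · rw [Finset.card_image_of_injective _ h.injective, hC']
  have h₁ : locCost weight sqDist (C.image Sigma.fst) ≤ 2 := by
    rw [locCost, Finset.sum_eq_single (decoy : Loc π)]
    · have h₂ := setDist_le sqDist (decoy : Loc π) hcore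
      have h₃ : sqDist (decoy : Loc π) core = gram (decoy : Loc π) decoy := by
        simp [sqDist, gram]
      simp only [weight, Nat.cast_one, one_mul]
      exact h₂.trans (h₃.trans_le hπ.gram_decoy.1)
    · intro v _ hv
      rw [h.setDist_eq_zero, mul_zero]
      rw [show C.image Sigma.fst = Finset.univ.erase (decoy : Loc π) by convert hCL]
      simp [hv]
    · exact fun hn => absurd (Finset.mem_univ _) hn
  linarith

/-- At most `k` centers miss one of the `k + 1` locations; it is neither decoy nor core, hence at
squared distance at least `a²` from all others. The two premises sit inside the event because it
must contain all supersets; actual outputs satisfy them. -/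
theorem isSuccess {k : ℕ} (hk : Fintype.card (Loc π) = k + 1) :
    IsSuccess h {C' | C' ⊆ h.points → C'.card ≤ k → (π.a : ℝ) ^ 2 ≤ cost h.points C'} := by
  classical
  intro C C' hCC' hy hc hsub hcard
  let D : Finset (Σ v : Loc π, Fin (weight v)) := Finset.univ.filter fun s => p s ∈ C'
  have hD : D.image p = C' := by
    ext x
    simp only [D, Finset.mem_image, Finset.mem_filter, Finset.mem_univ, true_and]
    constructor
    · rintro ⟨s, hs, rfl⟩
      exact hs
    · intro hx
      obtain ⟨s, rfl⟩ := h.mem_points.1 (hsub hx)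
      exact ⟨s, hx, rfl⟩
  have hCD : C ⊆ D := fun s hs =>
    Finset.mem_filter.2 ⟨Finset.mem_univ _, hCC' (Finset.mem_image_of_mem p hs)⟩
  have hDc : D.card ≤ k := by
    rw [← Finset.card_image_of_injective D h.injective]
    convert hcard
  have hmem : ∀ v : Loc π, v ∈ C.image Sigma.fst → v ∈ D.image Sigma.fst := fun v hv =>
    Finset.image_subset_image hCD (by convert hv)
  have hlt : (D.image Sigma.fst).card < Fintype.card (Loc π) := by
    have := Finset.card_image_le (s := D) (f := Sigma.fst)
    omega
  obtain ⟨v, hv⟩ : ∃ v, v ∉ D.image Sigma.fst := by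
    by_contra hcon
    push Not at hcon
    rw [Finset.eq_univ_iff_forall.2 hcon, Finset.card_univ] at hlt
    exact lt_irrefl _ hlt
  have hy' := hmem decoy (by convert hy)
  have hc' := hmem core (by convert hc)
  have hDne : D.Nonempty := by
    obtain ⟨s, hs, -⟩ := Finset.mem_image.1 hc'
    exact ⟨s, hs⟩
  have h₁ : (π.a : ℝ) ^ 2 ≤ setDist sqDist (D.image Sigma.fst) v := by
    refine le_setDist _ ⟨_, hc'⟩ _ fun u hu => sq_a_le_sqDist hπ h ?_ ?_ ?_
    · rintro rfl
      exact hv hy'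
    · rintro rfl
      exact hv hc'
    · rintro rfl
      exact hv hu
  have h₂ := h.locCost_le_cost hDne
  have h₃ : (weight v : ℝ) * setDist sqDist (D.image Sigma.fst) v ≤
      locCost weight sqDist (D.image Sigma.fst) :=
    Finset.single_le_sum
      (f := fun v => (weight v : ℝ) * setDist sqDist (D.image Sigma.fst) v)
      (fun v _ => mul_nonneg (Nat.cast_nonneg _) (h.setDist_nonneg _ v)) (Finset.mem_univ v)
  have h₄ := le_mul_of_one_le_left (h.setDist_nonneg (D.image Sigma.fst) v) (hπ.one_le_weight v)
  have h₅ : (π.a : ℝ) ^ 2 ≤ cost h.points (D.image p) := by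
    refine (h₁.trans (h₄.trans h₃)).trans ?_
    convert h₂
  convert h₅
  rw [← hD]

open Classical in
omit hπ in
/-- The first step puts a center at the base with probability at least `1 / 2`. -/
theorem le_stepProb_empty {r : Rule d l} (hX : h.points.Nonempty) (hl : 1 ≤ l)
    {Ev : Set (Finset (Pt d))} (m : ℕ) {x : ℝ} (hx : 0 ≤ x)
    (hwb : (2 * l - 1) * (Fintype.card (Σ v : Loc π, Fin (weight v)) : ℝ) ≤ 2 * l * π.wb)
    (hstep : ∀ s : (Σ v : Loc π, Fin (weight v)), s.1 = base →
      x ≤ stepProb h.points hX r Ev m (({s} : Finset _).image p)) :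
    x / 2 ≤ stepProb h.points hX r Ev (m + 1) ∅ := by
  rw [stepProb_succ h.points hX r Ev p h.injective m ∅
    (fun a ha => h.candidatePMF_eq_zero hX _ a ha)]
  have hμ : ∀ s, (candidatePMF h.points hX ∅ (p s)).toReal =
      1 / (Fintype.card (Σ v : Loc π, Fin (weight v)) : ℝ) := fun s => by
    rw [candidatePMF, dif_neg (by simp), PMF.uniformOfFinset_apply,
      if_pos (h.mem_points.2 ⟨s, rfl⟩), h.card_points, ENNReal.toReal_inv, ENNReal.toReal_natCast,
      one_div]
  have key := sum_prod_mul_ge (l := l) (fun s => (candidatePMF h.points hX ∅ (p s)).toReal)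
    (fun s => ENNReal.toReal_nonneg) (h.sum_candidatePMF hX _) Finset.univ
    (Finset.univ.filter fun s => s.1 ∈ ({base} : Finset (Loc π))) ∅ (Finset.subset_univ _)
    (Finset.empty_subset _)
    (fun σ => stepProb h.points hX r Ev m (insert (p (σ (r ∅ (p ∘ σ)))) ∅))
    (fun σ => stepProb_nonneg _ _ _ _ _ _) 0 0 x
    (fun σ hσ => by simp at hσ) (fun σ _ _ => stepProb_nonneg _ _ _ _ _ _)
    (fun σ hσ _ => by
      have hb := hσ (r ∅ (p ∘ σ))
      simp only [Finset.mem_filter, Finset.mem_univ, true_and, Finset.mem_singleton] at hb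
      have := hstep _ hb
      rwa [Finset.image_singleton] at this)
  refine le_trans ?_ key
  have hcard : 0 < Fintype.card (Σ v : Loc π, Fin (weight v)) := by
    rw [← h.card_points]
    exact hX.card_pos
  have hcard' : (0 : ℝ) < Fintype.card (Σ v : Loc π, Fin (weight v)) := by exact_mod_cast hcard
  have hl' : (1 : ℝ) ≤ l := by exact_mod_cast hl
  have hb : ∑ s with s.1 ∈ ({base} : Finset (Loc π)),
      (candidatePMF h.points hX ∅ (p s)).toReal =
      π.wb / (Fintype.card (Σ v : Loc π, Fin (weight v)) : ℝ) := by
    simp only [hμ]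
    have := IsRealization.sum_sigma_filter (w := weight) ({base} : Finset (Loc π))
      (fun _ => 1 / (Fintype.card (Σ v : Loc π, Fin (weight v)) : ℝ))
    rw [this, Finset.sum_singleton, mul_one_div]
    rfl
  rw [hb, Finset.sum_empty, zero_pow (by omega), zero_mul, zero_mul, zero_add, zero_add, sub_zero]
  -- A candidate misses the base with probability at most `1/(2l)`, so by Bernoulli's inequality all
  -- `l` candidates are at the base with probability at least 1/2, whatever the rule.
  have h₁ : 1 + (-(1 / (2 * l : ℝ))) ≤
      π.wb / (Fintype.card (Σ v : Loc π, Fin (weight v)) : ℝ) := by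
    rw [le_div_iff₀ hcard', show (1 + (-(1 / (2 * l : ℝ)))) = (2 * l - 1) / (2 * l) by
      field_simp; ring, div_mul_eq_mul_div, div_le_iff₀ (by positivity)]
    linarith
  have h₂ : 1 / (2 * l : ℝ) ≤ 1 := by
    rw [div_le_one (by positivity)]
    linarith
  have h₃ := one_add_mul_le_pow (show (-2 : ℝ) ≤ -(1 / (2 * l : ℝ)) by linarith) l
  have h₄ := pow_le_pow_left₀ (by linarith) h₁ l
  have h₅ : (l : ℝ) * -(1 / (2 * l)) = -(1 / 2) := by
    field_simp
  rw [h₅] at h₃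
  have := mul_le_mul_of_nonneg_left (h₃.trans h₄) hx
  linarith

end Loc

open Loc in
/-- The hard instance. -/
theorem exists_seeding_hard {π : Params} {Ω : ℝ} (hπ : π.Valid Ω) {k l : ℕ} (hl : 2 ≤ l)
    (hk : Fintype.card (Loc π) = k + 1) {u₀ v₀ : ℕ} (hu₀ : l ≤ u₀ + 1)
    (hv₀ : 2 * π.n + 112 * (π.a : ℝ) ^ 3 + 1 ≤ 15 * π.a ^ 2 * v₀) {V τ : ℝ} (hV : V ≤ 1)
    (hVt : V ≤ 1 - runErr (l * π.n / (30 * π.a ^ 2)) (8 * π.a) v₀ π.t)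
    (hτ₀ : 0 ≤ τ) (hτ : 100 * Ω ^ 3 ≤ τ * π.ρ π.P) (f : ℕ → ℝ) (hfP : f π.P ≤ 0)
    (hfV : ∀ j < π.P, f (j + 1) ≤ V)
    (hf : ∀ j < π.P, f j ≤ f (j + 1) + 1 / (6 * π.P) * (V - f (j + 1)) -
      runErr (l * π.P / (8 * π.n)) 2 u₀ π.s)
    (hwb : (2 * l - 1) * (Fintype.card (Σ v : Loc π, Fin (weight v)) : ℝ) ≤ 2 * l * π.wb)
    {x : ℝ} (hx : 0 ≤ x) (hxf : x ≤ f 0 - k * τ) {β : ℝ} (hβ₀ : 0 ≤ β)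
    (hβ : 3 * β ≤ (π.a : ℝ) ^ 2) :
    ∃ (d : ℕ) (X : Finset (Pt d)) (hX : X.Nonempty), 0 < opt X k ∧
      ∀ r : Rule d l, IsGreedyRule X r → ENNReal.ofReal (x / 2) ≤
        (seedingPMF X hX r k).toOuterMeasure {C | β * opt X k ≤ cost X C} := by
  classical
  have hM : 0 < Fintype.card (Σ v : Loc π, Fin (weight v)) :=
    Fintype.card_pos_iff.2 ⟨⟨base, 0, hπ.wb_pos⟩⟩
  have hM' : (0 : ℝ) < Fintype.card (Σ v : Loc π, Fin (weight v)) := by exact_mod_cast hM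
  obtain ⟨d, p, h⟩ := exists_isRealization hπ.fillerCost_nonneg hπ.weight_pos
    (e := 1 / (Fintype.card (Σ v : Loc π, Fin (weight v)) : ℝ)) (by positivity)
  have he : 1 / (Fintype.card (Σ v : Loc π, Fin (weight v)) : ℝ) *
      (Fintype.card (Σ v : Loc π, Fin (weight v)) : ℝ) ≤ 1 := by
    rw [one_div_mul_cancel hM'.ne']
  have hX : h.points.Nonempty := by
    rw [← Finset.card_pos, h.card_points]
    exact hM
  have hk₁ : 1 ≤ k := by
    rw [card_eq] at hk
    omega
  have hkM : k < h.points.card := by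
    rw [h.card_points]
    have : Fintype.card (Loc π) ≤ Fintype.card (Σ v : Loc π, Fin (weight v)) :=
      Fintype.card_le_of_injective (fun v => ⟨v, 0, hπ.weight_pos v⟩)
        fun u v huv => congrArg Sigma.fst huv
    omega
  refine ⟨d, h.points, hX, opt_pos _ hk₁ hkM, fun r hr => ?_⟩
  have hEv := isSuccess hπ h hk
  obtain ⟨m, rfl⟩ : ∃ m, k = m + 1 := ⟨k - 1, by omega⟩
  have hstep := le_stepProb_empty h (r := r) hX (by omega)
    (Ev := {C' | C' ⊆ h.points → C'.card ≤ m + 1 → (π.a : ℝ) ^ 2 ≤ cost h.points C'}) m hx hwb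
    (fun s hs => by
      have hA : (({s} : Finset (Σ v : Loc π, Fin (weight v))).image Sigma.fst) = {base} := by
        rw [Finset.image_singleton, hs]
      have hmain := (le_stepProb hπ h hr hX hEv hl he hu₀ hv₀ hV hVt hτ₀ hτ f hfP hfV hf m {s}
        (by rw [hA, Finset.card_singleton, hk]; ring)).1 ⟨0, hπ.one_le_P⟩ π.s (by
          rw [hA]
          exact pre_base _)
      refine le_trans ?_ hmain
      have := hf 0 hπ.one_le_P
      push_cast at hxf
      simp only at this ⊢
      linarith)
  refine (ENNReal.ofReal_le_ofReal hstep).trans ?_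
  rw [ofReal_stepProb, ← seedingPMF_eq_iterPMF]
  refine PMF.toOuterMeasure_mono _ fun C hC => ?_
  obtain ⟨hC₁, hC₂⟩ := hC
  obtain ⟨h₁, -, h₂⟩ := card_le_of_mem_support_seedingPMF h.points hX r hk₁ hC₂
  have h₃ := mul_le_mul_of_nonneg_left (opt_le_three hπ h hk he) hβ₀
  have h₄ := hC₁ h₂ h₁
  rw [Set.mem_ofPred_eq]
  linarith

open Loc in
/-- The hard instance in terms of its numerical parameters. -/
theorem exists_seeding_of_params {k l P a s t u₀ v₀ : ℕ} (hl : 2 ≤ l) (hP : 1 ≤ P) (ha : 1 ≤ a)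
    (haP : 8 * a ≤ 9 * P ^ 2) (hk : 3 + 2 * P + 8 * a + P * s + t = k + 1) (hu₀ : l ≤ u₀ + 1)
    (hv₀ : 24 * (P : ℝ) ^ 2 + 112 * (a : ℝ) ^ 3 + 1 ≤ 15 * a ^ 2 * v₀) {V : ℝ} (hV₀ : 0 < V)
    (hV : V ≤ 1)
    (hVt : V ≤ 1 - runErr (l * (12 * P ^ 2) / (30 * a ^ 2)) (8 * a) v₀ t)
    (hVs : runErr (l / (96 * P)) 2 u₀ s ≤ V / (10 * P)) {β : ℝ} (hβ₀ : 0 ≤ β)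
    (hβ : 3 * β ≤ (a : ℝ) ^ 2) :
    ∃ (d : ℕ) (X : Finset (Pt d)) (hX : X.Nonempty), 0 < opt X k ∧
      ∀ r : Rule d l, IsGreedyRule X r → ENNReal.ofReal (V / 48 / 2) ≤
        (seedingPMF X hX r k).toOuterMeasure {C | β * opt X k ≤ cost X C} := by
  have hP' : (1 : ℝ) ≤ P := by exact_mod_cast hP
  have ha' : (1 : ℝ) ≤ a := by exact_mod_cast ha
  have hk' : (1 : ℝ) ≤ k := by exact_mod_cast (show 1 ≤ k by omega)
  have hl' : (2 : ℝ) ≤ l := by exact_mod_cast hl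
  let Ω : ℝ := (P * (P + 1) + 1 + (12 * P ^ 2 : ℕ) + (8 * a : ℕ)) + P * s + t * (15 * a ^ 2) +
    30 * a ^ 3
  have hΩ : 1 ≤ Ω := by
    have : (0 : ℝ) ≤ P * (P + 1) + (12 * P ^ 2 : ℕ) + (8 * a : ℕ) + P * s + t * (15 * a ^ 2) +
      30 * a ^ 3 := by positivity
    linarith
  -- Over all `k` steps the transitions lose at most `V/48`, half of the value `f 0 = V/24` below.
  -- The scale `B` is then taken so large that each transition fails with probability at most `τ`.
  let τ : ℝ := V / (48 * k)
  have hτ : 0 < τ := by positivity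
  have hτ₁ : τ ≤ 1 := by
    rw [div_le_one (by positivity)]
    linarith
  let B : ℝ := 100 * Ω ^ 3 / τ
  have hBτ : 100 * Ω ^ 3 = τ * B := (mul_div_cancel₀ _ hτ.ne').symm
  have hB : 100 * Ω ^ 3 ≤ B := by
    have : 0 ≤ B := by positivity
    rw [hBτ]
    exact mul_le_of_le_one_left this hτ₁
  -- The base outweighs all other points by the factor `2l`, as the first step requires.
  let π : Params := ⟨P, s, 8 * a, t, 2 * l * (P * P + P + 1 + 12 * P ^ 2 + 8 * a + P * s + t),
    12 * P ^ 2, a, fun j => B ^ 4 ^ (P - j)⟩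
  have hρP : π.ρ π.P = B := by simp [π]
  have hπ : π.Valid Ω := by
    refine ⟨hP, ha, rfl, ?_, ?_, rfl, ?_, hΩ, ?_, ?_, ?_, ?_, ?_⟩
    · simp only [π]
      nlinarith
    · simp only [π]
      positivity
    · intro j hj
      simp only [π] at hj ⊢
      rw [← pow_mul, ← pow_succ]
      congr 2
      omega
    · rw [hρP]
      exact hB
    all_goals
      simp only [π, Ω]
      have h₁ : (0 : ℝ) ≤ P * (P + 1) + 1 + (12 * P ^ 2 : ℕ) + (8 * a : ℕ) := by positivity
      have h₂ : (0 : ℝ) ≤ P * s := by positivity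
      have h₃ : (0 : ℝ) ≤ t * (15 * a ^ 2) := by positivity
      have h₄ : (0 : ℝ) ≤ 30 * a ^ 3 := by positivity
      linarith
  have hcard : (Fintype.card (Σ v : Loc π, Fin (weight v)) : ℝ) =
      π.wb + (P * P + P + 1 + 12 * P ^ 2 + 8 * a + P * s + t) := by
    rw [Fintype.card_sigma]
    simp only [Fintype.card_fin]
    rw [sum_eq]
    simp [weight, π]
    ring
  -- A linear lower bound for the success probability from phase `j` on. Each phase has to yield
  -- `V/(24P)`, which is available since `23/144 - 1/10` exceeds `1/24`.
  let f : ℕ → ℝ := fun j => V / 24 * ((P - j) / P)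
  have hf₁ : ∀ j, f (j + 1) = f j - V / (24 * P) := fun j => by
    simp only [f]
    push_cast
    field_simp
    ring
  have hf₀ : ∀ j, f j ≤ V / 24 := fun j => by
    simp only [f]
    refine mul_le_of_le_one_right (by positivity) ?_
    rw [div_le_one (by positivity)]
    have : (0 : ℝ) ≤ j := Nat.cast_nonneg j
    linarith
  refine exists_seeding_hard hπ hl (u₀ := u₀) (v₀ := v₀) (V := V) (τ := τ) ?_ hu₀ ?_ hV ?_ hτ.le ?_
    f ?_ ?_ ?_ ?_ (by positivity) ?_ hβ₀ hβ
  · rw [card_eq]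
    exact hk
  · simp only [π]
    push_cast
    linarith
  · simp only [π]
    push_cast
    exact hVt
  · rw [hρP]
    exact hBτ.le
  · simp [f, π]
  · intro j _
    linarith [hf₀ (j + 1)]
  · intro j _
    have h₁ : (l * π.P / (8 * π.n) : ℝ) = l / (96 * P) := by
      simp only [π]
      push_cast
      field_simp
      norm_num
    rw [h₁]
    have h₂ : 1 / (6 * (P : ℝ)) * (V - V / 24) ≤ 1 / (6 * (P : ℝ)) * (V - f (j + 1)) :=
      mul_le_mul_of_nonneg_left (by linarith [hf₀ (j + 1)]) (by positivity)
    have h₃ : V / (24 * P) + V / (10 * P) ≤ 1 / (6 * (P : ℝ)) * (V - V / 24) := by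
      have : 1 / (6 * (P : ℝ)) * (V - V / 24) - (V / (24 * P) + V / (10 * P)) =
        (13 / 720) * (V / P) := by
        field_simp
        ring
      have h₄ : 0 ≤ V / P := by positivity
      linarith
    have h₅ := hf₁ j
    have h₆ : runErr (l / (96 * P)) 2 u₀ π.s ≤ V / (10 * P) := hVs
    change f j ≤ f (j + 1) + 1 / (6 * (P : ℝ)) * (V - f (j + 1)) - runErr (l / (96 * P)) 2 u₀ π.s
    linarith
  · have hw : (π.wb : ℝ) = 2 * l * (P * P + P + 1 + 12 * P ^ 2 + 8 * a + P * s + t) := by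
      simp only [π]
      push_cast
      rfl
    have hR : (0 : ℝ) ≤ P * P + P + 1 + 12 * P ^ 2 + 8 * a + P * s + t := by positivity
    rw [hcard, hw]
    generalize (P * P + P + 1 + 12 * P ^ 2 + 8 * a + P * s + t : ℝ) = R at hR ⊢
    linarith
  · have : f 0 = V / 24 := by
      simp only [f, Nat.cast_zero, sub_zero]
      rw [div_self (by positivity), mul_one]
    have h₁ : k * τ = V / 48 := by
      simp only [τ]
      field_simp
    rw [this, h₁]
    linarith

/-! ### Numerical choice of the parameters -/

/-- A bound for the error of a long run. -/
theorem runErr_le_add {γ K : ℝ} (hγ : 0 ≤ γ) {u₀ u : ℕ} (hu₀ : 1 ≤ u₀) {x : ℝ} (hx : 1 ≤ x)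
    (h : x * (u₀ + 1) ≤ u + 1) :
    runErr γ K u₀ u ≤ Real.exp (-(γ * Real.log x)) + K ^ 2 / u₀ := by
  have hu : u₀ ≤ u := by
    have : (u₀ : ℝ) ≤ u := by nlinarith [(Nat.cast_nonneg u₀ : (0 : ℝ) ≤ u₀)]
    exact_mod_cast this
  refine (runErr_le hγ hu₀ hu).trans (add_le_add ?_ ?_)
  · refine Real.exp_le_exp.2 (neg_le_neg (mul_le_mul_of_nonneg_left ?_ hγ))
    refine Real.log_le_log (by linarith) ?_
    rwa [le_div_iff₀ (by positivity)]
  · rw [← mul_one_div (K ^ 2) (u₀ : ℝ)]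
    refine mul_le_mul_of_nonneg_left ?_ (sq_nonneg K)
    have : (0 : ℝ) ≤ 1 / u := by positivity
    linarith

theorem log_ge_half {T : ℝ} (hT : 2 ≤ T) : 1 / 2 ≤ Real.log T := by
  have h₁ := Real.log_le_log (by norm_num) hT
  linarith [Real.log_two_gt_d9]

theorem large_of_log_le {T : ℝ} (hT : 2 ≤ T) (hT₁ : 8000 * Real.log T ≤ √T) :
    16000000 ≤ T := by
  have hlog := log_ge_half hT
  have hRR : √T * √T = T := Real.mul_self_sqrt (by linarith)
  nlinarith

/-- The number of phases and the distance scale of the satellites. -/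
theorem exists_scales {T : ℝ} (hT : 2 ≤ T) (hT₁ : 8000 * Real.log T ≤ √T) :
    ∃ P a : ℕ, (1 : ℝ) ≤ P ∧ (P : ℝ) ≤ T ∧ P * (1000 * Real.log T) ≤ T ∧ (P : ℝ) ≤ a ∧
      8 * (a : ℝ) ≤ 9 * P ^ 2 ∧ 16 * (P ^ 2 * T) ≤ (a : ℝ) ^ 2 ∧
      (a : ℝ) ^ 2 ≤ 25 * (P ^ 2 * T) ∧ T ^ 3 / Real.log T ^ 2 ≤ 4000000 * (P ^ 2 * T) := by
  have hlog := log_ge_half hT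
  have hTb := large_of_log_le hT hT₁
  obtain ⟨R, hR⟩ : ∃ R, R = √T := ⟨_, rfl⟩
  have hRR : R * R = T := by rw [hR]; exact Real.mul_self_sqrt (by linarith)
  rw [← hR] at hT₁
  have hR₁ : 4000 ≤ R := by linarith
  have hy₀ : 0 ≤ T / (1000 * Real.log T) := by positivity
  -- As many phases as possible while `T / P` stays a large multiple of `log T`. The hypothesis on
  -- `√T` gives `P ≥ 4 √T`, which makes room for the `8a` satellites when `a` is about `4 P √T`.
  obtain ⟨P, hP⟩ : ∃ P, P = ⌊T / (1000 * Real.log T)⌋₊ := ⟨_, rfl⟩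
  have hPy : (P : ℝ) ≤ T / (1000 * Real.log T) := by rw [hP]; exact Nat.floor_le hy₀
  have hyP : T / (1000 * Real.log T) < P + 1 := by rw [hP]; exact Nat.lt_floor_add_one _
  have hyR : 8 * R ≤ T / (1000 * Real.log T) := by
    rw [le_div_iff₀ (by positivity)]
    refine le_trans ?_ hRR.le
    have := mul_le_mul_of_nonneg_left hT₁ (show 0 ≤ R by linarith)
    linarith
  have hPy' : T / (2000 * Real.log T) ≤ P := by
    have : T / (2000 * Real.log T) = T / (1000 * Real.log T) / 2 := by
      field_simp
      norm_num
    linarith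
  have hPR : 4 * R ≤ P := by linarith
  have hP₁ : (1 : ℝ) ≤ P := by linarith
  have hPlog : P * (1000 * Real.log T) ≤ T := by
    rwa [le_div_iff₀ (by positivity)] at hPy
  have hPT : (P : ℝ) ≤ T := by
    refine le_trans ?_ hPlog
    exact le_mul_of_one_le_right (by linarith) (by linarith)
  have hPR₁ : P ≤ P * R := le_mul_of_one_le_right (by linarith) (by linarith)
  have ha₁ : 4 * (P * R) ≤ (⌈4 * (P * R)⌉₊ : ℝ) := Nat.le_ceil _
  have ha₃ : (⌈4 * (P * R)⌉₊ : ℝ) < 4 * (P * R) + 1 := Nat.ceil_lt_add_one (by positivity)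
  generalize ⌈4 * (P * R)⌉₊ = a at ha₁ ha₃
  refine ⟨P, a, hP₁, hPT, hPlog, by linarith, ?_, ?_, ?_, ?_⟩
  · have h₂ : P * (4 * R) ≤ P * P := mul_le_mul_of_nonneg_left hPR (by linarith)
    linarith
  · calc 16 * (P ^ 2 * T) = (4 * (P * R)) ^ 2 := by rw [← hRR]; ring
      _ ≤ _ := pow_le_pow_left₀ (by positivity) ha₁ 2
  · calc (a : ℝ) ^ 2 ≤ (5 * (P * R)) ^ 2 := pow_le_pow_left₀ (by positivity) (by linarith) 2
      _ = _ := by rw [← hRR]; ring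
  · have h₁ : (T / (2000 * Real.log T)) ^ 2 ≤ (P : ℝ) ^ 2 := pow_le_pow_left₀ (by positivity) hPy' 2
    have h₂ : T ^ 3 / Real.log T ^ 2 = 4000000 * ((T / (2000 * Real.log T)) ^ 2 * T) := by
      field_simp
      norm_num
    rw [h₂]
    have h₃ := mul_le_mul_of_nonneg_right h₁ (show 0 ≤ T by linarith)
    linarith

/-- The error of the run through the light fillers. -/
theorem runErr_light_le {k l P a t : ℕ} {T : ℝ} (hT : T = l * Real.log k) (hk : 1 ≤ √(k : ℝ))
    (ha : 1 ≤ a) (haT : (a : ℝ) ^ 2 ≤ 25 * (P ^ 2 * T))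
    (hak : 2 * (64000 * (a : ℝ) ^ 2 + 1) ≤ √k) (ht : (k : ℝ) / 2 ≤ t + 1) :
    1 / 1000 ≤ 1 - runErr (l * (12 * P ^ 2) / (30 * a ^ 2)) (8 * a) (64000 * a ^ 2) t := by
  have hkk : √(k : ℝ) * √(k : ℝ) = k := Real.mul_self_sqrt (Nat.cast_nonneg k)
  have hlogs : Real.log √(k : ℝ) = Real.log k / 2 := Real.log_sqrt (Nat.cast_nonneg k)
  have ha' : (1 : ℝ) ≤ a := by exact_mod_cast ha
  have h₁ := runErr_le_add (γ := l * (12 * P ^ 2) / (30 * a ^ 2)) (K := 8 * a) (by positivity)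
    (Nat.mul_pos (by norm_num) (pow_pos ha 2) : 1 ≤ 64000 * a ^ 2) hk (u := t) (by
      push_cast
      have := mul_le_mul_of_nonneg_left hak (show 0 ≤ √(k : ℝ) by linarith)
      linarith)
  have h₂ : (8 * a : ℝ) ^ 2 / (64000 * a ^ 2 : ℕ) = 1 / 1000 := by
    push_cast
    field_simp
    norm_num
  -- The exponent equals `P² T / (5 a²)`, at least `1/125` by the upper bound on `a²`. The threshold
  -- `64000 a²` turns the failure term into `1/1000`, leaving a constant chance of reaching the
  -- core.
  obtain ⟨y, hy⟩ : ∃ y, y = l * (12 * P ^ 2) / (30 * (a : ℝ) ^ 2) * Real.log √(k : ℝ) := ⟨_, rfl⟩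
  have h₃ : 1 / 125 ≤ y := by
    rw [hy, hlogs, div_mul_eq_mul_div, le_div_iff₀ (by positivity)]
    have : l * (12 * (P : ℝ) ^ 2) * (Real.log k / 2) = 6 * (P ^ 2 * T) := by rw [hT]; ring
    rw [this]
    linarith
  have h₄ : Real.exp (-y) ≤ 125 / 126 := by
    rw [Real.exp_neg, inv_le_comm₀ (Real.exp_pos _) (by norm_num)]
    have := Real.add_one_le_exp y
    norm_num at this ⊢
    linarith
  rw [h₂, ← hy] at h₁
  linarith

/-- The error of the run through the fillers of a phase. -/
theorem runErr_filler_le {k l P s : ℕ} {T : ℝ} (hT : T = l * Real.log k) (hk : 1 ≤ √(k : ℝ))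
    (hT₁ : 16000000 ≤ T) (hl : 2 ≤ l) (hlT : (l : ℝ) ≤ T) (hP : (1 : ℝ) ≤ P) (hPT : (P : ℝ) ≤ T)
    (hPlog : P * (1000 * Real.log T) ≤ T) (hT₂ : 20000000 * T ^ 3 ≤ √k)
    (hs : (k : ℝ) ≤ 4 * P * (s + 1)) :
    runErr (l / (96 * P)) 2 (80000 * P * l) s ≤ 1 / 1000 / (10 * P) := by
  have hkk : √(k : ℝ) * √(k : ℝ) = k := Real.mul_self_sqrt (Nat.cast_nonneg k)
  have hlogs : Real.log √(k : ℝ) = Real.log k / 2 := Real.log_sqrt (Nat.cast_nonneg k)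
  have hP' : 1 ≤ P := by exact_mod_cast hP
  have hl' : (2 : ℝ) ≤ l := by exact_mod_cast hl
  have hlog := log_ge_half (show 2 ≤ T by linarith)
  have hT13 : T ≤ T ^ 3 := le_self_pow₀ (by linarith) (by norm_num)
  have h₁ := runErr_le_add (γ := l / (96 * P)) (K := 2) (by positivity)
    (Nat.mul_pos (Nat.mul_pos (by norm_num) hP') (by omega) : 1 ≤ 80000 * P * l) hk (u := s) (by
      push_cast
      have h₂ : (P : ℝ) ^ 2 * l ≤ T ^ 3 := by
        calc (P : ℝ) ^ 2 * l ≤ T ^ 2 * T := by gcongr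
          _ = T ^ 3 := by ring
      have h₃ : 4 * P * (80000 * P * l + 1) ≤ √(k : ℝ) := by
        have : 4 * P * (80000 * P * l + 1) = 320000 * ((P : ℝ) ^ 2 * l) + 4 * P := by ring
        linarith
      have h₄ := mul_le_mul_of_nonneg_left h₃ (show 0 ≤ √(k : ℝ) by linarith)
      have h₅ : 4 * P * (√(k : ℝ) * (80000 * P * l + 1)) ≤ 4 * P * (s + 1) := by linarith
      exact le_of_mul_le_mul_left h₅ (by linarith))
  have h₂ : (2 : ℝ) ^ 2 / (80000 * P * l : ℕ) ≤ 1 / (40000 * P) := by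
    push_cast
    rw [div_le_div_iff₀ (by positivity) (by positivity)]
    have := mul_le_mul_of_nonneg_left hl' (show (0 : ℝ) ≤ P by linarith)
    linarith
  -- The exponent equals `T / (192 P)`, so the bound on `P log T` makes `exp (-y)` at most `1/T²`,
  -- well below `1/P`. The error of a phase has to be `O(1/P)`, and this is what forces `P` down to
  -- order `T / log T`.
  obtain ⟨y, hy⟩ : ∃ y, y = l / (96 * P) * Real.log √(k : ℝ) := ⟨_, rfl⟩
  have h₃ : 2 * Real.log T ≤ y := by
    rw [hy, hlogs, div_mul_eq_mul_div, le_div_iff₀ (by positivity)]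
    have : l * (Real.log k / 2) = T / 2 := by rw [hT]; ring
    rw [this]
    have : 0 ≤ P * Real.log T := by positivity
    linarith
  have h₄ : Real.exp (-y) ≤ 1 / T ^ 2 := by
    have h₅ : Real.exp (2 * Real.log T) = T ^ 2 := by
      rw [two_mul, Real.exp_add, Real.exp_log (by linarith), sq]
    rw [Real.exp_neg, ← one_div, ← h₅]
    exact one_div_le_one_div_of_le (Real.exp_pos _) (Real.exp_le_exp.2 h₃)
  have h₆ : 1 / T ^ 2 ≤ 3 / (40000 * P) := by
    rw [div_le_div_iff₀ (by positivity) (by positivity)]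
    nlinarith
  have h₇ : 1 / 1000 / (10 * (P : ℝ)) = 3 / (40000 * P) + 1 / (40000 * P) := by
    field_simp
    norm_num
  rw [← hy] at h₁
  rw [h₇]
  exact h₁.trans (add_le_add (h₄.trans h₆) h₂)

/-- The hard instance for large `k`, with `T = l * log k`. -/
theorem exists_seeding_large {k l : ℕ} {T : ℝ} (hl : 2 ≤ l) (hL : 1 ≤ Real.log k)
    (hT : T = l * Real.log k) (hT₁ : 8000 * Real.log T ≤ √T) (hT₂ : 20000000 * T ^ 3 ≤ √k) :
    ∃ (d : ℕ) (X : Finset (Pt d)) (hX : X.Nonempty), 0 < opt X k ∧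
      ∀ r : Rule d l, IsGreedyRule X r → ENNReal.ofReal (1 / 1000 / 48 / 2) ≤
        (seedingPMF X hX r k).toOuterMeasure
          {C | 1 / 1000000 * (T ^ 3 / Real.log T ^ 2) * opt X k ≤ cost X C} := by
  have hl' : (2 : ℝ) ≤ l := by exact_mod_cast hl
  have hT2 : 2 ≤ T := by rw [hT]; nlinarith
  have hlT : (l : ℝ) ≤ T := by rw [hT]; nlinarith
  have hTb := large_of_log_le hT2 hT₁
  have hT3 : 1 ≤ T ^ 3 := one_le_pow₀ (by linarith)
  have hT13 : T ≤ T ^ 3 := le_self_pow₀ (by linarith) (by norm_num)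
  have hk₁ : 1 ≤ √(k : ℝ) := by linarith
  have hkk : √(k : ℝ) * √(k : ℝ) = k := Real.mul_self_sqrt (Nat.cast_nonneg k)
  have hkk' : √(k : ℝ) ≤ k := by
    have := mul_le_mul_of_nonneg_left hk₁ (show 0 ≤ √(k : ℝ) by linarith)
    linarith
  obtain ⟨P, a, hP₁, hPT, hPlog, haP₁, haP, ha2₁, ha2₂, hβ⟩ := exists_scales hT2 hT₁
  have hP₁' : 1 ≤ P := by exact_mod_cast hP₁
  have ha1 : (1 : ℝ) ≤ a := by linarith
  have ha1' : 1 ≤ a := by exact_mod_cast ha1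
  have hP2T : P ^ 2 * T ≤ T ^ 3 := by
    calc (P : ℝ) ^ 2 * T ≤ T ^ 2 * T := by gcongr
      _ = T ^ 3 := by ring
  have haa : (a : ℝ) ≤ a ^ 2 := le_self_pow₀ ha1 (by norm_num)
  -- The fillers of all phases use at most a quarter of the locations; `t` below takes what is left,
  -- about half of `k` or more.
  obtain ⟨s, hs⟩ : ∃ s, s = k / (4 * P) := ⟨_, rfl⟩
  have hs₁ : 4 * (P * s) ≤ k := by
    rw [hs, ← mul_assoc]
    exact Nat.mul_div_le k (4 * P)
  have hs₂ : (k : ℝ) ≤ 4 * P * (s + 1) := by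
    have : k < 4 * P * (s + 1) := by
      rw [hs]
      exact Nat.lt_mul_div_succ k (by omega)
    exact_mod_cast this.le
  have hsmall : 12 + 8 * P + 32 * a ≤ k := by
    have h₃ : (12 + 8 * P + 32 * a : ℝ) ≤ √k := by linarith
    exact_mod_cast h₃.trans hkk'
  obtain ⟨t, ht⟩ : ∃ t, 3 + 2 * P + 8 * a + P * s + t = k + 1 :=
    ⟨k + 1 - (3 + 2 * P + 8 * a + P * s), by omega⟩
  have ht₂ : (k : ℝ) / 2 ≤ t + 1 := by
    have h₁ : k ≤ 2 * (t + 1) := by omega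
    have h₂ : (k : ℝ) ≤ 2 * (t + 1) := by exact_mod_cast h₁
    linarith
  refine exists_seeding_of_params (u₀ := 80000 * P * l) (v₀ := 64000 * a ^ 2) hl hP₁'
    ha1' (by exact_mod_cast haP) ht ?_ ?_ (by norm_num) (by norm_num)
    (runErr_light_le hT hk₁ ha1' ha2₂ (by linarith) ht₂)
    (runErr_filler_le hT hk₁ hTb hl hlT hP₁ hPT hPlog hT₂ hs₂)
    (by positivity) (by linarith)
  · have : 1 * l ≤ 80000 * P * l := Nat.mul_le_mul_right l (by omega)
    omega
  · push_cast
    have h₁ : (P : ℝ) ^ 2 ≤ a ^ 4 := by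
      calc (P : ℝ) ^ 2 ≤ (a : ℝ) ^ 2 := by gcongr
        _ ≤ (a : ℝ) ^ 4 := pow_le_pow_right₀ ha1 (by norm_num)
    have h₂ : (a : ℝ) ^ 3 ≤ a ^ 4 := pow_le_pow_right₀ ha1 (by norm_num)
    have h₃ : (1 : ℝ) ≤ a ^ 4 := one_le_pow₀ ha1
    have h₄ : 15 * (a : ℝ) ^ 2 * (64000 * a ^ 2) = 960000 * a ^ 4 := by ring
    linarith

/-- The range in which the hard instance for large `k` applies. -/
theorem exists_large : ∃ K : ℕ, 1 ≤ K ∧ ∀ k l : ℕ, K ≤ k → 2 ≤ l →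
    (l : ℝ) ≤ (k : ℝ) ^ (1 / 10 : ℝ) → 1 ≤ Real.log k ∧
      8000 * Real.log (l * Real.log k) ≤ √(l * Real.log k) ∧
      20000000 * (l * Real.log k) ^ 3 ≤ √k := by
  have h₁ : ∀ᶠ x : ℝ in Filter.atTop, 8000 * Real.log x ≤ √x := by
    have := (isLittleO_log_rpow_atTop (show (0 : ℝ) < 1 / 2 by norm_num)).bound
      (show (0 : ℝ) < 1 / 8000 by norm_num)
    filter_upwards [this, Filter.eventually_ge_atTop 1] with x hx hx₁
    rw [Real.norm_of_nonneg (Real.log_nonneg hx₁), Real.norm_of_nonneg (by positivity),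
      ← Real.sqrt_eq_rpow] at hx
    linarith
  obtain ⟨T₀, hT₀⟩ := Filter.eventually_atTop.1 h₁
  have h₂ : ∀ᶠ x : ℝ in Filter.atTop, Real.log x ≤ 1 / 300 * x ^ (1 / 15 : ℝ) ∧
      max 1 T₀ ≤ Real.log x ∧ 1 ≤ x := by
    have := (isLittleO_log_rpow_atTop (show (0 : ℝ) < 1 / 15 by norm_num)).bound
      (show (0 : ℝ) < 1 / 300 by norm_num)
    filter_upwards [this, Filter.eventually_ge_atTop 1,
      Real.tendsto_log_atTop.eventually_ge_atTop (max 1 T₀)] with x hx hx₁ hx₂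
    rw [Real.norm_of_nonneg (Real.log_nonneg hx₁), Real.norm_of_nonneg (by positivity)] at hx
    exact ⟨hx, hx₂, hx₁⟩
  obtain ⟨K, hK⟩ := Filter.eventually_atTop.1 h₂
  refine ⟨max 1 ⌈K⌉₊, le_max_left _ _, fun k l hk hl hlk => ?_⟩
  have hkK : K ≤ k := (Nat.le_ceil K).trans (by exact_mod_cast (le_max_right _ _).trans hk)
  obtain ⟨h₃, h₄, h₅⟩ := hK k hkK
  have hL : 1 ≤ Real.log k := (le_max_left _ _).trans h₄
  have hl' : (2 : ℝ) ≤ l := by exact_mod_cast hl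
  have hk₀ : (0 : ℝ) ≤ k := Nat.cast_nonneg k
  refine ⟨hL, hT₀ _ ?_, ?_⟩
  · have := (le_max_right 1 T₀).trans h₄
    nlinarith
  -- The exponents add up to `3/10 + 3 · 1/15 = 1/2`, which is where `ℓ ≤ k ^ 0.1` enters; the
  -- constants work since `20000000 < 300³`.
  · have h₆ : (l : ℝ) ^ 3 ≤ (k : ℝ) ^ (3 / 10 : ℝ) := by
      calc (l : ℝ) ^ 3 ≤ ((k : ℝ) ^ (1 / 10 : ℝ)) ^ 3 := pow_le_pow_left₀ (by linarith) hlk 3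
        _ = _ := by
          rw [← Real.rpow_natCast, ← Real.rpow_mul hk₀]
          norm_num
    have h₇ : Real.log k ^ 3 ≤ (1 / 300) ^ 3 * (k : ℝ) ^ (1 / 5 : ℝ) := by
      calc Real.log k ^ 3 ≤ (1 / 300 * (k : ℝ) ^ (1 / 15 : ℝ)) ^ 3 :=
            pow_le_pow_left₀ (by linarith) h₃ 3
        _ = _ := by
          rw [mul_pow, ← Real.rpow_natCast (_ ^ _), ← Real.rpow_mul hk₀]
          norm_num
    have h₈ : (k : ℝ) ^ (3 / 10 : ℝ) * (k : ℝ) ^ (1 / 5 : ℝ) = √k := by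
      rw [← Real.rpow_add (by linarith), Real.sqrt_eq_rpow]
      norm_num
    have h₉ := mul_le_mul h₆ h₇ (by positivity) (by positivity)
    rw [mul_pow]
    have : 0 ≤ √(k : ℝ) := Real.sqrt_nonneg _
    calc 20000000 * ((l : ℝ) ^ 3 * Real.log k ^ 3) ≤
        20000000 * ((k : ℝ) ^ (3 / 10 : ℝ) * ((1 / 300) ^ 3 * (k : ℝ) ^ (1 / 5 : ℝ))) := by linarith
      _ = 20000000 * (1 / 300) ^ 3 * ((k : ℝ) ^ (3 / 10 : ℝ) * (k : ℝ) ^ (1 / 5 : ℝ)) := by ring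
      _ ≤ √k := by
        rw [h₈]
        linarith

end KMeans

end

/-! ### Combination of small and large k -/

theorem mainTheorem3 :
    ∃ α p : ℝ, 0 < α ∧ 0 < p ∧
      ∀ k l : ℕ, 2 ≤ l → (l : ℝ) ≤ (k : ℝ) ^ (1 / 10 : ℝ) →
        ∃ (d : ℕ) (X : Finset (KMeans.Pt d)) (hX : X.Nonempty),
          0 < KMeans.opt X k ∧
          ∀ r : KMeans.Rule d l, KMeans.IsGreedyRule X r →
            ENNReal.ofReal p ≤ (KMeans.seedingPMF X hX r k).toOuterMeasure
              {C | α * ((l : ℝ) ^ 3 * Real.log k ^ 3 / Real.log (l * Real.log k) ^ 2) *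
                KMeans.opt X k ≤ KMeans.cost X C} := by
  obtain ⟨K, hK₁, hK⟩ := KMeans.exists_large
  have hK₁' : (1 : ℝ) ≤ K := by exact_mod_cast hK₁
  -- For `k < K` both `ℓ` and `log k` are at most `K`, so dividing by `K ^ 6` pushes the claimed
  -- ratio below 1, where any `k + 1` points serve.
  refine ⟨1 / (1000000 * K ^ 6), 1 / 1000 / 48 / 2, by positivity, by norm_num,
    fun k l hl hlk => ?_⟩
  have hl' : (2 : ℝ) ≤ l := by exact_mod_cast hl
  have hK6 : (1 : ℝ) ≤ K ^ 6 := one_le_pow₀ hK₁'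
  have hpos : 0 ≤ (l : ℝ) ^ 3 * Real.log k ^ 3 / Real.log (l * Real.log k) ^ 2 := by
    have := Real.log_natCast_nonneg k
    positivity
  rcases Nat.lt_or_ge k K with hkK | hkK
  -- The hypotheses `2 ≤ ℓ ≤ k ^ 0.1` exclude `k < 1024`, which keeps the logarithm in the
  -- denominator at least 1.
  · have hk : (1024 : ℝ) ≤ k := by
      have h₁ := pow_le_pow_left₀ (by norm_num) (hl'.trans hlk) 10
      rw [← Real.rpow_natCast (_ ^ _), ← Real.rpow_mul (Nat.cast_nonneg k)] at h₁
      norm_num at h₁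
      exact_mod_cast h₁
    have hk₁ : 1 ≤ k := by exact_mod_cast (show (1 : ℝ) ≤ k by linarith)
    refine KMeans.exists_seeding_trivial hk₁ ?_ (by norm_num)
    have hlog : 2 ≤ Real.log k := by
      rw [Real.le_log_iff_exp_le (by linarith)]
      have h₁ : Real.exp 2 = Real.exp 1 ^ 2 := by rw [← Real.exp_nat_mul]; norm_num
      have h₂ := Real.exp_one_lt_d9
      have h₃ := Real.exp_pos 1
      rw [h₁]
      nlinarith
    have hlogT : 1 ≤ Real.log (l * Real.log k) := by
      rw [Real.le_log_iff_exp_le (by positivity)]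
      have h₂ := Real.exp_one_lt_d9
      nlinarith
    have hkK' : (k : ℝ) ≤ K := by exact_mod_cast hkK.le
    have hlK : (l : ℝ) ≤ K := by
      refine hlk.trans (le_trans ?_ hkK')
      calc (k : ℝ) ^ (1 / 10 : ℝ) ≤ (k : ℝ) ^ (1 : ℝ) :=
            Real.rpow_le_rpow_of_exponent_le (by linarith) (by norm_num)
        _ = k := Real.rpow_one _
    have hlogK : Real.log k ≤ K := by
      have := Real.log_le_sub_one_of_pos (show (0 : ℝ) < k by linarith)
      linarith
    have h₁ : (l : ℝ) ^ 3 * Real.log k ^ 3 / Real.log (l * Real.log k) ^ 2 ≤ K ^ 6 := by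
      refine (div_le_self (by positivity) (one_le_pow₀ hlogT)).trans ?_
      calc (l : ℝ) ^ 3 * Real.log k ^ 3 ≤ (K : ℝ) ^ 3 * (K : ℝ) ^ 3 := by
            gcongr
        _ = (K : ℝ) ^ 6 := by ring
    rw [div_mul_eq_mul_div, one_mul, div_le_one (by positivity)]
    linarith
  · obtain ⟨h₁, h₂, h₃⟩ := hK k l hkK hl hlk
    obtain ⟨d, X, hX, hopt, hr⟩ := KMeans.exists_seeding_large hl h₁ rfl h₂ h₃
    refine ⟨d, X, hX, hopt, fun r hr' => (hr r hr').trans ?_⟩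
    refine (KMeans.seedingPMF X hX r k).toOuterMeasure.mono fun C hC => ?_
    rw [Set.mem_ofPred_eq] at hC ⊢
    refine le_trans ?_ hC
    rw [mul_pow]
    refine mul_le_mul_of_nonneg_right (mul_le_mul_of_nonneg_right ?_ hpos) hopt.le
    exact one_div_le_one_div_of_le (by norm_num) (by linarith)
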